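/- Let $d\ge 2$ be an integer and let $\rho=\sum_{ijkl}\rho_{ij,kl}|ij\rangle\langle kl|$ be a state (density matrix) on $\mathbb{C}^d\otimes\mathbb{C}^d$. Write $\rho^{\Gamma}=\sum_{ijkl}\rho_{ij,kl}|il\rangle\langle kj|$ for its partial transpose, $\mathcal{R}(\rho)=\sum_{ijkl}\rho_{ij,kl}|ik\rangle\langle jl|$ for its realigned matrix, and $\|M\|_1=\mathrm{tr}\sqrt{M^\dagger M}$ for the trace norm. For a unit vector $|\Phi\rangle\in\mathbb{C}^d\otimes\mathbb{C}^d$ with reduced state $\rho_A=\mathrm{tr}_B|\Phi\rangle\langle\Phi|$ put $$C^t_q(|\Phi\rangle)=1-\mathrm{tr}\,\rho_A^q+\mathrm{tr}(I-\rho_A)-\mathrm{tr}\,(I-\rho_A)^q ,$$ and let $$C^t_q(\rho)=\inf\sum_i p_i\,C^t_q(|\Phi_i\rangle)$$ be its convex roof, the infimum being over all finite decompositions $\rho=\sum_i p_i|\Phi_i\rangle\langle\Phi_i|$ with unit vectors $|\Phi_i\rangle$, $p_i\ge 0$ and $\sum_i p_i=1$. (i) If $d\ge 3$ and $q\ge 2$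 is real, or $d=2$ and $q\ge 4$ is real, then $$C^t_q(\rho)\ \ge\ \frac{d-d^{1-q}\bigl(1+(d-1)^q\bigr)}{(d-1)^2}\,\Bigl[\max\bigl(\|\rho^{\Gamma}\|_1,\|\mathcal{R}(\rho)\|_1\bigr)-1\Bigr]^2 .$$ (ii) Let $d=2$, let $s\approx 3.339$ (any real $s$ with $|s-3.339|\le 0.001$, in particular $s=3.33902$), and let $s\le q<4$. Then $$C^t_q(\rho)\ \ge\ \frac{1-2^{1-q}}{1-2^{1-s}}\,\Bigl[\max\bigl(\|\rho^{\Gamma}\|_1,\|\mathcal{R}(\rho)\|_1\bigr)-1\Bigr]^2 ,$$ and the inequality is strict whenever $\rho$ is entangled (not separable). -/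

import Mathlib

open scoped Matrix Kronecker ComplexOrder

namespace QuantumBipartite

/-- Operators on the tensor product of two `d`-dimensional Hilbert spaces, in a product basis:
the entry `ρ (i, j) (k, l)` is the coefficient of `|ij⟩⟨kl|`. -/
abbrev BipartiteMatrix (d : ℕ) := Matrix (Fin d × Fin d) (Fin d × Fin d) ℂ

/-- Density matrices: positive semidefinite of unit trace. -/
def IsState {n : Type*} [Fintype n] (ρ : Matrix n n ℂ) : Prop :=
  ρ.PosSemidef ∧ ρ.trace = 1

/-- Unit vectors `|Φ⟩ = ∑ Φ (i, j) |ij⟩`. -/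
def IsUnitVector {n : Type*} [Fintype n] (Φ : n → ℂ) : Prop :=
  ∑ x, ‖Φ x‖ ^ 2 = 1

/-- The projection `|Φ⟩⟨Φ|`. -/
def pureState {n : Type*} (Φ : n → ℂ) : Matrix n n ℂ :=
  Matrix.vecMulVec Φ (star Φ)

/-- The partial trace over the second subsystem. -/
def partialTraceB {d : ℕ} (ρ : BipartiteMatrix d) : Matrix (Fin d) (Fin d) ℂ :=
  Matrix.of fun i k => ∑ j, ρ (i, j) (k, j)

/-- The partial transpose over the second subsystem: `ρ^Γ = ∑ ρ_{ij,kl} |il⟩⟨kj|`. -/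
def partialTransposeB {d : ℕ} (ρ : BipartiteMatrix d) : BipartiteMatrix d :=
  Matrix.of fun x y => ρ (x.1, y.2) (y.1, x.2)

/-- The realigned matrix: `R(ρ) = ∑ ρ_{ij,kl} |ik⟩⟨jl|`. -/
def realignment {d : ℕ} (ρ : BipartiteMatrix d) : BipartiteMatrix d :=
  Matrix.of fun x y => ρ (x.1, y.1) (x.2, y.2)

/-- The trace norm `‖M‖₁ = tr √(M† M)`. -/
noncomputable def traceNorm {n : Type*} [Fintype n] [DecidableEq n] (M : Matrix n n ℂ) : ℝ :=
  (cfc Real.sqrt (Mᴴ * M)).trace.re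

/-- The number `tr (A ^ q)`, for a positive semidefinite matrix `A` and a real exponent `q`. -/
noncomputable def tracePow {n : Type*} [Fintype n] [DecidableEq n] (A : Matrix n n ℂ) (q : ℝ) : ℝ :=
  (cfc (fun x : ℝ => x ^ q) A).trace.re

/-- The total concurrence of a pure state,
`C^t_q(|Φ⟩) = 1 - tr (ρ_A ^ q) + tr (I - ρ_A) - tr ((I - ρ_A) ^ q)`, with
`ρ_A = tr_B |Φ⟩⟨Φ|`. -/
noncomputable def pureTotalConcurrence {d : ℕ} (q : ℝ) (Φ : Fin d × Fin d → ℂ) : ℝ :=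
  1 - tracePow (partialTraceB (pureState Φ)) q
    + (1 - partialTraceB (pureState Φ)).trace.re
    - tracePow (1 - partialTraceB (pureState Φ)) q

/-- `(p, Φ)` is a decomposition `ρ = ∑ p_i |Φ_i⟩⟨Φ_i|` of `ρ` into pure states. -/
def IsPureDecomposition {d m : ℕ} (ρ : BipartiteMatrix d) (p : Fin m → ℝ)
    (Φ : Fin m → Fin d × Fin d → ℂ) : Prop :=
  (∀ i, 0 ≤ p i) ∧ ∑ i, p i = 1 ∧ (∀ i, IsUnitVector (Φ i)) ∧
    ρ = ∑ i, (p i : ℂ) • pureState (Φ i)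

/-- The total concurrence of a mixed state: the convex roof
`C^t_q(ρ) = inf ∑ p_i C^t_q(|Φ_i⟩)` over all pure state decompositions of `ρ`. -/
noncomputable def totalConcurrence {d : ℕ} (q : ℝ) (ρ : BipartiteMatrix d) : ℝ :=
  sInf {c : ℝ | ∃ (m : ℕ) (p : Fin m → ℝ) (Φ : Fin m → Fin d × Fin d → ℂ),
    IsPureDecomposition ρ p Φ ∧ c = ∑ i, p i * pureTotalConcurrence q (Φ i)}

/-- Separable states: convex combinations of product states. -/
def IsSeparable {d : ℕ} (ρ : BipartiteMatrix d) : Prop :=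
  ∃ (m : ℕ) (p : Fin m → ℝ) (σ τ : Fin m → Matrix (Fin d) (Fin d) ℂ),
    (∀ i, 0 ≤ p i) ∧ ∑ i, p i = 1 ∧ (∀ i, IsState (σ i)) ∧ (∀ i, IsState (τ i)) ∧
      ρ = ∑ i, (p i : ℂ) • (σ i ⊗ₖ τ i)

end QuantumBipartite

/-!
The total concurrence of a pure state with squared Schmidt coefficients `λ` is `∑ g(λ)`, where
`g(λ) = 1 - λ ^ q - (1 - λ) ^ q` (`concSummand`), and the trace norms of its partial transpose and of
its realignment are at most `(∑ √λ) ^ 2`. By the triangle inequality for the trace norm and the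
convexity of the square, the theorem follows from the inequality
`K ((∑ √λ) ^ 2 - 1) ^ 2 ≤ ∑ g(λ)` for probability vectors `λ` (`IsConcurrenceBound`,
`IsConcurrenceBound.le_totalConcurrence`), in which `K` is such that equality holds for the uniform
vector.

For `d = 2` the inequality says that `λ (1 - λ) / g(λ)` is largest at `λ = 1 / 2`, which is true for
`q ≥ 3` (`isConcurrenceBound_two`). The coefficient of the second part of the theorem is smaller than
this optimal one, since `2 ^ (1 - s) < 1 / 2`. The inequality there is strict for entangled states
because their total concurrence is positive: decompositions with total concurrence tending to zero
are close to separable states, and by Carathéodory's theorem the separable states form a closed set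
(`IsConcurrenceBound.totalConcurrence_pos`).

For `d ≥ 3` put `y = d λ` and `x = √y`, so that `∑ x ^ 2 = d`. The Cauchy-Schwarz inequality with
weights `g(λ)` (`le_sum_of_csWeight`) reduces the claim to a bound by one of the weighted mean of the
ratios `y (d - y) g(1 / d) / ((d - 1) g(y / d))`. The weights (`csWeight`) are at most one, and their
total defect is at least proportional to the variance of `x`. The ratio equals one at `y = 1`, and it
is bounded by a tangent line or parabola at `y = 1` plus `C (√y - 1) ^ 2`, where `C` comes from a
bound of a second derivative (`le_tangent_add_sq_sqrt_sub`). The mean of `(x - 1) ^ 2` is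
`2 (1 - σ)`, for `σ` the mean of `x`, whereas the variance is `(1 - σ) (1 + σ)`: so the claim holds
as soon as `C` is below a threshold (`sum_csWeight_mul_affine_le`, `sum_csWeight_mul_quadratic_le`,
`sum_csWeight_mul_decreasing_le`).

The second derivatives are estimated as follows. With `p = q - 1` and `φ(s) = (1 - s ^ p) / (1 - s)`
one has `g(λ) = λ (1 - λ) (φ(λ) + φ(1 - λ))` (`concSummand_eq`). For `q ≤ 3` the function `φ` is
concave, with `|φ''(s)|` at most a small multiple of `s ^ (-3 / 2)`. For `q ≥ 3` it is convex, and
the second derivative of `1 / (φ(λ) + φ(1 - λ))` is bounded after replacing `(1 - λ) ^ p` by a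
truncated binomial series, which leaves a polynomial inequality with nonnegative coefficients
(`invSummand_polynomial_le`). The resulting `C` is small enough unless `d` and `q` are both large. In
that case the same method, applied to `λ / g(λ)`, leads to a better bound
(`divSummand_polynomial_le`).
-/

namespace QuantumBipartite

/-! ### The trace norm -/

lemma trace_cfc {n : Type*} [Fintype n] [DecidableEq n] {A : Matrix n n ℂ} (hA : A.IsHermitian)
    (f : ℝ → ℝ) : (cfc f A).trace.re = ∑ i, f (hA.eigenvalues i) := by
  rw [hA.cfc_eq, Matrix.IsHermitian.cfc, Unitary.conjStarAlgAut_apply, Matrix.trace_mul_comm,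
    ← mul_assoc, Unitary.coe_star_mul_self, one_mul, Matrix.trace_diagonal]
  simp

lemma inner_mulVec_mulVec {n : Type*} [Fintype n] [DecidableEq n] (N : Matrix n n ℂ) (u v : n → ℂ) :
    inner ℂ (WithLp.toLp 2 (N *ᵥ u)) (WithLp.toLp 2 (N *ᵥ v)) =
      inner ℂ (WithLp.toLp 2 u) (WithLp.toLp 2 ((Nᴴ * N) *ᵥ v)) := by
  simp only [EuclideanSpace.inner_eq_star_dotProduct]
  rw [← Matrix.mulVec_mulVec, Matrix.star_mulVec, dotProduct_comm, ← Matrix.dotProduct_mulVec,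
    dotProduct_comm]

/-- Singular value description of the trace norm: with respect to an orthonormal eigenbasis `e`
of `Nᴴ N`, the vectors `N e k` are pairwise orthogonal and their norms add up to `‖N‖₁`. -/
lemma exists_orthogonal_image_basis {n : Type*} [Fintype n] [DecidableEq n] (N : Matrix n n ℂ) :
    ∃ e : OrthonormalBasis n ℂ (EuclideanSpace ℂ n),
      (∀ k l, k ≠ l → inner ℂ (WithLp.toLp 2 (N *ᵥ e k)) (WithLp.toLp 2 (N *ᵥ e l)) = 0) ∧
      traceNorm N = ∑ k, ‖WithLp.toLp 2 (N *ᵥ e k)‖ := by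
  have hH : (Nᴴ * N).IsHermitian := Matrix.isHermitian_conjTranspose_mul_self N
  have key : ∀ k l, inner ℂ (WithLp.toLp 2 (N *ᵥ hH.eigenvectorBasis k))
      (WithLp.toLp 2 (N *ᵥ hH.eigenvectorBasis l)) =
        (hH.eigenvalues l : ℂ) * inner ℂ (hH.eigenvectorBasis k) (hH.eigenvectorBasis l) := by
    intro k l
    rw [inner_mulVec_mulVec, hH.mulVec_eigenvectorBasis]
    rw [WithLp.toLp_smul, RCLike.real_smul_eq_coe_smul (K := ℂ), inner_smul_right]
    rfl
  refine ⟨hH.eigenvectorBasis, fun k l hkl => ?_, ?_⟩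
  · rw [key, hH.eigenvectorBasis.orthonormal.2 hkl, mul_zero]
  · rw [traceNorm, trace_cfc hH]
    refine Finset.sum_congr rfl fun k _ => ?_
    have h := key k k
    rw [inner_self_eq_norm_sq_to_K, inner_self_eq_norm_sq_to_K, hH.eigenvectorBasis.orthonormal.1]
      at h
    have h2 : hH.eigenvalues k = ‖WithLp.toLp 2 (N *ᵥ hH.eigenvectorBasis k)‖ ^ 2 := by
      have h3 := h.symm
      simp only [Complex.coe_algebraMap, Complex.ofReal_one, one_pow, mul_one] at h3
      exact_mod_cast h3
    rw [h2, Real.sqrt_sq (norm_nonneg _)]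

/-- The trace norm is dominated by the projective cross norm of any decomposition into rank one
matrices. -/
lemma traceNorm_le_of_eq_sum {n ι : Type*} [Fintype n] [DecidableEq n] [Fintype ι]
    (N : Matrix n n ℂ) (α β : ι → n → ℂ) (hN : ∀ x y, N x y = ∑ t, α t x * β t y) :
    traceNorm N ≤ ∑ t, √(∑ x, ‖α t x‖ ^ 2) * √(∑ x, ‖β t x‖ ^ 2) := by
  obtain ⟨e, horth, htr⟩ := exists_orthogonal_image_basis N
  set w : n → EuclideanSpace ℂ n := fun k => WithLp.toLp 2 (N *ᵥ e k) with hw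
  set f : n → EuclideanSpace ℂ n := fun k => ((‖w k‖⁻¹ : ℝ) : ℂ) • w k with hf
  have hfw : ∀ k, ((‖w k‖ : ℝ) : ℂ) = inner ℂ (f k) (w k) := by
    intro k
    rw [hf]
    simp only [inner_smul_left, inner_self_eq_norm_sq_to_K, Complex.conj_ofReal]
    by_cases h0 : ‖w k‖ = 0
    · simp [h0]
    · have : (‖w k‖ : ℂ) ≠ 0 := by exact_mod_cast h0
      push_cast
      simp only [Complex.coe_algebraMap]
      field_simp
  have hwk : ∀ k, w k = ∑ t, (∑ y, β t y * e k y) • WithLp.toLp 2 (α t) := by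
    intro k
    ext x
    simp only [hw, Matrix.mulVec, dotProduct, WithLp.ofLp_sum, WithLp.ofLp_smul, Finset.sum_apply,
      Pi.smul_apply, smul_eq_mul, hN, Finset.sum_mul]
    rw [Finset.sum_comm]
    refine Finset.sum_congr rfl fun t _ => Finset.sum_congr rfl fun y _ => by ring
  have hbes : ∀ a : EuclideanSpace ℂ n, ∑ k, ‖inner ℂ (f k) a‖ ^ 2 ≤ ‖a‖ ^ 2 := by
    intro a
    have hon : Orthonormal ℂ (fun k : {k // w k ≠ 0} => f k) := by
      constructor
      · rintro ⟨k, hk⟩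
        simp [hf, norm_smul, norm_ne_zero_iff.2 hk]
      · rintro ⟨k, hk⟩ ⟨l, hl⟩ hkl
        have : k ≠ l := fun h => hkl (Subtype.ext h)
        simp only [hf, inner_smul_left, inner_smul_right]
        rw [horth k l this]; simp
    have h := hon.sum_inner_products_le a (s := Finset.univ)
    refine le_trans (le_of_eq ?_) h
    rw [← Finset.sum_filter_of_ne (p := fun k => w k ≠ 0)]
    · exact Finset.sum_subtype _ (by simp) _
    · intro k _ hk h0
      apply hk
      simp [hf, h0]
  have hpar : ∀ t, ∑ k, ‖∑ y, β t y * e k y‖ ^ 2 = ∑ x, ‖β t x‖ ^ 2 := by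
    intro t
    have h := e.sum_sq_norm_inner_left (WithLp.toLp 2 (star (β t)))
    rw [EuclideanSpace.norm_sq_eq] at h
    simp only [EuclideanSpace.inner_eq_star_dotProduct] at h
    simp only [Pi.star_apply, norm_star] at h
    rw [← h]
    refine Finset.sum_congr rfl fun k _ => ?_
    simp [dotProduct, mul_comm]
  have hsum : ∀ k, ‖w k‖ ≤ ∑ t, ‖∑ y, β t y * e k y‖ * ‖inner ℂ (f k) (WithLp.toLp 2 (α t))‖ := by
    intro k
    have h1 : ‖((‖w k‖ : ℝ) : ℂ)‖ = ‖w k‖ := by simp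
    rw [← h1, hfw k]
    conv_lhs => rw [hwk k, inner_sum]
    refine (norm_sum_le _ _).trans (Finset.sum_le_sum fun t _ => ?_)
    rw [inner_smul_right, norm_mul]
  rw [htr]
  calc ∑ k, ‖w k‖ ≤ ∑ k, ∑ t, ‖∑ y, β t y * e k y‖ * ‖inner ℂ (f k) (WithLp.toLp 2 (α t))‖ :=
        Finset.sum_le_sum fun k _ => hsum k
    _ = ∑ t, ∑ k, ‖∑ y, β t y * e k y‖ * ‖inner ℂ (f k) (WithLp.toLp 2 (α t))‖ :=
        Finset.sum_comm
    _ ≤ _ := by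
        refine Finset.sum_le_sum fun t _ => ?_
        refine (Real.sum_mul_le_sqrt_mul_sqrt _ _ _).trans ?_
        rw [hpar t, mul_comm]
        refine mul_le_mul_of_nonneg_right ?_ (Real.sqrt_nonneg _)
        refine Real.sqrt_le_sqrt ((hbes _).trans (le_of_eq ?_))
        rw [EuclideanSpace.norm_sq_eq]

lemma norm_trace_le_traceNorm {n : Type*} [Fintype n] [DecidableEq n] (N : Matrix n n ℂ) :
    N.trace.re ≤ traceNorm N := by
  obtain ⟨e, -, htr⟩ := exists_orthogonal_image_basis N
  have h : N.trace = ∑ k, inner ℂ (e k) (WithLp.toLp 2 (N *ᵥ e k)) := by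
    have h1 := LinearMap.trace_eq_sum_inner (Matrix.toEuclideanLin N) e
    rw [← Matrix.trace_toLin_eq N (EuclideanSpace.basisFun n ℂ).toBasis]
    exact h1
  rw [htr, h, Complex.re_sum]
  refine Finset.sum_le_sum fun k _ => ?_
  refine (Complex.re_le_norm _).trans ((norm_inner_le_norm _ _).trans ?_)
  rw [e.orthonormal.1, one_mul]

/-! ### Schmidt decompositions -/

/-- The summand of the total concurrence: `C^t_q(|Φ⟩) = ∑ concSummand q λ`, over the squared Schmidt
coefficients `λ` of `Φ`. -/
noncomputable def concSummand (q x : ℝ) : ℝ := 1 - x ^ q - (1 - x) ^ q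

/-- A Schmidt decomposition of `Φ`. The vectors on the second side are not normalized: the squared
norm of `r a` is the squared Schmidt coefficient `l a`. -/
structure IsSchmidt {d : ℕ} (Φ : Fin d × Fin d → ℂ) (l : Fin d → ℝ) (u r : Fin d → Fin d → ℂ) :
    Prop where
  nonneg : ∀ a, 0 ≤ l a
  sum_eq : ∑ a, l a = 1
  norm_left : ∀ a, ∑ i, ‖u a i‖ ^ 2 = 1
  norm_right : ∀ a, ∑ j, ‖r a j‖ ^ 2 = l a
  eq_sum : ∀ i j, Φ (i, j) = ∑ a, u a i * r a j

lemma partialTraceB_pureState {d : ℕ} (Φ : Fin d × Fin d → ℂ) :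
    partialTraceB (pureState Φ) =
      (Matrix.of fun i j => Φ (i, j)) * (Matrix.of fun i j => Φ (i, j))ᴴ := by
  ext i k
  simp [partialTraceB, pureState, Matrix.vecMulVec_apply, Matrix.mul_apply]

lemma tracePow_eq {n : Type*} [Fintype n] [DecidableEq n] {A : Matrix n n ℂ} (hA : A.IsHermitian)
    (q : ℝ) : tracePow A q = ∑ i, (hA.eigenvalues i) ^ q := trace_cfc hA _

lemma tracePow_one_sub_eq {n : Type*} [Fintype n] [DecidableEq n] {A : Matrix n n ℂ}
    (hA : A.IsHermitian) (q : ℝ) : tracePow (1 - A) q = ∑ i, (1 - hA.eigenvalues i) ^ q := by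
  have hcont : ∀ f : ℝ → ℝ, ContinuousOn f (spectrum ℝ A) := fun f =>
    A.finite_real_spectrum.continuousOn f
  have h1 : (1 : Matrix n n ℂ) - A = cfc (fun x : ℝ => 1 - x) A := by
    rw [cfc_sub (fun _ => (1 : ℝ)) (fun x => x) A (hcont _) (hcont _), cfc_const_one ℝ A hA.isSelfAdjoint,
      cfc_id' ℝ A hA.isSelfAdjoint]
  rw [tracePow, h1, ← cfc_comp' (fun x : ℝ => x ^ q) (fun x : ℝ => 1 - x) A
    ((A.finite_real_spectrum.image _).continuousOn _) (hcont _) hA.isSelfAdjoint, trace_cfc hA]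

/-- The Schmidt decomposition, from the spectral theorem for `M Mᴴ`, where `M i j = Φ (i, j)`. -/
lemma exists_schmidt {d : ℕ} (Φ : Fin d × Fin d → ℂ) (hΦ : IsUnitVector Φ) :
    ∃ l u r, IsSchmidt Φ l u r ∧ ∀ q, pureTotalConcurrence q Φ = ∑ a, concSummand q (l a) := by
  set M : Matrix (Fin d) (Fin d) ℂ := Matrix.of fun i j => Φ (i, j) with hM
  have hA : (M * Mᴴ).IsHermitian := Matrix.isHermitian_mul_conjTranspose_self M
  have hps : (M * Mᴴ).PosSemidef := Matrix.posSemidef_self_mul_conjTranspose M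
  have htr : (M * Mᴴ).trace = 1 := by
    have h : (M * Mᴴ).trace = ((∑ x : Fin d × Fin d, ‖Φ x‖ ^ 2 : ℝ) : ℂ) := by
      rw [Fintype.sum_prod_type]
      simp [Matrix.trace, Matrix.mul_apply, hM, Complex.mul_conj, Complex.normSq_eq_norm_sq]
    rw [h, hΦ]; simp
  have hsum : ∑ a, hA.eigenvalues a = 1 := by
    have h := hA.trace_eq_sum_eigenvalues
    rw [htr] at h
    have h' := congrArg Complex.re h.symm
    simpa using h'
  set e := hA.eigenvectorBasis
  refine ⟨hA.eigenvalues, fun a i => e a i, fun a j => ∑ i, star (e a i) * M i j, ⟨?_, hsum, ?_,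
    ?_, ?_⟩, ?_⟩
  · exact fun a => hps.eigenvalues_nonneg a
  · intro a
    have h := e.orthonormal.1 a
    rw [EuclideanSpace.norm_eq, Real.sqrt_eq_one] at h
    exact h
  · intro a
    have h := inner_mulVec_mulVec Mᴴ (e a) (e a)
    rw [inner_self_eq_norm_sq_to_K, Matrix.conjTranspose_conjTranspose,
      hA.mulVec_eigenvectorBasis, WithLp.toLp_smul, RCLike.real_smul_eq_coe_smul (K := ℂ),
      inner_smul_right, WithLp.toLp_ofLp, inner_self_eq_norm_sq_to_K, e.orthonormal.1] at h
    have h2 : ‖WithLp.toLp 2 (Mᴴ *ᵥ (e a).ofLp)‖ ^ 2 = hA.eigenvalues a := by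
      simp only [Complex.coe_algebraMap, Complex.ofReal_one, one_pow, mul_one] at h
      exact_mod_cast h
    rw [← h2, EuclideanSpace.norm_sq_eq]
    refine Finset.sum_congr rfl fun j _ => ?_
    congr 1
    rw [← norm_star]
    simp [Matrix.mulVec, dotProduct, mul_comm]
  · intro i j
    have h := e.sum_repr (WithLp.toLp 2 fun i => M i j)
    have h' := congrArg (fun v : EuclideanSpace ℂ (Fin d) => v i) h
    simp only [WithLp.ofLp_sum, WithLp.ofLp_smul, Finset.sum_apply, Pi.smul_apply, smul_eq_mul,
      e.repr_apply_apply, EuclideanSpace.inner_eq_star_dotProduct, dotProduct] at h'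
    rw [show Φ (i, j) = M i j from rfl, ← h']
    refine Finset.sum_congr rfl fun a _ => ?_
    rw [mul_comm]
    congr 1
    refine Finset.sum_congr rfl fun k _ => ?_
    simp [mul_comm]
  · intro q
    have hA' := partialTraceB_pureState Φ
    rw [pureTotalConcurrence, hA', tracePow_eq hA, tracePow_one_sub_eq hA, Matrix.trace_sub, htr]
    simp only [concSummand, Finset.sum_sub_distrib]
    simp

/-- For a pure state, both matrices are sums of `d ^ 2` matrices of rank one and of norms
`√(l a) √(l b)`. -/
lemma IsSchmidt.traceNorm_le {d m : ℕ} {ρ : BipartiteMatrix d} {p : Fin m → ℝ}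
    {Φ : Fin m → Fin d × Fin d → ℂ} (h : IsPureDecomposition ρ p Φ) {l : Fin m → Fin d → ℝ}
    {u r : Fin m → Fin d → Fin d → ℂ} (hs : ∀ i, IsSchmidt (Φ i) (l i) (u i) (r i)) :
    max (traceNorm (partialTransposeB ρ)) (traceNorm (realignment ρ)) ≤
      ∑ i, p i * (∑ a, √(l i a)) ^ 2 := by
  obtain ⟨hp, -, -, hρ⟩ := h
  have hρ' : ∀ x y, ρ x y = ∑ i, (p i : ℂ) * (Φ i x * star (Φ i y)) := by
    intro x y
    rw [hρ, Matrix.sum_apply]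
    simp [pureState, Matrix.vecMulVec_apply]
  have hnp : ∀ (v w : Fin d → ℂ), ∑ x : Fin d × Fin d, ‖v x.1 * w x.2‖ ^ 2 =
      (∑ i, ‖v i‖ ^ 2) * ∑ j, ‖w j‖ ^ 2 := by
    intro v w
    rw [Fintype.sum_prod_type, Finset.sum_mul_sum]
    simp [mul_pow]
  have hfin : ∀ i, ∑ a, ∑ b, √(l i a) * √(l i b) = (∑ a, √(l i a)) ^ 2 := by
    intro i
    rw [sq, Finset.sum_mul_sum]
  have hpc : ∀ i, ‖(p i : ℂ)‖ = p i := fun i => by simp [abs_of_nonneg (hp i)]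
  refine max_le ?_ ?_
  · refine (traceNorm_le_of_eq_sum (ι := Fin m × Fin d × Fin d) _
      (fun t x => (p t.1 * u t.1 t.2.1 x.1) * star (r t.1 t.2.2 x.2))
      (fun t y => star (u t.1 t.2.2 y.1) * r t.1 t.2.1 y.2) ?_).trans (le_of_eq ?_)
    · intro x y
      simp only [partialTransposeB, Matrix.of_apply, hρ', Fintype.sum_prod_type]
      refine Finset.sum_congr rfl fun i _ => ?_
      rw [(hs i).eq_sum, (hs i).eq_sum, star_sum, Finset.sum_mul_sum, Finset.mul_sum]
      refine Finset.sum_congr rfl fun a _ => ?_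
      rw [Finset.mul_sum]
      refine Finset.sum_congr rfl fun b _ => ?_
      rw [star_mul']; ring
    · rw [Fintype.sum_prod_type]
      refine Finset.sum_congr rfl fun i _ => ?_
      rw [← hfin, Finset.mul_sum, Fintype.sum_prod_type]
      refine Finset.sum_congr rfl fun a _ => ?_
      rw [Finset.mul_sum]
      refine Finset.sum_congr rfl fun b _ => ?_
      rw [hnp (fun k => p i * u i a k) (fun k => star (r i b k)), hnp (fun k => star (u i b k)) (r i a)]
      simp only [norm_mul, norm_star, mul_pow, ← Finset.mul_sum, (hs i).norm_left,
        (hs i).norm_right, hpc, mul_one, one_mul]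
      rw [Real.sqrt_mul (sq_nonneg _), Real.sqrt_sq (hp i)]
      ring
  · refine (traceNorm_le_of_eq_sum (ι := Fin m × Fin d × Fin d) _
      (fun t x => (p t.1 * u t.1 t.2.1 x.1) * star (u t.1 t.2.2 x.2))
      (fun t y => r t.1 t.2.1 y.1 * star (r t.1 t.2.2 y.2)) ?_).trans (le_of_eq ?_)
    · intro x y
      simp only [realignment, Matrix.of_apply, hρ', Fintype.sum_prod_type]
      refine Finset.sum_congr rfl fun i _ => ?_
      rw [(hs i).eq_sum, (hs i).eq_sum, star_sum, Finset.sum_mul_sum, Finset.mul_sum]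
      refine Finset.sum_congr rfl fun a _ => ?_
      rw [Finset.mul_sum]
      refine Finset.sum_congr rfl fun b _ => ?_
      rw [star_mul']; ring
    · rw [Fintype.sum_prod_type]
      refine Finset.sum_congr rfl fun i _ => ?_
      rw [← hfin, Finset.mul_sum, Fintype.sum_prod_type]
      refine Finset.sum_congr rfl fun a _ => ?_
      rw [Finset.mul_sum]
      refine Finset.sum_congr rfl fun b _ => ?_
      rw [hnp (fun k => p i * u i a k) (fun k => star (u i b k)), hnp (r i a) (fun k => star (r i b k))]
      simp only [norm_mul, norm_star, mul_pow, ← Finset.mul_sum, (hs i).norm_left,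
        (hs i).norm_right, hpc, mul_one]
      rw [Real.sqrt_sq (hp i), Real.sqrt_mul ((hs i).nonneg a)]

/-! ### Separable states -/

/-- In finite dimension the convex hull of a compact set is compact, by Carathéodory's theorem. -/
lemma isCompact_convexHull_of_finiteDimensional {E : Type*} [AddCommGroup E] [Module ℝ E]
    [TopologicalSpace E] [ContinuousAdd E] [ContinuousSMul ℝ E] [FiniteDimensional ℝ E]
    {s : Set E} (hs : IsCompact s) : IsCompact (convexHull ℝ s) := by
  classical
  rcases s.eq_empty_or_nonempty with rfl | ⟨z₀, hz₀⟩
  · simp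
  set N := Module.finrank ℝ E + 1
  set F : (Fin N → ℝ) × (Fin N → E) → E := fun t => ∑ i, t.1 i • t.2 i
  have hF : Continuous F := by fun_prop
  have hc : IsCompact (stdSimplex ℝ (Fin N) ×ˢ Set.pi Set.univ fun _ : Fin N => s) :=
    (isCompact_stdSimplex ℝ _).prod (isCompact_univ_pi fun _ => hs)
  have himg : convexHull ℝ s =
      F '' (stdSimplex ℝ (Fin N) ×ˢ Set.pi Set.univ fun _ : Fin N => s) := by
    apply Set.Subset.antisymm
    · intro x hx
      obtain ⟨ι, _, z, w, hz, haff, hw, hw1, rfl⟩ := eq_pos_convex_span_of_mem_convexHull hx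
      have hcard : Fintype.card ι ≤ Fintype.card (Fin N) := by
        rw [Fintype.card_fin]
        refine haff.card_le_finrank_succ.trans ?_
        exact Nat.succ_le_succ (Submodule.finrank_le _)
      obtain ⟨g⟩ := Function.Embedding.nonempty_of_card_le hcard
      have hext : ∀ (f : ι → E), ∑ i, f i = ∑ j, Function.extend g f 0 j := by
        intro f
        rw [← Finset.sum_subset (Finset.subset_univ (Finset.univ.map g))]
        · simp [g.injective.extend_apply]
        · intro j _ hj
          rw [Function.extend_apply']
          · rfl
          · rintro ⟨i, rfl⟩
            exact hj (Finset.mem_map_of_mem g (Finset.mem_univ i))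
      have hextR : ∀ (f : ι → ℝ), ∑ i, f i = ∑ j, Function.extend g f 0 j := by
        intro f
        rw [← Finset.sum_subset (Finset.subset_univ (Finset.univ.map g))]
        · simp [g.injective.extend_apply]
        · intro j _ hj
          rw [Function.extend_apply']
          · rfl
          · rintro ⟨i, rfl⟩
            exact hj (Finset.mem_map_of_mem g (Finset.mem_univ i))
      refine ⟨(Function.extend g w 0, Function.extend g z fun _ => z₀), ⟨⟨?_, ?_⟩, ?_⟩, ?_⟩
      · intro j
        by_cases hj : ∃ i, g i = j
        · obtain ⟨i, rfl⟩ := hj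
          simpa [g.injective.extend_apply] using (hw i).le
        · simp [Function.extend_apply' _ _ _ hj]
      · rw [← hextR, hw1]
      · intro j _
        by_cases hj : ∃ i, g i = j
        · obtain ⟨i, rfl⟩ := hj
          simpa [g.injective.extend_apply] using hz ⟨i, rfl⟩
        · simpa [Function.extend_apply' _ _ _ hj] using hz₀
      · rw [hext]
        refine Finset.sum_congr rfl fun j _ => ?_
        by_cases hj : ∃ i, g i = j
        · obtain ⟨i, rfl⟩ := hj
          simp [g.injective.extend_apply]
        · simp [Function.extend_apply' _ _ _ hj]
    · rintro _ ⟨⟨w, z⟩, ⟨⟨hw, hw1⟩, hz⟩, rfl⟩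
      exact (convex_convexHull ℝ s).sum_mem (fun i _ => hw i) hw1
        fun i _ => subset_convexHull ℝ s (hz i (Set.mem_univ i))
  rw [himg]
  exact hc.image hF

/-- The projections onto unit product vectors. -/
def pureProductStates (d : ℕ) : Set (BipartiteMatrix d) :=
  {ρ | ∃ u v : Fin d → ℂ, IsUnitVector u ∧ IsUnitVector v ∧ ρ = pureState u ⊗ₖ pureState v}

lemma isState_pureState {n : Type*} [Fintype n] {u : n → ℂ} (hu : IsUnitVector u) :
    IsState (pureState u) := by
  refine ⟨Matrix.posSemidef_vecMulVec_self_star u, ?_⟩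
  rw [pureState, Matrix.trace_vecMulVec]
  have h : u ⬝ᵥ star u = ((∑ x, ‖u x‖ ^ 2 : ℝ) : ℂ) := by
    simp [dotProduct, Complex.mul_conj, Complex.normSq_eq_norm_sq]
  rw [h, hu]; simp

lemma isSeparable_of_mem_convexHull {d : ℕ} {ρ : BipartiteMatrix d}
    (h : ρ ∈ convexHull ℝ (pureProductStates d)) : IsSeparable ρ := by
  obtain ⟨ι, _, w, z, hw, hw1, hz, rfl⟩ := mem_convexHull_iff_exists_fintype.1 h
  choose u v hu hv huv using hz
  let e := Fintype.equivFin ι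
  refine ⟨Fintype.card ι, fun i => w (e.symm i), fun i => pureState (u (e.symm i)),
    fun i => pureState (v (e.symm i)), fun i => hw _, ?_, fun i => isState_pureState (hu _),
    fun i => isState_pureState (hv _), ?_⟩
  · rw [← hw1]; exact e.symm.sum_comp w
  · rw [← e.symm.sum_comp]
    refine Finset.sum_congr rfl fun i _ => ?_
    rw [huv]
    ext x y
    simp

lemma isClosed_convexHull_pureProductStates (d : ℕ) :
    IsClosed (convexHull ℝ (pureProductStates d)) := by
  refine (isCompact_convexHull_of_finiteDimensional ?_).isClosed
  let S := Metric.sphere (0 : EuclideanSpace ℂ (Fin d)) 1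
  have hS : IsCompact (S ×ˢ S) := (isCompact_sphere _ _).prod (isCompact_sphere _ _)
  have hmem : ∀ u : EuclideanSpace ℂ (Fin d), u ∈ S ↔ IsUnitVector (u : Fin d → ℂ) := by
    intro u
    rw [mem_sphere_zero_iff_norm, EuclideanSpace.norm_eq, Real.sqrt_eq_one]
    rfl
  have himg : pureProductStates d =
      (fun t : EuclideanSpace ℂ (Fin d) × EuclideanSpace ℂ (Fin d) =>
        pureState (t.1 : Fin d → ℂ) ⊗ₖ pureState (t.2 : Fin d → ℂ)) '' (S ×ˢ S) := by
    ext ρ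
    constructor
    · rintro ⟨u, v, hu, hv, rfl⟩
      exact ⟨(WithLp.toLp 2 u, WithLp.toLp 2 v), ⟨(hmem _).2 hu, (hmem _).2 hv⟩, rfl⟩
    · rintro ⟨⟨u, v⟩, ⟨hu, hv⟩, rfl⟩
      exact ⟨u, v, (hmem _).1 hu, (hmem _).1 hv, rfl⟩
  rw [himg]
  refine hS.image ?_
  refine continuous_matrix fun x y => ?_
  simp only [Matrix.kroneckerMap_apply, pureState, Matrix.vecMulVec_apply, Pi.star_apply]
  fun_prop

/-- Dropping the off-diagonal terms of a Schmidt decomposition turns a pure state into a separable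
one, at an entrywise distance of at most `∑_{a ≠ b} √l a √l b`. -/
lemma IsSchmidt.exists_separable_near {d : ℕ} {Φ : Fin d × Fin d → ℂ} {l : Fin d → ℝ}
    {u r : Fin d → Fin d → ℂ} (hs : IsSchmidt Φ l u r) :
    ∃ D ∈ convexHull ℝ (pureProductStates d),
      ∀ x y, ‖pureState Φ x y - D x y‖ ≤ (∑ a, √(l a)) ^ 2 - 1 := by
  classical
  obtain ⟨a₀, -⟩ : (Finset.univ : Finset (Fin d)).Nonempty := by
    by_contra hne
    rw [Finset.not_nonempty_iff_eq_empty] at hne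
    have := hs.sum_eq
    rw [hne] at this
    simp at this
  have hrz : ∀ a, l a = 0 → ∀ j, r a j = 0 := by
    intro a ha j
    have h := hs.norm_right a
    rw [ha, Finset.sum_eq_zero_iff_of_nonneg (fun _ _ => sq_nonneg _)] at h
    simpa using h j (Finset.mem_univ j)
  set v : Fin d → Fin d → ℂ := fun a =>
    if l a = 0 then u a₀ else fun j => ((√(l a))⁻¹ : ℝ) * r a j with hv
  have hlv : ∀ a j k, (l a : ℂ) * (v a j * star (v a k)) = r a j * star (r a k) := by
    intro a j k
    by_cases h : l a = 0
    · simp [h, hrz a h]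
    · have h1 : (l a : ℂ) = (√(l a) : ℂ) * (√(l a) : ℂ) := by
        rw [← Complex.ofReal_mul, Real.mul_self_sqrt (hs.nonneg a)]
      have h2 : ((√(l a) : ℝ) : ℂ) ≠ 0 := by
        rw [Complex.ofReal_ne_zero, Real.sqrt_ne_zero (hs.nonneg a)]; exact h
      have hva : v a = fun j => ((√(l a))⁻¹ : ℝ) * r a j := by simp [hv, h]
      rw [hva, h1]
      simp only [star_mul', Complex.star_def, Complex.conj_ofReal]
      push_cast
      field_simp
  have hvu : ∀ a, IsUnitVector (v a) := by
    intro a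
    by_cases h : l a = 0
    · simp only [hv, h, if_true]; exact hs.norm_left a₀
    · simp only [hv, h, if_false, IsUnitVector, norm_mul, mul_pow, ← Finset.mul_sum,
        hs.norm_right]
      rw [Complex.norm_real, Real.norm_of_nonneg (by positivity), inv_pow,
        Real.sq_sqrt (hs.nonneg a), inv_mul_cancel₀ h]
  refine ⟨∑ a, l a • (pureState (u a) ⊗ₖ pureState (v a)), ?_, ?_⟩
  · exact (convex_convexHull ℝ _).sum_mem (fun a _ => hs.nonneg a) hs.sum_eq
      fun a _ => subset_convexHull ℝ _ ⟨u a, v a, hs.norm_left a, hvu a, rfl⟩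
  · rintro ⟨i, j⟩ ⟨k, m⟩
    have hD : (∑ a, l a • (pureState (u a) ⊗ₖ pureState (v a))) (i, j) (k, m) =
        ∑ a, (u a i * r a j) * star (u a k * r a m) := by
      rw [Matrix.sum_apply]
      refine Finset.sum_congr rfl fun a _ => ?_
      rw [star_mul', show u a i * r a j * (star (u a k) * star (r a m)) =
        u a i * star (u a k) * (r a j * star (r a m)) by ring, ← hlv]
      simp [pureState, Matrix.vecMulVec_apply]
      ring
    have hu1 : ∀ a i, ‖u a i‖ ≤ 1 := by
      intro a i
      have h := Finset.single_le_sum (f := fun i => ‖u a i‖ ^ 2) (fun _ _ => sq_nonneg _)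
        (Finset.mem_univ i)
      rw [hs.norm_left] at h
      exact (sq_le_one_iff₀ (norm_nonneg _)).1 h
    have hr1 : ∀ a j, ‖r a j‖ ≤ √(l a) := by
      intro a j
      have h := Finset.single_le_sum (f := fun i => ‖r a i‖ ^ 2) (fun _ _ => sq_nonneg _)
        (Finset.mem_univ j)
      rw [hs.norm_right] at h
      exact Real.le_sqrt_of_sq_le h
    have hur : ∀ a i j, ‖u a i * r a j‖ ≤ √(l a) := by
      intro a i j
      rw [norm_mul]
      exact (mul_le_of_le_one_left (norm_nonneg _) (hu1 a i)).trans (hr1 a j)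
    have hP : pureState Φ (i, j) (k, m) =
        ∑ a, ∑ b, (u a i * r a j) * star (u b k * r b m) := by
      rw [pureState, Matrix.vecMulVec_apply, Pi.star_apply, hs.eq_sum, hs.eq_sum, star_sum,
        Finset.sum_mul_sum]
    rw [hP, hD, ← Finset.sum_sub_distrib]
    have hT : (∑ a, √(l a)) ^ 2 - 1 = ∑ a, ∑ b ∈ Finset.univ.erase a, √(l a) * √(l b) := by
      rw [sq, Finset.sum_mul_sum, ← hs.sum_eq, ← Finset.sum_sub_distrib]
      refine Finset.sum_congr rfl fun a _ => ?_
      rw [← Finset.add_sum_erase _ _ (Finset.mem_univ a), Real.mul_self_sqrt (hs.nonneg a)]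
      ring
    rw [hT]
    refine (norm_sum_le _ _).trans (Finset.sum_le_sum fun a _ => ?_)
    rw [← Finset.add_sum_erase _ _ (Finset.mem_univ a), add_sub_cancel_left]
    refine (norm_sum_le _ _).trans (Finset.sum_le_sum fun b _ => ?_)
    rw [norm_mul, norm_star]
    exact mul_le_mul (hur _ _ _) (hur _ _ _) (norm_nonneg _) (Real.sqrt_nonneg _)

/-! ### From pure states to mixed states -/

lemma exists_pureDecomposition {d : ℕ} {ρ : BipartiteMatrix d} (hρ : IsState ρ) :
    ∃ (m : ℕ) (p : Fin m → ℝ) (Φ : Fin m → Fin d × Fin d → ℂ), IsPureDecomposition ρ p Φ := by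
  obtain ⟨hps, htr⟩ := hρ
  have hA := hps.isHermitian
  let e := Fintype.equivFin (Fin d × Fin d)
  refine ⟨_, fun i => hA.eigenvalues (e.symm i), fun i => hA.eigenvectorBasis (e.symm i),
    fun i => hps.eigenvalues_nonneg _, ?_, fun i => ?_, ?_⟩
  · rw [e.symm.sum_comp (fun i => hA.eigenvalues i)]
    have h := hA.trace_eq_sum_eigenvalues
    rw [htr] at h
    have h' := congrArg Complex.re h.symm
    simpa using h'
  · have h := hA.eigenvectorBasis.orthonormal.1 (e.symm i)
    rw [EuclideanSpace.norm_eq, Real.sqrt_eq_one] at h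
    exact h
  · rw [e.symm.sum_comp (fun i => (hA.eigenvalues i : ℂ) • pureState (hA.eigenvectorBasis i))]
    conv_lhs => rw [hA.spectral_theorem, Unitary.conjStarAlgAut_apply]
    ext x y
    rw [Matrix.sum_apply, Matrix.mul_apply]
    refine Finset.sum_congr rfl fun k _ => ?_
    rw [Matrix.mul_diagonal]
    simp [pureState, Matrix.vecMulVec_apply, Matrix.star_apply]
    ring

lemma trace_partialTransposeB {d : ℕ} (ρ : BipartiteMatrix d) :
    (partialTransposeB ρ).trace = ρ.trace := rfl

lemma sq_sum_le_sum_mul_sq {m : ℕ} {p t : Fin m → ℝ} (hp : ∀ i, 0 ≤ p i) (h1 : ∑ i, p i = 1) :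
    (∑ i, p i * t i) ^ 2 ≤ ∑ i, p i * t i ^ 2 := by
  have h2 := (even_two.convexOn_pow (𝕜 := ℝ)).map_sum_le (t := Finset.univ) (w := p) (p := t)
    (fun i _ => hp i) h1 (fun i _ => Set.mem_univ _)
  simpa using h2

/-- The coefficient `K` is admissible if the total concurrence of every pure state, written in its
squared Schmidt coefficients `l`, is at least `K (‖ρ^Γ‖₁ - 1)²`. -/
def IsConcurrenceBound (d : ℕ) (q K : ℝ) : Prop :=
  ∀ l : Fin d → ℝ, (∀ a, 0 ≤ l a) → ∑ a, l a = 1 →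
    K * ((∑ a, √(l a)) ^ 2 - 1) ^ 2 ≤ ∑ a, concSummand q (l a)

lemma IsConcurrenceBound.le_totalConcurrence {d : ℕ} {q K : ℝ} (hK : IsConcurrenceBound d q K)
    (hK0 : 0 ≤ K) {ρ : BipartiteMatrix d} (hρ : IsState ρ) :
    K * (max (traceNorm (partialTransposeB ρ)) (traceNorm (realignment ρ)) - 1) ^ 2
      ≤ totalConcurrence q ρ := by
  obtain ⟨m₀, p₀, Φ₀, h₀⟩ := exists_pureDecomposition hρ
  refine le_csInf ⟨_, m₀, p₀, Φ₀, h₀, rfl⟩ ?_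
  rintro _ ⟨m, p, Φ, h, rfl⟩
  choose l u r hs hC using fun i => exists_schmidt (Φ i) (h.2.2.1 i)
  have hle := IsSchmidt.traceNorm_le h hs
  have h1 : 1 ≤ max (traceNorm (partialTransposeB ρ)) (traceNorm (realignment ρ)) := by
    refine le_trans ?_ (le_max_left _ _)
    refine le_trans (le_of_eq ?_) (norm_trace_le_traceNorm _)
    rw [trace_partialTransposeB, hρ.2, Complex.one_re]
  have hsum : ∑ i, p i * ((∑ a, √(l i a)) ^ 2 - 1) = ∑ i, p i * (∑ a, √(l i a)) ^ 2 - 1 := by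
    simp only [mul_sub, mul_one, Finset.sum_sub_distrib, h.2.1]
  calc K * (max (traceNorm (partialTransposeB ρ)) (traceNorm (realignment ρ)) - 1) ^ 2
      ≤ K * (∑ i, p i * ((∑ a, √(l i a)) ^ 2 - 1)) ^ 2 := by
        refine mul_le_mul_of_nonneg_left ?_ hK0
        rw [hsum]
        exact pow_le_pow_left₀ (by linarith) (by linarith) 2
    _ ≤ K * ∑ i, p i * ((∑ a, √(l i a)) ^ 2 - 1) ^ 2 :=
        mul_le_mul_of_nonneg_left (sq_sum_le_sum_mul_sq h.1 h.2.1) hK0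
    _ ≤ ∑ i, p i * pureTotalConcurrence q (Φ i) := by
        rw [Finset.mul_sum]
        refine Finset.sum_le_sum fun i _ => ?_
        rw [hC, mul_left_comm]
        exact mul_le_mul_of_nonneg_left (hK _ (hs i).nonneg (hs i).sum_eq) (h.1 i)

/-- A faithful lower bound on pure states makes the convex roof faithful: decompositions with a
total concurrence tending to zero exhibit `ρ` as a limit of separable states, and these form a
closed set. -/
lemma IsConcurrenceBound.totalConcurrence_pos {d : ℕ} {q K : ℝ} (hK : IsConcurrenceBound d q K)
    (hK0 : 0 < K) {ρ : BipartiteMatrix d} (hρ : IsState ρ) (hsep : ¬ IsSeparable ρ) :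
    0 < totalConcurrence q ρ := by
  have h0 : 0 ≤ totalConcurrence q ρ :=
    (mul_nonneg hK0.le (sq_nonneg _)).trans (hK.le_totalConcurrence hK0.le hρ)
  refine lt_of_le_of_ne h0 fun heq => hsep (isSeparable_of_mem_convexHull ?_)
  obtain ⟨m₀, p₀, Φ₀, h₀⟩ := exists_pureDecomposition hρ
  have hex : ∀ k : ℕ, ∃ D ∈ convexHull ℝ (pureProductStates d),
      ∀ x y, ‖ρ x y - D x y‖ ≤ √((1 / ((k : ℝ) + 1)) / K) := by
    intro k
    have hpos : totalConcurrence q ρ < 1 / ((k : ℝ) + 1) := by rw [← heq]; positivity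
    rw [totalConcurrence] at hpos
    obtain ⟨_, ⟨m, p, Φ, h, rfl⟩, hlt⟩ := exists_lt_of_csInf_lt (by
      exact ⟨_, m₀, p₀, Φ₀, h₀, rfl⟩) hpos
    choose l u r hs hC using fun i => exists_schmidt (Φ i) (h.2.2.1 i)
    choose D hD hΦD using fun i => (hs i).exists_separable_near
    refine ⟨∑ i, p i • D i, (convex_convexHull ℝ _).sum_mem (fun i _ => h.1 i) h.2.1
      fun i _ => hD i, fun x y => ?_⟩
    have hle : ‖ρ x y - (∑ i, p i • D i) x y‖ ≤ ∑ i, p i * ((∑ a, √(l i a)) ^ 2 - 1) := by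
      rw [h.2.2.2, Matrix.sum_apply, Matrix.sum_apply, ← Finset.sum_sub_distrib]
      refine (norm_sum_le _ _).trans (Finset.sum_le_sum fun i _ => ?_)
      have : ((p i : ℂ) • pureState (Φ i)) x y - (p i • D i) x y =
          (p i : ℂ) * (pureState (Φ i) x y - D i x y) := by
        simp [mul_sub]
      rw [this, norm_mul, Complex.norm_real, Real.norm_of_nonneg (h.1 i)]
      exact mul_le_mul_of_nonneg_left (hΦD i x y) (h.1 i)
    refine hle.trans (Real.le_sqrt_of_sq_le ?_)
    refine (sq_sum_le_sum_mul_sq h.1 h.2.1).trans ?_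
    rw [le_div_iff₀ hK0, mul_comm, Finset.mul_sum]
    refine le_trans (Finset.sum_le_sum fun i _ => ?_) hlt.le
    rw [hC, mul_left_comm]
    exact mul_le_mul_of_nonneg_left (hK _ (hs i).nonneg (hs i).sum_eq) (h.1 i)
  choose D hD hρD using hex
  refine (isClosed_convexHull_pureProductStates d).mem_of_tendsto (f := D)
    (b := Filter.atTop) ?_ (Filter.Eventually.of_forall hD)
  refine tendsto_pi_nhds.2 fun x => tendsto_pi_nhds.2 fun y => ?_
  rw [tendsto_iff_norm_sub_tendsto_zero]
  refine squeeze_zero (fun _ => norm_nonneg _) (fun k => ?_)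
    (g := fun k : ℕ => √((1 / ((k : ℝ) + 1)) / K)) ?_
  · rw [norm_sub_rev]; exact hρD k x y
  · have h1 := (tendsto_one_div_add_atTop_nhds_zero_nat (𝕜 := ℝ)).div_const K
    have h2 := (Real.continuous_sqrt.tendsto _).comp h1
    simpa [Function.comp_def] using h2

/-! ### Weighted averages of the inverse summand -/

section Averages

variable {d : ℕ} {x : Fin d → ℝ}

/-- The weight of the index `i` in the Cauchy-Schwarz estimate of the concurrence, for
`x i = √(d l i)`. -/
noncomputable def csWeight (x : Fin d → ℝ) (i : Fin d) : ℝ :=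
  (∑ j, x j - x i) ^ 2 / (((d : ℝ) - 1) * (d - x i ^ 2))

lemma sq_sum_sub_le (hx : ∑ i, x i ^ 2 = d) (i : Fin d) :
    (∑ j, x j - x i) ^ 2 ≤ ((d : ℝ) - 1) * (d - x i ^ 2) := by
  have h1 : ∑ j, x j - x i = ∑ j ∈ Finset.univ.erase i, x j := by
    rw [← Finset.add_sum_erase _ _ (Finset.mem_univ i)]; ring
  have h2 : (d : ℝ) - x i ^ 2 = ∑ j ∈ Finset.univ.erase i, x j ^ 2 := by
    rw [← hx, ← Finset.add_sum_erase _ _ (Finset.mem_univ i)]; ring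
  have h3 := sq_sum_le_card_mul_sum_sq (s := Finset.univ.erase i) (f := x)
  have h4 : ((Finset.univ.erase i).card : ℝ) = (d : ℝ) - 1 := by
    rw [Finset.card_erase_of_mem (Finset.mem_univ i), Finset.card_fin]
    have : 1 ≤ d := Fin.pos i
    push_cast [this]; ring
  rw [h1, h2, ← h4]
  exact h3

lemma csWeight_nonneg (hd : 3 ≤ d) {i : Fin d} (hi : x i ^ 2 ≤ d) : 0 ≤ csWeight x i := by
  have : (3 : ℝ) ≤ d := by exact_mod_cast hd
  exact div_nonneg (sq_nonneg _) (mul_nonneg (by linarith) (by linarith))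

lemma csWeight_le_one (hd : 3 ≤ d) (hx : ∑ i, x i ^ 2 = d) (i : Fin d) : csWeight x i ≤ 1 := by
  have : (3 : ℝ) ≤ d := by exact_mod_cast hd
  have hle : x i ^ 2 ≤ d := by
    rw [← hx]
    exact Finset.single_le_sum (f := fun i => x i ^ 2) (fun _ _ => sq_nonneg _) (Finset.mem_univ i)
  exact div_le_one_of_le₀ (sq_sum_sub_le hx i) (mul_nonneg (by linarith) (by linarith))

/-- The defect `1 - csWeight x i`, up to the factor `d / (d - x i ^ 2)`, in terms of the mean
`σ` and the variance `V` of `x`. -/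
lemma one_sub_csWeight (hd : 3 ≤ d) {i : Fin d} (hi : x i ^ 2 < d) {σ V : ℝ}
    (hσ : ∑ j, x j = d * σ) (hV : V = 1 - σ ^ 2) :
    1 - csWeight x i = d / (d - x i ^ 2) * (V - (x i - σ) ^ 2 / ((d : ℝ) - 1)) := by
  have h3 : (3 : ℝ) ≤ d := by exact_mod_cast hd
  have h1 : (d : ℝ) - x i ^ 2 ≠ 0 := by linarith
  have h2 : (d : ℝ) - 1 ≠ 0 := by linarith
  rw [csWeight, hσ, hV]
  field_simp
  ring

lemma variance_defect_nonneg (hd : 3 ≤ d) (hx : ∑ i, x i ^ 2 = d) (i : Fin d) {σ V : ℝ}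
    (hσ : ∑ j, x j = d * σ) (hV : V = 1 - σ ^ 2) :
    0 ≤ V - (x i - σ) ^ 2 / ((d : ℝ) - 1) := by
  have h3 : (3 : ℝ) ≤ d := by exact_mod_cast hd
  have h := sq_sum_sub_le hx i
  rw [hσ] at h
  rw [sub_nonneg, div_le_iff₀ (by linarith), hV]
  have : (0 : ℝ) < d := by linarith
  nlinarith

lemma sum_sub_mean_sq (hx : ∑ i, x i ^ 2 = d) {σ V : ℝ}
    (hσ : ∑ j, x j = d * σ) (hV : V = 1 - σ ^ 2) : ∑ i, (x i - σ) ^ 2 = d * V := by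
  have : ∀ i, (x i - σ) ^ 2 = x i ^ 2 - 2 * σ * x i + σ ^ 2 := fun i => by ring
  simp only [this, Finset.sum_add_distrib, Finset.sum_sub_distrib, ← Finset.mul_sum, hx, hσ]
  simp [hV]; ring

lemma sum_variance_defect (hd : 3 ≤ d) (hx : ∑ i, x i ^ 2 = d) {σ V : ℝ}
    (hσ : ∑ j, x j = d * σ) (hV : V = 1 - σ ^ 2) :
    ∑ i, (V - (x i - σ) ^ 2 / ((d : ℝ) - 1)) = d * V * (((d : ℝ) - 2) / (d - 1)) := by
  have h3 : (3 : ℝ) ≤ d := by exact_mod_cast hd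
  have h2 : (d : ℝ) - 1 ≠ 0 := by linarith
  rw [Finset.sum_sub_distrib, ← Finset.sum_div, sum_sub_mean_sq hx hσ hV]
  simp
  field_simp
  ring

lemma variance_defect_le (hd : 3 ≤ d) (hx : ∑ i, x i ^ 2 = d) {i : Fin d} (hi : x i ^ 2 < d)
    {σ V : ℝ} (hσ : ∑ j, x j = d * σ) (hV : V = 1 - σ ^ 2) :
    V - (x i - σ) ^ 2 / ((d : ℝ) - 1) ≤ 1 - csWeight x i := by
  rw [one_sub_csWeight hd hi hσ hV]
  refine le_mul_of_one_le_left (variance_defect_nonneg hd hx i hσ hV) ?_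
  rw [one_le_div (by linarith)]
  linarith [sq_nonneg (x i)]

lemma sum_csWeight_le (hd : 3 ≤ d) (hx : ∑ i, x i ^ 2 = d) (hlt : ∀ i, x i ^ 2 < d) {σ V : ℝ}
    (hσ : ∑ j, x j = d * σ) (hV : V = 1 - σ ^ 2) :
    d * V * (((d : ℝ) - 2) / (d - 1)) ≤ ∑ i, (1 - csWeight x i) := by
  rw [← sum_variance_defect hd hx hσ hV]
  exact Finset.sum_le_sum fun i _ => variance_defect_le hd hx (hlt i) hσ hV

lemma sq_sqrt_min_sub_one_le (hx0 : ∀ i, 0 ≤ x i) (hle : ∀ i, x i ^ 2 ≤ d - 1) (i : Fin d) :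
    (√(min (x i ^ 2) (d - x i ^ 2)) - 1) ^ 2 ≤ (x i - 1) ^ 2 := by
  rcases le_total (x i ^ 2) (d - x i ^ 2) with h | h
  · rw [min_eq_left h, Real.sqrt_sq (hx0 i)]
  · rw [min_eq_right h]
    have h1 : 1 ≤ √(d - x i ^ 2) := Real.one_le_sqrt.2 (by linarith [hle i])
    have h2 : √(d - x i ^ 2) ≤ x i := (Real.sqrt_le_left (hx0 i)).2 h
    exact pow_le_pow_left₀ (by linarith) (by linarith) 2

lemma sum_sub_one_sq (hx : ∑ i, x i ^ 2 = d) {σ : ℝ} (hσ : ∑ j, x j = d * σ) :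
    ∑ i, (x i - 1) ^ 2 = 2 * d * (1 - σ) := by
  have : ∀ i, (x i - 1) ^ 2 = x i ^ 2 - 2 * x i + 1 := fun i => by ring
  simp only [this, Finset.sum_add_distrib, Finset.sum_sub_distrib, ← Finset.mul_sum, hx, hσ]
  simp; ring

lemma mean_bounds (hd : 3 ≤ d) (hx0 : ∀ i, 0 ≤ x i) (hx : ∑ i, x i ^ 2 = d) {σ : ℝ}
    (hσ : ∑ j, x j = d * σ) : 1 / √(d : ℝ) ≤ σ ∧ σ ≤ 1 := by
  have h3 : (3 : ℝ) ≤ d := by exact_mod_cast hd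
  have hd0 : (0 : ℝ) < d := by linarith
  have hσ0 : 0 ≤ σ := by
    have : 0 ≤ d * σ := hσ ▸ Finset.sum_nonneg fun i _ => hx0 i
    exact nonneg_of_mul_nonneg_right this hd0
  constructor
  · have h1 : (d : ℝ) ≤ (∑ i, x i) ^ 2 := by
      rw [← hx]
      exact Finset.sum_sq_le_sq_sum_of_nonneg fun i _ => hx0 i
    rw [hσ] at h1
    have h2 : 1 ≤ d * σ ^ 2 := by
      have : (d : ℝ) * 1 ≤ d * (d * σ ^ 2) := by nlinarith
      exact le_of_mul_le_mul_left this hd0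
    rw [div_le_iff₀ (Real.sqrt_pos.2 hd0)]
    have h4 : (1 : ℝ) ≤ (σ * √(d : ℝ)) ^ 2 := by
      rw [mul_pow, Real.sq_sqrt hd0.le]; linarith
    exact (one_le_sq_iff₀ (by positivity)).1 h4
  · have h1 := sq_sum_le_card_mul_sum_sq (s := Finset.univ) (f := x)
    rw [hσ, hx, Finset.card_fin] at h1
    have h2 : σ ^ 2 ≤ 1 := by
      have : (d : ℝ) * d * σ ^ 2 ≤ d * d * 1 := by nlinarith
      exact le_of_mul_le_mul_left this (by positivity)
    exact (sq_le_one_iff₀ hσ0).1 h2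

/-- The gain over `∑ x i ^ 2 = d` comes from the defects of the weights; when one `x k ^ 2` exceeds
`d / 2`, the minimum is small at `k`, where the defect is magnified. -/
lemma sum_csWeight_mul_min_le (hd : 3 ≤ d) (hx : ∑ i, x i ^ 2 = d) (hlt : ∀ i, x i ^ 2 < d)
    {σ V : ℝ} (hσ : ∑ j, x j = d * σ) (hV : V = 1 - σ ^ 2) :
    ∑ i, csWeight x i * min (x i ^ 2) (d - x i ^ 2) ≤
      d - d * V * (((d : ℝ) - 2) / (d - 1)) / 2 := by
  have h3 : (3 : ℝ) ≤ d := by exact_mod_cast hd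
  have hn : (0 : ℝ) < d - 1 := by linarith
  have hV1 : V ≤ 1 := by rw [hV]; linarith [sq_nonneg σ]
  set u : Fin d → ℝ := fun i => V - (x i - σ) ^ 2 / ((d : ℝ) - 1) with hu
  have hu0 : ∀ i, 0 ≤ u i := fun i => variance_defect_nonneg hd hx i hσ hV
  have hule : ∀ i, u i ≤ 1 - csWeight x i := fun i => variance_defect_le hd hx (hlt i) hσ hV
  have hvar := sum_sub_mean_sq hx hσ hV
  by_cases hall : ∀ i, x i ^ 2 ≤ d / 2
  · have h1 : ∀ i, csWeight x i * min (x i ^ 2) (d - x i ^ 2) ≤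
        x i ^ 2 - (V * x i ^ 2 - (d / 2) / ((d : ℝ) - 1) * (x i - σ) ^ 2) := by
      intro i
      rw [min_eq_left (by linarith [hall i])]
      have h2 : (x i - σ) ^ 2 / ((d : ℝ) - 1) * x i ^ 2 ≤
          (x i - σ) ^ 2 / ((d : ℝ) - 1) * (d / 2) :=
        mul_le_mul_of_nonneg_left (hall i) (by positivity)
      have h4 := mul_le_mul_of_nonneg_right (hule i) (sq_nonneg (x i))
      simp only [hu] at h4
      have h5 : (d / 2) / ((d : ℝ) - 1) * (x i - σ) ^ 2 =
        (x i - σ) ^ 2 / ((d : ℝ) - 1) * (d / 2) := by ring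
      rw [h5]
      nlinarith
    refine (Finset.sum_le_sum fun i _ => h1 i).trans (le_of_eq ?_)
    rw [Finset.sum_sub_distrib, Finset.sum_sub_distrib, ← Finset.mul_sum, ← Finset.mul_sum, hx,
      hvar]
    field_simp
    ring
  · push Not at hall
    obtain ⟨k, hk⟩ := hall
    set m : ℝ := d - x k ^ 2 with hm
    have hm0 : 0 < m := sub_pos.2 (hlt k)
    have hsum : ∑ j ∈ Finset.univ.erase k, x j ^ 2 = m := by
      rw [hm, ← hx, ← Finset.add_sum_erase _ _ (Finset.mem_univ k)]; ring
    have hjm : ∀ j ∈ Finset.univ.erase k, x j ^ 2 ≤ m := fun j hj => by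
      rw [← hsum]
      exact Finset.single_le_sum (f := fun j => x j ^ 2) (fun _ _ => sq_nonneg _) hj
    have hvark : ∑ j ∈ Finset.univ.erase k, (x j - σ) ^ 2 = d * V - (x k - σ) ^ 2 := by
      rw [← hvar, ← Finset.add_sum_erase _ _ (Finset.mem_univ k)]; ring
    have h1 : ∀ j ∈ Finset.univ.erase k, csWeight x j * min (x j ^ 2) (d - x j ^ 2) ≤
        x j ^ 2 - (V * x j ^ 2 - m / ((d : ℝ) - 1) * (x j - σ) ^ 2) := by
      intro j hj
      have hjm' := hjm j hj
      rw [min_eq_left (by linarith)]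
      have h2 : (x j - σ) ^ 2 / ((d : ℝ) - 1) * x j ^ 2 ≤ (x j - σ) ^ 2 / ((d : ℝ) - 1) * m :=
        mul_le_mul_of_nonneg_left hjm' (by positivity)
      have h4 := mul_le_mul_of_nonneg_right (hule j) (sq_nonneg (x j))
      simp only [hu] at h4
      have h5 : m / ((d : ℝ) - 1) * (x j - σ) ^ 2 = (x j - σ) ^ 2 / ((d : ℝ) - 1) * m := by ring
      rw [h5]
      nlinarith
    have hkey : csWeight x k * min (x k ^ 2) (d - x k ^ 2) = m - d * u k := by
      have h6 := one_sub_csWeight hd (hlt k) hσ hV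
      rw [min_eq_right (by linarith), ← hm]
      rw [← hm] at h6
      have h7 : csWeight x k = 1 - d / m * u k := by simp only [hu]; linarith
      rw [h7]
      field_simp
    rw [← Finset.add_sum_erase _ _ (Finset.mem_univ k), hkey]
    have h8 := Finset.sum_le_sum h1
    rw [Finset.sum_sub_distrib, Finset.sum_sub_distrib, ← Finset.mul_sum, ← Finset.mul_sum, hsum,
      hvark] at h8
    have h9 : (x k - σ) ^ 2 ≤ ((d : ℝ) - 1) * V := by
      have := hu0 k
      simp only [hu, sub_nonneg, div_le_iff₀ hn] at this
      linarith
    -- it remains to bound a linear function of `(x k - σ) ^ 2`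
    have h10 : V * ((((d : ℝ) - 2) / (d - 1)) * d / 2) ≤
        (d - 2 * m) + V * m * ((d - 2) / (d - 1)) := by
      have hr1 : ((d : ℝ) - 2) / (d - 1) ≤ 1 := by rw [div_le_one hn]; linarith
      have hr0 : 0 ≤ ((d : ℝ) - 2) / (d - 1) := div_nonneg (by linarith) hn.le
      have hrV : V * (((d : ℝ) - 2) / (d - 1)) ≤ 1 := by nlinarith
      have : V * (((d : ℝ) - 2) / (d - 1)) * (d / 2 - m) ≤ 1 * (d / 2 - m) :=
        mul_le_mul_of_nonneg_right hrV (by linarith)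
      nlinarith
    have h11 : m / ((d : ℝ) - 1) * (d * V - (x k - σ) ^ 2) - V * m - d * u k ≤
        - (V * m * ((d - 2) / (d - 1))) := by
      simp only [hu]
      have e : m / ((d : ℝ) - 1) * (d * V - (x k - σ) ^ 2) - V * m
          - d * (V - (x k - σ) ^ 2 / ((d : ℝ) - 1)) + V * m * ((d - 2) / (d - 1)) =
          (d - m) / (d - 1) * ((x k - σ) ^ 2 - (d - 1) * V) := by
        field_simp
        ring
      have : (d - m) / ((d : ℝ) - 1) * ((x k - σ) ^ 2 - (d - 1) * V) ≤ 0 :=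
        mul_nonpos_of_nonneg_of_nonpos (div_nonneg (by linarith) hn.le) (by linarith)
      linarith
    linarith

/-- Averaging the bound `1 + b (y - 1) + C (√y - 1) ^ 2`. -/
lemma sum_csWeight_mul_affine_le (hd : 3 ≤ d) (hx0 : ∀ i, 0 ≤ x i) (hx : ∑ i, x i ^ 2 = d)
    (hle : ∀ i, x i ^ 2 ≤ d - 1) {a : Fin d → ℝ} {b C : ℝ} (hb0 : 0 ≤ b) (hb1 : b ≤ 1)
    (hC0 : 0 ≤ C)
    (hC : C ≤ (1 - b / 2) * (((d : ℝ) - 2) / (d - 1)) * ((1 + 1 / √(d : ℝ)) / 2))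
    (ha : ∀ i, a i ≤ 1 + b * (min (x i ^ 2) (d - x i ^ 2) - 1)
      + C * (√(min (x i ^ 2) (d - x i ^ 2)) - 1) ^ 2) :
    ∑ i, csWeight x i * a i ≤ d := by
  have h3 : (3 : ℝ) ≤ d := by exact_mod_cast hd
  have hlt : ∀ i, x i ^ 2 < d := fun i => by linarith [hle i]
  obtain ⟨σ, hσ⟩ : ∃ σ : ℝ, ∑ j, x j = d * σ := ⟨(∑ j, x j) / d, by field_simp⟩
  obtain ⟨hσ0, hσ1⟩ := mean_bounds hd hx0 hx hσ
  have hsd : (0 : ℝ) ≤ 1 / √(d : ℝ) := by positivity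
  set V : ℝ := 1 - σ ^ 2 with hV
  have hV0 : 0 ≤ V := by rw [hV]; nlinarith
  have hδ := sq_sqrt_min_sub_one_le hx0 hle
  have hterm : ∀ i, csWeight x i * a i ≤ (1 - b) - (1 - b) * (1 - csWeight x i)
      + b * (csWeight x i * min (x i ^ 2) (d - x i ^ 2)) + C * (x i - 1) ^ 2 := by
    intro i
    have hw0 := csWeight_nonneg hd (hlt i).le
    have hw1 := csWeight_le_one hd hx i
    have h1 := mul_le_mul_of_nonneg_left (ha i) hw0
    have h2 : csWeight x i * (C * (√(min (x i ^ 2) (d - x i ^ 2)) - 1) ^ 2) ≤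
        1 * (C * (x i - 1) ^ 2) :=
      mul_le_mul hw1 (mul_le_mul_of_nonneg_left (hδ i) hC0) (by positivity) zero_le_one
    nlinarith
  have h4 := sum_csWeight_le hd hx hlt hσ hV
  have h5 := sum_csWeight_mul_min_le hd hx hlt hσ hV
  have h6 := sum_sub_one_sq hx hσ
  calc ∑ i, csWeight x i * a i ≤ _ := Finset.sum_le_sum fun i _ => hterm i
    _ = d * (1 - b) - (1 - b) * ∑ i, (1 - csWeight x i)
        + b * ∑ i, csWeight x i * min (x i ^ 2) (d - x i ^ 2) + C * (2 * d * (1 - σ)) := by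
      rw [Finset.sum_add_distrib, Finset.sum_add_distrib, Finset.sum_sub_distrib,
        ← Finset.mul_sum, ← Finset.mul_sum, ← Finset.mul_sum, h6]
      simp
      ring
    _ ≤ d := by
      set r : ℝ := ((d : ℝ) - 2) / (d - 1)
      have hr0 : 0 ≤ r := div_nonneg (by linarith) (by linarith)
      have h7 := mul_le_mul_of_nonneg_left h4 (sub_nonneg.2 hb1)
      have h8 := mul_le_mul_of_nonneg_left h5 hb0
      have h9 : C * 2 ≤ (1 - b / 2) * r * (1 + σ) := by
        have : (1 - b / 2) * r * ((1 + 1 / √(d : ℝ)) / 2) ≤ (1 - b / 2) * r * ((1 + σ) / 2) :=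
          mul_le_mul_of_nonneg_left (by linarith) (mul_nonneg (by linarith) hr0)
        linarith
      have h10 : C * (2 * d * (1 - σ)) ≤ (1 - b / 2) * (d * V * r) := by
        have := mul_le_mul_of_nonneg_left h9 (show 0 ≤ (d : ℝ) * (1 - σ) by
          exact mul_nonneg (by linarith) (by linarith))
        have e : V = (1 - σ) * (1 + σ) := by rw [hV]; ring
        rw [e]
        linarith
      linarith

/-- The inequality for the mean `σ` to which averaging the quadratic bound comes down; `σ = 1` is a
root. -/
lemma cubic_nonneg_of_mean_ge {d rd ν σ c : ℝ} (hrd : 2 ≤ rd) (hrd2 : rd ^ 2 = d) (hν0 : 0 ≤ ν)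
    (hν1 : ν ≤ 1) (hσrd : 1 ≤ σ * rd) (hσ1 : σ ≤ 1) (hσp : 0 < σ)
    (hc : c ≤ (ν * ((d - 1) * (d - 2)) + (1 - ν) * d ^ 2) - (1 - ν) * (1 + rd)) :
    0 ≤ (1 + σ) * ((ν * ((d - 1) * (d - 2)) + (1 - ν) * d ^ 2) * σ - (1 - ν) * (1 + rd))
      - 2 * c * σ ^ 3 := by
  have hd4 : 4 ≤ d := by nlinarith
  have h0 : 0 ≤ ν * ((d - 1) * (d - 2)) := mul_nonneg hν0 (by nlinarith)
  have h1 : (1 + rd) * (rd + 2) ≤ d ^ 2 := by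
    have h2 : (1 + rd) * (rd + 2) ≤ 4 * d := by rw [← hrd2]; nlinarith
    nlinarith
  have h3 := mul_le_mul_of_nonneg_left h1 (sub_nonneg.2 hν1)
  have hB0 : 0 ≤ (1 - ν) * (1 + rd) := mul_nonneg (by linarith) (by linarith)
  set A := ν * ((d - 1) * (d - 2)) + (1 - ν) * d ^ 2 with hA
  set B := (1 - ν) * (1 + rd) with hB
  have hAB : B * rd ≤ A - 2 * B := by
    have : (1 - ν) * ((1 + rd) * (rd + 2)) = B * rd + 2 * B := by rw [hB]; ring
    linarith
  have h4 : 2 * c * σ ^ 3 ≤ 2 * (A - B) * σ ^ 3 := by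
    have := mul_le_mul_of_nonneg_right hc (show 0 ≤ σ ^ 3 by positivity)
    linarith
  have h5 : (1 + σ) * (A * σ - B) - 2 * (A - B) * σ ^ 3 =
      (1 - σ) * (2 * (A - B) * σ ^ 2 + ((A - 2 * B) * σ - B)) := by ring
  have h6 : 0 ≤ (A - 2 * B) * σ - B := by
    have := mul_le_mul_of_nonneg_right hAB hσp.le
    have := mul_le_mul_of_nonneg_left hσrd hB0
    linarith
  have h7 : 0 ≤ A - B := by
    have := mul_nonneg hB0 (show 0 ≤ rd by linarith)
    linarith
  have h8 : 0 ≤ (1 - σ) * (2 * (A - B) * σ ^ 2 + ((A - 2 * B) * σ - B)) :=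
    mul_nonneg (by linarith) (by positivity)
  linarith

/-- Averaging the bound `ν + (1 - ν) y (d - y) / (d - 1) + C (√y - 1) ^ 2 (d - y) / (d - 1)`. -/
lemma sum_csWeight_mul_quadratic_le (hd : 5 ≤ d) (hx0 : ∀ i, 0 ≤ x i) (hx : ∑ i, x i ^ 2 = d)
    (hlt : ∀ i, x i ^ 2 < d) {a : Fin d → ℝ} {ν C : ℝ} (hν0 : 0 ≤ ν) (hν1 : ν ≤ 1) (hC0 : 0 ≤ C)
    (hC : C * d ^ 2 ≤ ν * (((d : ℝ) - 1) * (d - 2)) + (1 - ν) * (d ^ 2 - 1 - √(d : ℝ)))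
    (ha : ∀ i, a i ≤ ν + (1 - ν) * (x i ^ 2 * (d - x i ^ 2) / ((d : ℝ) - 1))
      + C * ((x i - 1) ^ 2 * ((d - x i ^ 2) / ((d : ℝ) - 1)))) :
    ∑ i, csWeight x i * a i ≤ d := by
  have h5 : (5 : ℝ) ≤ d := by exact_mod_cast hd
  have hd3 : 3 ≤ d := by omega
  have hn : (0 : ℝ) < d - 1 := by linarith
  have hd0 : (0 : ℝ) < d := by linarith
  obtain ⟨σ, hσ⟩ : ∃ σ : ℝ, ∑ j, x j = d * σ := ⟨(∑ j, x j) / d, by field_simp⟩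
  obtain ⟨hσ0, hσ1⟩ := mean_bounds hd3 hx0 hx hσ
  set rd := √(d : ℝ) with hrd
  have hrd2 : rd ^ 2 = d := Real.sq_sqrt hd0.le
  have hrd0 : 0 < rd := Real.sqrt_pos.2 hd0
  have hrd_gt : 2 ≤ rd := by
    rw [hrd]; exact Real.le_sqrt_of_sq_le (by linarith)
  have hσp : 0 < σ := lt_of_lt_of_le (by positivity) hσ0
  have hσrd : 1 ≤ σ * rd := by rwa [div_le_iff₀ hrd0] at hσ0
  set V : ℝ := 1 - σ ^ 2 with hV
  have hV0 : 0 ≤ V := by rw [hV]; nlinarith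
  have hxle : ∀ i, x i ≤ rd := fun i => Real.le_sqrt_of_sq_le (hlt i).le
  have hxs : ∀ i, x i ≤ d * σ := fun i => hσ ▸
    Finset.single_le_sum (f := x) (fun j _ => hx0 j) (Finset.mem_univ i)
  have hterm : ∀ i, csWeight x i * a i ≤ ν - ν * (1 - csWeight x i) +
      (1 - ν) / ((d : ℝ) - 1) ^ 2 * (x i ^ 2 * (d * σ - x i) ^ 2)
      + C / ((d : ℝ) - 1) ^ 2 * ((d * σ) ^ 2 * (x i - 1) ^ 2) := by
    intro i
    have hw0 := csWeight_nonneg hd3 (hlt i).le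
    have h1 := mul_le_mul_of_nonneg_left (ha i) hw0
    have h2 : csWeight x i * ((d - x i ^ 2) / ((d : ℝ) - 1)) =
        (d * σ - x i) ^ 2 / ((d : ℝ) - 1) ^ 2 := by
      have : (d : ℝ) - x i ^ 2 ≠ 0 := by linarith [hlt i]
      rw [csWeight, hσ]
      field_simp
    have h3 : (d * σ - x i) ^ 2 ≤ (d * σ) ^ 2 :=
      pow_le_pow_left₀ (by linarith [hxs i]) (by linarith [hx0 i]) 2
    have h4 : C * (x i - 1) ^ 2 * ((d * σ - x i) ^ 2 / ((d : ℝ) - 1) ^ 2) ≤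
        C * (x i - 1) ^ 2 * ((d * σ) ^ 2 / ((d : ℝ) - 1) ^ 2) := by gcongr
    calc csWeight x i * a i ≤ _ := h1
      _ = ν - ν * (1 - csWeight x i)
          + (1 - ν) * x i ^ 2 * (csWeight x i * ((d - x i ^ 2) / ((d : ℝ) - 1)))
          + C * (x i - 1) ^ 2 * (csWeight x i * ((d - x i ^ 2) / ((d : ℝ) - 1))) := by ring
      _ ≤ _ := by
        rw [h2]
        have e1 : (1 - ν) / ((d : ℝ) - 1) ^ 2 * (x i ^ 2 * (d * σ - x i) ^ 2) =
          (1 - ν) * x i ^ 2 * ((d * σ - x i) ^ 2 / ((d : ℝ) - 1) ^ 2) := by ring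
        have e2 : C / ((d : ℝ) - 1) ^ 2 * ((d * σ) ^ 2 * (x i - 1) ^ 2) =
          C * (x i - 1) ^ 2 * ((d * σ) ^ 2 / ((d : ℝ) - 1) ^ 2) := by ring
        rw [e1, e2]
        linarith
  have h4 := sum_csWeight_le hd3 hx hlt hσ hV
  have h6 := sum_sub_one_sq hx hσ
  -- the excess of the third moment controls the quartic sum
  set c3 := ∑ i, (x i - 1) ^ 2 * (x i + 1) with hc3
  have hc3eq : c3 = ∑ i, x i ^ 3 - d * σ := by
    have : ∀ i, (x i - 1) ^ 2 * (x i + 1) = x i ^ 3 - x i ^ 2 - x i + 1 := fun i => by ring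
    rw [hc3]
    simp only [this, Finset.sum_add_distrib, Finset.sum_sub_distrib, hx, hσ]
    simp; ring
  have hc3ge : d * V / σ ≤ c3 := by
    have h := Finset.sum_nonneg (s := Finset.univ) (f := fun i => x i * (x i - 1 / σ) ^ 2)
      (fun i _ => mul_nonneg (hx0 i) (sq_nonneg _))
    have : ∀ i, x i * (x i - 1 / σ) ^ 2 = x i ^ 3 - 2 / σ * x i ^ 2 + 1 / σ ^ 2 * x i :=
      fun i => by ring
    simp only [this, Finset.sum_add_distrib, Finset.sum_sub_distrib, ← Finset.mul_sum, hx, hσ] at h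
    have e : d * V / σ = d / σ - d * σ := by rw [hV]; field_simp
    have e2 : 1 / σ ^ 2 * (d * σ) = d / σ := by field_simp
    have e3 : 2 / σ * (d : ℝ) = 2 * (d / σ) := by ring
    rw [hc3eq, e]
    rw [e2, e3] at h
    linarith
  have hv : ∑ i, x i ^ 4 - d ≤ (1 + rd) * c3 := by
    have : ∀ i, (x i - 1) ^ 2 * (x i + 1) ^ 2 = x i ^ 4 - 2 * x i ^ 2 + 1 := fun i => by ring
    have e : ∑ i, (x i - 1) ^ 2 * (x i + 1) ^ 2 = ∑ i, x i ^ 4 - d := by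
      simp only [this, Finset.sum_add_distrib, Finset.sum_sub_distrib, ← Finset.mul_sum, hx]
      simp; ring
    rw [← e, hc3, Finset.mul_sum]
    refine Finset.sum_le_sum fun i _ => ?_
    have h1 : 0 ≤ (x i - 1) ^ 2 * (x i + 1) := mul_nonneg (sq_nonneg _) (by linarith [hx0 i])
    have h2 := mul_le_mul_of_nonneg_left (show x i + 1 ≤ 1 + rd by linarith [hxle i]) h1
    linarith
  have hquart : ∑ i, x i ^ 2 * (d * σ - x i) ^ 2 =
      d * ((d : ℝ) - 1) ^ 2 - d * (d * (d - 2)) * V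
        - (2 * d * σ * c3 - (∑ i, x i ^ 4 - d)) := by
    have : ∀ i, x i ^ 2 * (d * σ - x i) ^ 2 =
      (d * σ) ^ 2 * x i ^ 2 - 2 * (d * σ) * x i ^ 3 + x i ^ 4 := fun i => by ring
    simp only [this, Finset.sum_add_distrib, Finset.sum_sub_distrib, ← Finset.mul_sum, hx]
    rw [hc3eq, hV]
    ring
  have hquart' : ∑ i, x i ^ 2 * (d * σ - x i) ^ 2 ≤
      d * ((d : ℝ) - 1) ^ 2 - d * V * (d ^ 2 - (1 + rd) / σ) := by
    have h1 : 0 ≤ 2 * d * σ - (1 + rd) := by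
      have : (2 : ℝ) * d * σ = 2 * rd * (σ * rd) := by rw [← hrd2]; ring
      nlinarith
    have h2 := mul_le_mul_of_nonneg_left hc3ge h1
    have e : (2 * d * σ - (1 + rd)) * (d * V / σ) = d * V * (2 * d - (1 + rd) / σ) := by
      field_simp
    rw [e] at h2
    rw [hquart]
    linarith
  calc ∑ i, csWeight x i * a i ≤ _ := Finset.sum_le_sum fun i _ => hterm i
    _ = d * ν - ν * ∑ i, (1 - csWeight x i)
        + (1 - ν) / ((d : ℝ) - 1) ^ 2 * ∑ i, x i ^ 2 * (d * σ - x i) ^ 2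
        + C / ((d : ℝ) - 1) ^ 2 * ((d * σ) ^ 2 * (2 * d * (1 - σ))) := by
      rw [Finset.sum_add_distrib, Finset.sum_add_distrib, Finset.sum_sub_distrib,
        ← Finset.mul_sum, ← Finset.mul_sum, ← Finset.mul_sum, ← Finset.mul_sum, h6]
      simp
    _ ≤ d * ν - ν * (d * V * (((d : ℝ) - 2) / (d - 1)))
        + (1 - ν) / ((d : ℝ) - 1) ^ 2 *
          (d * ((d : ℝ) - 1) ^ 2 - d * V * (d ^ 2 - (1 + rd) / σ))
        + C / ((d : ℝ) - 1) ^ 2 * ((d * σ) ^ 2 * (2 * d * (1 - σ))) := by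
      gcongr
    _ = d - d * (1 - σ) / (((d : ℝ) - 1) ^ 2 * σ) *
        ((1 + σ) * ((ν * (((d : ℝ) - 1) * (d - 2)) + (1 - ν) * d ^ 2) * σ - (1 - ν) * (1 + rd))
          - 2 * (C * d ^ 2) * σ ^ 3) := by
      rw [hV]
      field_simp
      ring_nf
    _ ≤ d := by
      have hfac : 0 ≤ d * (1 - σ) / (((d : ℝ) - 1) ^ 2 * σ) := by
        have : 0 ≤ 1 - σ := by linarith
        positivity
      refine sub_le_self _ (mul_nonneg hfac ?_)
      exact cubic_nonneg_of_mean_ge hrd_gt hrd2 hν0 hν1 hσrd hσ1 hσp (by linarith)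

end Averages
/-- The Cauchy-Schwarz reduction: it is enough to average bounds `a i` of the ratios
`y (d - y) g₀ / ((d - 1) g)`, `y = d l i`, against the weights `csWeight`. -/
lemma le_sum_of_csWeight {d : ℕ} (hd : 3 ≤ d) {l : Fin d → ℝ} (hl0 : ∀ i, 0 ≤ l i)
    (hl1 : ∑ i, l i = 1) (hlt : ∀ i, l i < 1) {g₀ : ℝ} (hg₀ : 0 < g₀) {g a : Fin d → ℝ}
    (hg : ∀ i, 0 ≤ g i) (ha : ∀ i, 0 ≤ a i)
    (hag : ∀ i, d * l i * (d - d * l i) / ((d : ℝ) - 1) * g₀ ≤ a i * g i)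
    (hsum : ∑ i, csWeight (fun i => √(d * l i)) i * a i ≤ d) :
    d * g₀ / ((d : ℝ) - 1) ^ 2 * ((∑ i, √(l i)) ^ 2 - 1) ^ 2 ≤ ∑ i, g i := by
  have h3 : (3 : ℝ) ≤ d := by exact_mod_cast hd
  have hd0 : (0 : ℝ) < d := by linarith
  have hn : (0 : ℝ) < d - 1 := by linarith
  set x : Fin d → ℝ := fun i => √(d * l i) with hx
  have hx2 : ∀ i, x i ^ 2 = d * l i := fun i => Real.sq_sqrt (mul_nonneg hd0.le (hl0 i))
  have hx0 : ∀ i, 0 ≤ x i := fun i => Real.sqrt_nonneg _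
  set s := ∑ i, x i with hs
  have hs2 : s ^ 2 = d * (∑ i, √(l i)) ^ 2 := by
    have : s = √(d : ℝ) * ∑ i, √(l i) := by
      rw [hs, Finset.mul_sum]
      exact Finset.sum_congr rfl fun i _ => Real.sqrt_mul hd0.le _
    rw [this, mul_pow, Real.sq_sqrt hd0.le]
  have hxs : ∀ i, x i ≤ s := fun i =>
    Finset.single_le_sum (f := x) (fun j _ => hx0 j) (Finset.mem_univ i)
  have hxx : ∑ i, x i ^ 2 = d := by simp only [hx2, ← Finset.mul_sum, hl1, mul_one]
  have hlin : ∑ i, x i * (s - x i) = d * ((∑ i, √(l i)) ^ 2 - 1) := by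
    have : ∀ i, x i * (s - x i) = s * x i - x i ^ 2 := fun i => by ring
    simp only [this, Finset.sum_sub_distrib, ← Finset.mul_sum, hxx, ← hs]
    rw [← sq, hs2]; ring
  have hterm : ∀ i, (x i * (s - x i)) ^ 2 ≤
      (g i / g₀) * (((d : ℝ) - 1) ^ 2 * (csWeight x i * a i)) := by
    intro i
    have hdl : 0 < (d : ℝ) - d * l i := by nlinarith [hlt i]
    have hne : 1 - l i ≠ 0 := (sub_pos.2 (hlt i)).ne'
    have e : csWeight x i = (s - x i) ^ 2 / (((d : ℝ) - 1) * (d - d * l i)) := by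
      rw [csWeight, hx2]
    have h1 := mul_le_mul_of_nonneg_right (hag i)
      (show 0 ≤ (s - x i) ^ 2 * ((d : ℝ) - 1) / ((d - d * l i) * g₀) by positivity)
    have e1 : d * l i * (d - d * l i) / ((d : ℝ) - 1) * g₀ *
        ((s - x i) ^ 2 * ((d : ℝ) - 1) / ((d - d * l i) * g₀)) = (x i * (s - x i)) ^ 2 := by
      rw [mul_pow, hx2]
      field_simp
    rw [e1] at h1
    refine h1.trans (le_of_eq ?_)
    rw [e]
    field_simp
  have hw0 : ∀ i, 0 ≤ csWeight x i := fun i => csWeight_nonneg hd (by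
    rw [hx2]; nlinarith [hlt i])
  have hCS : (∑ i, x i * (s - x i)) ^ 2 ≤
      (∑ i, g i / g₀) * ∑ i, ((d : ℝ) - 1) ^ 2 * (csWeight x i * a i) := by
    have h1 : ∑ i, x i * (s - x i) ≤
        ∑ i, √(g i / g₀) * √(((d : ℝ) - 1) ^ 2 * (csWeight x i * a i)) := by
      refine Finset.sum_le_sum fun i _ => ?_
      rw [← Real.sqrt_mul (div_nonneg (hg i) hg₀.le)]
      exact Real.le_sqrt_of_sq_le (hterm i)
    have h0 : 0 ≤ ∑ i, x i * (s - x i) :=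
      Finset.sum_nonneg fun i _ => mul_nonneg (hx0 i) (sub_nonneg.2 (hxs i))
    refine (pow_le_pow_left₀ h0 h1 2).trans ?_
    refine (Finset.sum_mul_sq_le_sq_mul_sq _ _ _).trans (le_of_eq ?_)
    congr 1
    · exact Finset.sum_congr rfl fun i _ => Real.sq_sqrt (div_nonneg (hg i) hg₀.le)
    · refine Finset.sum_congr rfl fun i _ => Real.sq_sqrt ?_
      exact mul_nonneg (sq_nonneg _) (mul_nonneg (hw0 i) (ha i))
  rw [hlin, ← Finset.mul_sum, ← Finset.sum_div] at hCS
  have hG : 0 ≤ (∑ i, g i) / g₀ := div_nonneg (Finset.sum_nonneg fun i _ => hg i) hg₀.le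
  have h4 : (∑ i, g i) / g₀ * (((d : ℝ) - 1) ^ 2 * ∑ i, csWeight x i * a i) ≤
      (∑ i, g i) / g₀ * (((d : ℝ) - 1) ^ 2 * d) := by gcongr
  have h5 := hCS.trans h4
  have h6 : d * ((d : ℝ) * (((∑ i, √(l i)) ^ 2 - 1) ^ 2 * g₀)) ≤
      d * ((∑ i, g i) * ((d : ℝ) - 1) ^ 2) := by
    have := mul_le_mul_of_nonneg_right h5 hg₀.le
    have e : (∑ i, g i) / g₀ * (((d : ℝ) - 1) ^ 2 * d) * g₀ =
      d * ((∑ i, g i) * ((d : ℝ) - 1) ^ 2) := by field_simp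
    rw [e] at this
    linarith
  have h7 := le_of_mul_le_mul_left h6 hd0
  rw [div_mul_eq_mul_div, div_le_iff₀ (by positivity)]
  linarith

/-! ### Positivity of the summand -/

lemma concSummand_one_sub (q t : ℝ) : concSummand q (1 - t) = concSummand q t := by
  simp only [concSummand, sub_sub_cancel]; ring

lemma concSummand_nonneg {q t : ℝ} (hq : 1 ≤ q) (h0 : 0 ≤ t) (h1 : t ≤ 1) :
    0 ≤ concSummand q t := by
  have e1 : t ^ q ≤ t := by
    simpa using Real.rpow_le_rpow_of_exponent_ge' h0 h1 zero_le_one hq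
  have e2 : (1 - t) ^ q ≤ 1 - t := by
    simpa using Real.rpow_le_rpow_of_exponent_ge' (sub_nonneg.2 h1) (by linarith) zero_le_one hq
  simp only [concSummand]; linarith

lemma concSummand_pos {q t : ℝ} (hq : 1 < q) (h0 : 0 < t) (h1 : t < 1) :
    0 < concSummand q t := by
  have e1 : t ^ q < t := by simpa using Real.rpow_lt_rpow_of_exponent_gt h0 h1 hq
  have e2 : (1 - t) ^ q < 1 - t := by
    simpa using Real.rpow_lt_rpow_of_exponent_gt (sub_pos.2 h1) (by linarith) hq
  simp only [concSummand]; linarith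

/-! ### From one-variable bounds to pure states -/

lemma csWeight_sqrt_setup {d : ℕ} {l : Fin d → ℝ} (hl0 : ∀ i, 0 ≤ l i) (hl1 : ∑ i, l i = 1) :
    (∀ i, √(d * l i) ^ 2 = d * l i) ∧ ∑ i, √(d * l i) ^ 2 = d := by
  have h : ∀ i, √(d * l i) ^ 2 = d * l i := fun i =>
    Real.sq_sqrt (mul_nonneg (Nat.cast_nonneg _) (hl0 i))
  refine ⟨h, ?_⟩
  simp only [h, ← Finset.mul_sum, hl1, mul_one]

/-- In the presence of an eigenvalue above `1 - 1 / d` the variance is at least `((d - 2) / d) ^ 2`,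
and the defects of the weights add up to at least `d / 18`. -/
lemma sum_csWeight_le_of_large {d : ℕ} (hd : 3 ≤ d) {x : Fin d → ℝ}
    (hx : ∑ i, x i ^ 2 = d) (hlt : ∀ i, x i ^ 2 < d) {k : Fin d} (hk : (d : ℝ) - 1 < x k ^ 2) :
    ∑ i, csWeight x i ≤ 17 / 18 * d := by
  have h3 : (3 : ℝ) ≤ d := by exact_mod_cast hd
  have hd0 : (0 : ℝ) < d := by linarith
  have hn : (0 : ℝ) < d - 1 := by linarith
  obtain ⟨σ, hσ⟩ : ∃ σ : ℝ, ∑ j, x j = d * σ := ⟨(∑ j, x j) / d, by field_simp⟩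
  have h1 := sum_csWeight_le hd hx hlt hσ rfl
  have h2 := sq_sum_sub_le hx k
  rw [hσ] at h2
  have h4 : (d * σ) ^ 2 ≤ 4 * ((d : ℝ) - 1) := by
    have h5 : (d * σ) ^ 2 ≤ 2 * x k ^ 2 + 2 * (d * σ - x k) ^ 2 := by
      nlinarith [sq_nonneg (d * σ - x k - x k)]
    nlinarith
  have h6 : ((d : ℝ) - 2) ^ 2 ≤ d ^ 2 * (1 - σ ^ 2) := by
    rw [mul_pow] at h4; linarith
  have h7 : (d : ℝ) / 18 ≤ d * (1 - σ ^ 2) * (((d : ℝ) - 2) / (d - 1)) := by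
    have h8 := mul_le_mul_of_nonneg_right h6 (show (0 : ℝ) ≤ d - 2 by linarith)
    have h9 : (d : ℝ) ^ 2 * (d - 1) ≤ 18 * (d - 2) ^ 3 := by
      obtain ⟨y, hy⟩ : ∃ y : ℝ, (d : ℝ) = 3 + y := ⟨d - 3, by ring⟩
      have : 0 ≤ y := by linarith
      rw [hy, ← sub_nonneg]
      ring_nf
      positivity
    rw [mul_div_assoc', div_le_div_iff₀ (by norm_num) hn]
    refine le_of_mul_le_mul_left ?_ hd0
    linarith
  rw [Finset.sum_sub_distrib] at h1
  simp only [Finset.sum_const, Finset.card_univ, Fintype.card_fin, nsmul_eq_mul, mul_one] at h1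
  linarith

/-- Here `A y` bounds the ratio `y (d - y) g₀ / ((d - 1) g)` for `y ≤ d / 2`; the bound extends to
`y ≥ d / 2` by symmetry, and in the presence of an eigenvalue above `1 - 1 / d` a uniform bound of
the ratio is enough. -/
lemma isConcurrenceBound_of_ratio_bound {d : ℕ} (hd : 3 ≤ d) {q : ℝ} (hq : 1 < q) {A : ℝ → ℝ}
    (hsmall : ∀ y : ℝ, 0 ≤ y → y ≤ 1 →
      y * (d - y) / ((d : ℝ) - 1) * concSummand q (1 / d) ≤ 18 / 17 * concSummand q (y / d))
    (hA0 : ∀ y : ℝ, 0 ≤ y → y ≤ d / 2 → 0 ≤ A y)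
    (hA : ∀ y : ℝ, 0 ≤ y → y ≤ d / 2 →
      y * (d - y) / ((d : ℝ) - 1) * concSummand q (1 / d) ≤ A y * concSummand q (y / d))
    (hsum : ∀ x : Fin d → ℝ, (∀ i, 0 ≤ x i) → ∑ i, x i ^ 2 = d → (∀ i, x i ^ 2 ≤ d - 1) →
      ∑ i, csWeight x i * A (min (x i ^ 2) (d - x i ^ 2)) ≤ d) :
    IsConcurrenceBound d q (d * concSummand q (1 / d) / ((d : ℝ) - 1) ^ 2) := by
  intro l hl0 hl1
  have h3 : (3 : ℝ) ≤ d := by exact_mod_cast hd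
  have hd0 : (0 : ℝ) < d := by linarith
  have hg₀ : 0 < concSummand q (1 / d) :=
    concSummand_pos hq (by positivity) (by rw [div_lt_one hd0]; linarith)
  have hle : ∀ i, l i ≤ 1 := fun i =>
    hl1 ▸ Finset.single_le_sum (f := l) (fun j _ => hl0 j) (Finset.mem_univ i)
  have hg : ∀ i, 0 ≤ concSummand q (l i) := fun i => concSummand_nonneg hq.le (hl0 i) (hle i)
  obtain ⟨hx2, hxx⟩ := csWeight_sqrt_setup hl0 hl1
  have hcast : ∀ t : ℝ, d * t / d = t := fun t => by field_simp
  have hcast' : ∀ t : ℝ, ((d : ℝ) - d * t) / d = 1 - t := fun t => by field_simp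
  by_cases hlt : ∀ i, l i < 1
  swap
  · push Not at hlt
    obtain ⟨k, hk⟩ := hlt
    have hk1 : l k = 1 := le_antisymm (hle k) hk
    have hz : ∀ j, j ≠ k → l j = 0 := by
      have h1 : ∑ j ∈ Finset.univ.erase k, l j = 0 := by
        have := Finset.add_sum_erase Finset.univ l (Finset.mem_univ k)
        rw [hl1, hk1] at this; linarith
      intro j hj
      exact (Finset.sum_eq_zero_iff_of_nonneg fun i _ => hl0 i).1 h1 j
        (Finset.mem_erase.2 ⟨hj, Finset.mem_univ j⟩)
    have h2 : ∑ i, √(l i) = 1 := by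
      rw [Finset.sum_eq_single k (fun j _ hj => by rw [hz j hj, Real.sqrt_zero])
        (fun h => absurd (Finset.mem_univ k) h), hk1, Real.sqrt_one]
    rw [h2]
    simpa using Finset.sum_nonneg fun i _ => hg i
  by_cases hlarge : ∃ k, (d : ℝ) - 1 < d * l k
  · obtain ⟨k, hk⟩ := hlarge
    refine le_sum_of_csWeight hd hl0 hl1 hlt hg₀ (a := fun _ => 18 / 17) hg (fun _ => by norm_num) ?_ ?_
    · intro i
      by_cases hik : i = k
      · have h1 := hsmall (d - d * l i) (by nlinarith [hlt i]) (by rw [hik]; linarith)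
        rw [hcast', concSummand_one_sub] at h1
        refine le_trans (le_of_eq ?_) h1
        ring
      · have h1 := hsmall (d * l i) (mul_nonneg hd0.le (hl0 i)) ?_
        · rwa [hcast] at h1
        · have h2 : l i + l k ≤ 1 := by
            rw [← hl1, ← Finset.sum_pair hik]
            exact Finset.sum_le_sum_of_subset_of_nonneg (Finset.subset_univ _)
              fun j _ _ => hl0 j
          nlinarith
    · have h1 := sum_csWeight_le_of_large hd hxx (fun i => by rw [hx2]; nlinarith [hlt i])
        (k := k) (by rw [hx2]; exact hk)
      rw [← Finset.sum_mul]
      linarith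
  · push Not at hlarge
    have hmin : ∀ i, 0 ≤ min (d * l i) (d - d * l i) ∧ min (d * l i) (d - d * l i) ≤ d / 2 := by
      intro i
      refine ⟨le_min (mul_nonneg hd0.le (hl0 i)) (by nlinarith [hlt i]), ?_⟩
      rcases le_total (d * l i) (d - d * l i) with h | h
      · rw [min_eq_left h]; linarith
      · rw [min_eq_right h]; linarith
    refine le_sum_of_csWeight hd hl0 hl1 hlt hg₀
      (a := fun i => A (min (d * l i) (d - d * l i))) hg
      (fun i => hA0 _ (hmin i).1 (hmin i).2) ?_ ?_
    · intro i
      have h1 := hA _ (hmin i).1 (hmin i).2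
      rcases le_total (d * l i) (d - d * l i) with h | h
      · simp only [min_eq_left h] at h1 ⊢
        rwa [hcast] at h1
      · simp only [min_eq_right h] at h1 ⊢
        rw [hcast', concSummand_one_sub] at h1
        refine le_trans (le_of_eq ?_) h1
        ring
    · have h1 := hsum (fun i => √(d * l i)) (fun i => Real.sqrt_nonneg _) hxx
        (fun i => by rw [hx2]; exact hlarge i)
      simpa only [hx2] using h1

/-- The affine bound suits functions `λ (1 - λ) / concSummand q λ` that increase on `(0, 1 / 2]`. -/
lemma isConcurrenceBound_of_affine {d : ℕ} (hd : 3 ≤ d) {q b C : ℝ} (hq : 1 < q)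
    (hb0 : 0 ≤ b) (hb1 : b ≤ 1) (hC0 : 0 ≤ C)
    (hC : C ≤ (1 - b / 2) * (((d : ℝ) - 2) / (d - 1)) * ((1 + 1 / √(d : ℝ)) / 2))
    (hsmall : ∀ y : ℝ, 0 ≤ y → y ≤ 1 →
      y * (d - y) / ((d : ℝ) - 1) * concSummand q (1 / d) ≤ concSummand q (y / d))
    (hA : ∀ y : ℝ, 0 ≤ y → y ≤ d / 2 →
      y * (d - y) / ((d : ℝ) - 1) * concSummand q (1 / d) ≤
        (1 + b * (y - 1) + C * (√y - 1) ^ 2) * concSummand q (y / d)) :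
    IsConcurrenceBound d q (d * concSummand q (1 / d) / ((d : ℝ) - 1) ^ 2) := by
  refine isConcurrenceBound_of_ratio_bound hd hq
    (A := fun y => 1 + b * (y - 1) + C * (√y - 1) ^ 2) ?_ ?_ hA ?_
  · intro y h0 h1
    have h3 : (3 : ℝ) ≤ d := by exact_mod_cast hd
    have := concSummand_nonneg hq.le (show 0 ≤ y / d by positivity) (by
      rw [div_le_one (by linarith)]; linarith)
    linarith [hsmall y h0 h1]
  · intro y hy _
    have : 0 ≤ C * (√y - 1) ^ 2 := mul_nonneg hC0 (sq_nonneg _)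
    nlinarith
  · intro x hx0 hx hle
    exact sum_csWeight_mul_affine_le hd hx0 hx hle hb0 hb1 hC0 hC fun i => le_rfl

/-- The quadratic bound is symmetric under `y ↦ d - y` up to its last term; it is sharper than the
affine one when `concSummand q (1 / d)` is close to one. -/
lemma isConcurrenceBound_of_quadratic {d : ℕ} (hd : 5 ≤ d) {q ν C : ℝ} (hq : 1 < q)
    (hν0 : 0 ≤ ν) (hν1 : ν ≤ 1) (hC0 : 0 ≤ C)
    (hC : C * d ^ 2 ≤ ν * (((d : ℝ) - 1) * (d - 2)) + (1 - ν) * (d ^ 2 - 1 - √(d : ℝ)))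
    (hsmall : ∀ y : ℝ, 0 ≤ y → y ≤ 1 →
      y * (d - y) / ((d : ℝ) - 1) * concSummand q (1 / d) ≤ concSummand q (y / d))
    (hA : ∀ y : ℝ, 0 ≤ y → y ≤ d / 2 →
      y * (d - y) / ((d : ℝ) - 1) * concSummand q (1 / d) ≤
        (ν + (1 - ν) * (y * (d - y) / ((d : ℝ) - 1))
          + C * ((√y - 1) ^ 2 * ((d - y) / ((d : ℝ) - 1)))) * concSummand q (y / d)) :
    IsConcurrenceBound d q (d * concSummand q (1 / d) / ((d : ℝ) - 1) ^ 2) := by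
  have h5 : (5 : ℝ) ≤ d := by exact_mod_cast hd
  have hn : (0 : ℝ) < d - 1 := by linarith
  refine isConcurrenceBound_of_ratio_bound (by omega) hq
    (A := fun y => ν + (1 - ν) * (y * (d - y) / ((d : ℝ) - 1))
          + C * ((√y - 1) ^ 2 * ((d - y) / ((d : ℝ) - 1)))) ?_ ?_ hA ?_
  · intro y h0 h1
    have := concSummand_nonneg hq.le (show 0 ≤ y / d by positivity) (by
      rw [div_le_one (by linarith)]; linarith)
    linarith [hsmall y h0 h1]
  · intro y hy hy2
    have h1 : 0 ≤ (d - y) / ((d : ℝ) - 1) := div_nonneg (by linarith) hn.le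
    have h2 : 0 ≤ y * (d - y) / ((d : ℝ) - 1) :=
      div_nonneg (mul_nonneg hy (by linarith)) hn.le
    have h3 : 0 ≤ 1 - ν := by linarith
    positivity
  · intro x hx0 hx hle
    refine sum_csWeight_mul_quadratic_le hd hx0 hx (fun i => by linarith [hle i]) hν0 hν1 hC0 hC
      fun i => ?_
    rcases le_total (x i ^ 2) (d - x i ^ 2) with h | h
    · simp only [min_eq_left h, Real.sqrt_sq (hx0 i)]
      exact le_rfl
    · simp only [min_eq_right h]
      have e : (d : ℝ) - (d - x i ^ 2) = x i ^ 2 := by ring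
      rw [e, mul_comm (d - x i ^ 2) (x i ^ 2)]
      have h1 : 1 ≤ √(d - x i ^ 2) := Real.one_le_sqrt.2 (by linarith [hle i])
      have h2 : √(d - x i ^ 2) ≤ x i := (Real.sqrt_le_left (hx0 i)).2 h
      have h3 : √(d - x i ^ 2) ^ 2 = d - x i ^ 2 := Real.sq_sqrt (by linarith [hle i])
      have h4 : (√(d - x i ^ 2) - 1) ^ 2 * x i ^ 2 ≤ (x i - 1) ^ 2 * (d - x i ^ 2) := by
        generalize √(d - x i ^ 2) = z at h1 h2 h3
        rw [← h3, ← mul_pow, ← mul_pow]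
        refine pow_le_pow_left₀ (mul_nonneg (by linarith) (hx0 i)) ?_ 2
        nlinarith
      have h5 : (√(d - x i ^ 2) - 1) ^ 2 * (x i ^ 2 / ((d : ℝ) - 1)) ≤
          (x i - 1) ^ 2 * ((d - x i ^ 2) / ((d : ℝ) - 1)) := by
        rw [← mul_div_assoc, ← mul_div_assoc]
        gcongr
      have := mul_le_mul_of_nonneg_left h5 hC0
      linarith

/-! ### The geometric quotient -/

/-- The difference quotient `(1 - s ^ p) / (1 - s)`, a geometric sum for natural `p`. -/
noncomputable def geomQuot (p s : ℝ) : ℝ := (1 - s ^ p) / (1 - s)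

/-- The derivative of `geomQuot p`. -/
noncomputable def geomQuotDeriv (p s : ℝ) : ℝ := (geomQuot p s - p * s ^ (p - 1)) / (1 - s)

/-- The second derivative of `geomQuot p`. -/
noncomputable def geomQuotDeriv2 (p s : ℝ) : ℝ :=
  (2 * geomQuotDeriv p s - p * (p - 1) * s ^ (p - 2)) / (1 - s)

lemma hasDerivAt_geomQuot {p s : ℝ} (h0 : 0 < s) (h1 : s < 1) :
    HasDerivAt (geomQuot p) (geomQuotDeriv p s) s := by
  have hs : 1 - s ≠ 0 := (sub_pos.2 h1).ne'
  have a := (Real.hasDerivAt_rpow_const (p := p) (Or.inl h0.ne')).const_sub 1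
  have b := (hasDerivAt_id s).const_sub 1
  refine (a.div b hs).congr_deriv ?_
  simp only [geomQuotDeriv, geomQuot, id]
  field_simp
  ring

lemma hasDerivAt_geomQuotDeriv {p s : ℝ} (h0 : 0 < s) (h1 : s < 1) :
    HasDerivAt (geomQuotDeriv p) (geomQuotDeriv2 p s) s := by
  have hs : 1 - s ≠ 0 := (sub_pos.2 h1).ne'
  have a := (hasDerivAt_geomQuot (p := p) h0 h1).sub
    ((Real.hasDerivAt_rpow_const (p := p - 1) (Or.inl h0.ne')).const_mul p)
  have b := (hasDerivAt_id s).const_sub 1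
  refine (a.div b hs).congr_deriv ?_
  have e : p - 1 - 1 = p - 2 := by ring
  simp only [geomQuotDeriv2, geomQuotDeriv, id, e, Pi.sub_apply]
  field_simp
  ring

lemma geomQuotDeriv2_mul {p s : ℝ} (h1 : s < 1) :
    geomQuotDeriv2 p s * (1 - s) ^ 3 =
      2 * (1 - s ^ p) - 2 * p * s ^ (p - 1) * (1 - s) - p * (p - 1) * s ^ (p - 2) * (1 - s) ^ 2 := by
  have hs : 1 - s ≠ 0 := (sub_pos.2 h1).ne'
  simp only [geomQuotDeriv2, geomQuotDeriv, geomQuot]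
  field_simp

lemma hasDerivAt_geomQuotDeriv2_mul {p s : ℝ} (h0 : 0 < s) :
    HasDerivAt (fun s : ℝ => 2 * (1 - s ^ p) - 2 * p * s ^ (p - 1) * (1 - s)
      - p * (p - 1) * s ^ (p - 2) * (1 - s) ^ 2)
      (-(p * (p - 1) * (p - 2) * s ^ (p - 3) * (1 - s) ^ 2)) s := by
  have a := ((Real.hasDerivAt_rpow_const (p := p) (Or.inl h0.ne')).const_sub 1).const_mul 2
  have b := (Real.hasDerivAt_rpow_const (p := p - 1) (Or.inl h0.ne')).const_mul (2 * p)
  have c := (Real.hasDerivAt_rpow_const (p := p - 2) (Or.inl h0.ne')).const_mul (p * (p - 1))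
  have l := (hasDerivAt_id s).const_sub 1
  refine ((a.sub (b.mul l)).sub (c.mul (l.pow 2))).congr_deriv ?_
  have e : p - 1 - 1 = p - 2 := by ring
  have e' : p - 2 - 1 = p - 3 := by ring
  simp only [id, e, e', Pi.pow_apply]
  ring

/-- A function on `(0, 1]` that vanishes at `1` and has a nonpositive derivative is nonnegative. -/
lemma nonneg_of_deriv_nonpos {F F' : ℝ → ℝ} (hF : ∀ s, 0 < s → HasDerivAt F (F' s) s)
    (hF' : ∀ s, 0 < s → s < 1 → F' s ≤ 0) (h1 : F 1 = 0) {s : ℝ} (hs0 : 0 < s) (hs1 : s ≤ 1) :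
    0 ≤ F s := by
  have h : AntitoneOn F (Set.Icc s 1) := by
    refine antitoneOn_of_deriv_nonpos (convex_Icc _ _)
      (fun x hx => (hF x (hs0.trans_le hx.1)).continuousAt.continuousWithinAt)
      (fun x hx => ?_) (fun x hx => ?_)
    · rw [interior_Icc] at hx
      exact (hF x (hs0.trans hx.1)).differentiableAt.differentiableWithinAt
    · rw [interior_Icc] at hx
      rw [(hF x (hs0.trans hx.1)).deriv]
      exact hF' x (hs0.trans hx.1) hx.2
  rw [← h1]
  exact h ⟨le_rfl, hs1⟩ ⟨hs1, le_rfl⟩ hs1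

lemma geomQuotDeriv2_nonneg {p s : ℝ} (hp : 2 ≤ p) (h0 : 0 < s) (h1 : s < 1) :
    0 ≤ geomQuotDeriv2 p s := by
  have h := nonneg_of_deriv_nonpos (fun s hs => hasDerivAt_geomQuotDeriv2_mul (p := p) hs)
    (fun s hs _ => by
      have h1 : 0 ≤ p * (p - 1) * (p - 2) :=
        mul_nonneg (mul_nonneg (by linarith) (by linarith)) (by linarith)
      have := Real.rpow_nonneg hs.le (p - 3)
      rw [neg_nonpos]; positivity) (by simp) h0 h1.le
  simp only [← geomQuotDeriv2_mul h1] at h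
  exact nonneg_of_mul_nonneg_left h (pow_pos (sub_pos.2 h1) 3)

lemma geomQuotDeriv_mono {p s t : ℝ} (hp : 2 ≤ p) (h0 : 0 < s) (hst : s ≤ t) (h1 : t < 1) :
    geomQuotDeriv p s ≤ geomQuotDeriv p t := by
  have h : MonotoneOn (geomQuotDeriv p) (Set.Icc s t) := by
    refine monotoneOn_of_deriv_nonneg (convex_Icc _ _)
      (fun x hx => (hasDerivAt_geomQuotDeriv (h0.trans_le hx.1)
        (hx.2.trans_lt h1)).continuousAt.continuousWithinAt)
      (fun x hx => ?_) (fun x hx => ?_)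
    · rw [interior_Icc] at hx
      exact (hasDerivAt_geomQuotDeriv (h0.trans hx.1)
        (hx.2.trans h1)).differentiableAt.differentiableWithinAt
    · rw [interior_Icc] at hx
      rw [(hasDerivAt_geomQuotDeriv (h0.trans hx.1) (hx.2.trans h1)).deriv]
      exact geomQuotDeriv2_nonneg hp (h0.trans hx.1) (hx.2.trans h1)
  exact h ⟨le_rfl, hst⟩ ⟨hst, le_rfl⟩ hst

lemma one_add_le_geomQuot {p s : ℝ} (hp : 2 ≤ p) (h0 : 0 < s) (h1 : s < 1) :
    1 + s ≤ geomQuot p s := by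
  rw [geomQuot, le_div_iff₀ (sub_pos.2 h1)]
  have : s ^ p ≤ s ^ (2 : ℝ) := Real.rpow_le_rpow_of_exponent_ge h0 h1.le hp
  rw [Real.rpow_two] at this
  nlinarith

/-- The derivative is increasing, and equal to `1` at the origin. -/
lemma one_le_geomQuotDeriv {p s : ℝ} (hp : 2 ≤ p) (h0 : 0 < s) (h1 : s < 1) :
    1 ≤ geomQuotDeriv p s := by
  have key : ∀ t ∈ Set.Ioo 0 s, 1 + s - 1 / (1 - t) ≤ geomQuotDeriv p s * (s - t) := by
    intro t ht
    have hder : ∀ x, t ≤ x → x ≤ s → HasDerivAt (geomQuot p) (geomQuotDeriv p x) x :=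
      fun x hx hx' => hasDerivAt_geomQuot (ht.1.trans_le hx) (hx'.trans_lt h1)
    obtain ⟨c, hc, hc'⟩ := exists_hasDerivAt_eq_slope (geomQuot p) (geomQuotDeriv p) ht.2
      (fun x hx => (hder x hx.1 hx.2).continuousAt.continuousWithinAt)
      (fun x hx => hder x hx.1.le hx.2.le)
    have h2 : geomQuot p s - geomQuot p t ≤ geomQuotDeriv p s * (s - t) := by
      rw [eq_div_iff (sub_pos.2 ht.2).ne'] at hc'
      rw [← hc']
      exact mul_le_mul_of_nonneg_right (geomQuotDeriv_mono hp (ht.1.trans hc.1) hc.2.le h1)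
        (sub_pos.2 ht.2).le
    have h3 : geomQuot p t ≤ 1 / (1 - t) :=
      div_le_div_of_nonneg_right (by linarith [Real.rpow_nonneg ht.1.le p])
        (by linarith [ht.2])
    linarith [one_add_le_geomQuot hp h0 h1]
  have hl : Filter.Tendsto (fun t : ℝ => 1 + s - 1 / (1 - t)) (nhdsWithin 0 (Set.Ioi 0))
      (nhds (1 + s - 1 / (1 - 0))) := by
    refine ((ContinuousAt.sub continuousAt_const (ContinuousAt.div continuousAt_const
      (continuousAt_const.sub continuousAt_id) (by simp))).tendsto).mono_left nhdsWithin_le_nhds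
  have hr : Filter.Tendsto (fun t : ℝ => geomQuotDeriv p s * (s - t))
      (nhdsWithin 0 (Set.Ioi 0)) (nhds (geomQuotDeriv p s * (s - 0))) := by
    refine Filter.Tendsto.mono_left ?_ nhdsWithin_le_nhds
    exact (Continuous.tendsto (by fun_prop) 0)
  have h := le_of_tendsto_of_tendsto hl hr
    (Filter.eventually_of_mem (Ioo_mem_nhdsGT h0) key)
  simp only [sub_zero, div_one, add_sub_cancel_left] at h
  exact (le_mul_iff_one_le_left h0).1 h

/-! ### Comparison with a tangent line -/

/-- A bound `F'' ≤ c √a / (2 x √x)` on the second derivative is the bound by the second derivative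
of `c (√x - √a) ^ 2`, hence `F` stays below its tangent at `a` plus this function. -/
lemma le_tangent_add_sq_sqrt_sub {F F' F'' : ℝ → ℝ} {a c B : ℝ} (ha0 : 0 < a) (haB : a ≤ B)
    (hF : ∀ x, 0 < x → x ≤ B → HasDerivAt F (F' x) x)
    (hF' : ∀ x, 0 < x → x ≤ B → HasDerivAt F' (F'' x) x)
    (hF'' : ∀ x, 0 < x → x < B → 2 * x * √x * F'' x ≤ c * √a)
    {x : ℝ} (hx0 : 0 < x) (hxB : x ≤ B) :
    F x ≤ F a + F' a * (x - a) + c * (√x - √a) ^ 2 := by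
  set D : ℝ → ℝ := fun x => F' a + c * (1 - √a / √x) - F' x with hD
  have hDd : ∀ x, 0 < x → x ≤ B →
      HasDerivAt D (c * (√a * (1 / (2 * √x)) / √x ^ 2) - F'' x) x := by
    intro x h0 hB
    have hs := Real.sqrt_pos.2 h0
    have h1 := ((((Real.hasDerivAt_sqrt h0.ne').inv hs.ne').const_mul √a).const_sub 1).const_mul c
    refine ((h1.const_add (F' a)).sub (hF' x h0 hB)).congr_deriv ?_
    field_simp
  have hmono : ∀ x y, 0 < x → x ≤ y → y ≤ B → D x ≤ D y := by
    intro x y hx hxy hy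
    have h : MonotoneOn D (Set.Icc x y) := by
      refine monotoneOn_of_deriv_nonneg (convex_Icc _ _)
        (fun z hz => (hDd z (hx.trans_le hz.1)
          (hz.2.trans hy)).continuousAt.continuousWithinAt)
        (fun z hz => ?_) (fun z hz => ?_)
      · rw [interior_Icc] at hz
        exact (hDd z (hx.trans hz.1) (hz.2.le.trans hy)).differentiableAt.differentiableWithinAt
      · rw [interior_Icc] at hz
        have hz0 := hx.trans hz.1
        rw [(hDd z hz0 (hz.2.le.trans hy)).deriv, sub_nonneg]
        have h1 := hF'' z hz0 (hz.2.trans_le hy)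
        have hs := Real.sqrt_pos.2 hz0
        have e : c * (√a * (1 / (2 * √z)) / √z ^ 2) = c * √a / (2 * z * √z) := by
          rw [Real.sq_sqrt hz0.le]; field_simp
        rw [e, le_div_iff₀ (by positivity)]
        linarith
    exact h ⟨le_rfl, hxy⟩ ⟨hxy, le_rfl⟩ hxy
  have hDa : D a = 0 := by
    have hs := Real.sqrt_pos.2 ha0
    simp [hD, hs.ne']
  set E : ℝ → ℝ := fun x => F a + F' a * (x - a) + c * (√x - √a) ^ 2 - F x with hE
  have hEd : ∀ x, 0 < x → x ≤ B → HasDerivAt E (D x) x := by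
    intro x h0 hB
    have hs := Real.sqrt_pos.2 h0
    have h1 := ((((hasDerivAt_id x).sub_const a).const_mul (F' a)).const_add (F a)).add
      ((((Real.hasDerivAt_sqrt h0.ne').sub_const √a).pow 2).const_mul c)
    refine (h1.sub (hF x h0 hB)).congr_deriv ?_
    simp only [hD]
    field_simp
    ring
  have hEa : E a = 0 := by simp [hE]
  have hEx : 0 ≤ E x := by
    rcases le_total x a with h | h
    · have h1 : AntitoneOn E (Set.Icc x a) := by
        refine antitoneOn_of_deriv_nonpos (convex_Icc _ _)
          (fun z hz => (hEd z (hx0.trans_le hz.1)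
            (hz.2.trans haB)).continuousAt.continuousWithinAt)
          (fun z hz => ?_) (fun z hz => ?_)
        · rw [interior_Icc] at hz
          exact (hEd z (hx0.trans hz.1) (hz.2.le.trans haB)).differentiableAt.differentiableWithinAt
        · rw [interior_Icc] at hz
          rw [(hEd z (hx0.trans hz.1) (hz.2.le.trans haB)).deriv, ← hDa]
          exact hmono z a (hx0.trans hz.1) hz.2.le haB
      rw [← hEa]
      exact h1 ⟨le_rfl, h⟩ ⟨h, le_rfl⟩ h
    · have h1 : MonotoneOn E (Set.Icc a x) := by
        refine monotoneOn_of_deriv_nonneg (convex_Icc _ _)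
          (fun z hz => (hEd z (ha0.trans_le hz.1)
            (hz.2.trans hxB)).continuousAt.continuousWithinAt)
          (fun z hz => ?_) (fun z hz => ?_)
        · rw [interior_Icc] at hz
          exact (hEd z (ha0.trans hz.1) (hz.2.le.trans hxB)).differentiableAt.differentiableWithinAt
        · rw [interior_Icc] at hz
          rw [(hEd z (ha0.trans hz.1) (hz.2.le.trans hxB)).deriv, ← hDa]
          exact hmono a z ha0 hz.1.le (hz.2.le.trans hxB)
      rw [← hEa]
      exact h1 ⟨le_rfl, h⟩ ⟨h, le_rfl⟩ h
  simp only [hE, sub_nonneg] at hEx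
  exact hEx

/-! ### The inverse of the summand -/

/-- `λ (1 - λ) / concSummand q λ`, through the quotients `geomQuot`, with `p = q - 1`. -/
noncomputable def invSummand (p l : ℝ) : ℝ := 1 / (geomQuot p l + geomQuot p (1 - l))

lemma concSummand_eq {p l : ℝ} (h0 : 0 < l) (h1 : l < 1) :
    concSummand (p + 1) l = l * (1 - l) * (geomQuot p l + geomQuot p (1 - l)) := by
  have hm := sub_pos.2 h1
  have e1 : l ^ (p + 1) = l ^ p * l := Real.rpow_add_one h0.ne' p
  have e2 : (1 - l) ^ (p + 1) = (1 - l) ^ p * (1 - l) := Real.rpow_add_one hm.ne' p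
  simp only [concSummand, geomQuot, e1, e2, sub_sub_cancel]
  field_simp
  ring

/-- The first derivative of `invSummand p`. -/
noncomputable def invSummandDeriv (p l : ℝ) : ℝ :=
  -(geomQuotDeriv p l - geomQuotDeriv p (1 - l)) / (geomQuot p l + geomQuot p (1 - l)) ^ 2

/-- The second derivative of `invSummand p`. -/
noncomputable def invSummandDeriv2 (p l : ℝ) : ℝ :=
  (2 * (geomQuotDeriv p l - geomQuotDeriv p (1 - l)) ^ 2
    - (geomQuot p l + geomQuot p (1 - l)) * (geomQuotDeriv2 p l + geomQuotDeriv2 p (1 - l)))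
    / (geomQuot p l + geomQuot p (1 - l)) ^ 3

lemma hasDerivAt_geomQuot_add {p l : ℝ} (h0 : 0 < l) (h1 : l < 1) :
    HasDerivAt (fun l => geomQuot p l + geomQuot p (1 - l))
      (geomQuotDeriv p l - geomQuotDeriv p (1 - l)) l := by
  have a := (hasDerivAt_geomQuot (p := p) (s := 1 - l) (by linarith) (by linarith)).comp l
    ((hasDerivAt_id l).const_sub 1)
  refine ((hasDerivAt_geomQuot h0 h1).add a).congr_deriv ?_
  ring

lemma hasDerivAt_geomQuotDeriv_sub {p l : ℝ} (h0 : 0 < l) (h1 : l < 1) :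
    HasDerivAt (fun l => geomQuotDeriv p l - geomQuotDeriv p (1 - l))
      (geomQuotDeriv2 p l + geomQuotDeriv2 p (1 - l)) l := by
  have a := (hasDerivAt_geomQuotDeriv (p := p) (s := 1 - l) (by linarith) (by linarith)).comp l
    ((hasDerivAt_id l).const_sub 1)
  refine ((hasDerivAt_geomQuotDeriv h0 h1).sub a).congr_deriv ?_
  ring

lemma geomQuot_pos {p s : ℝ} (hp : 0 < p) (h0 : 0 < s) (h1 : s < 1) : 0 < geomQuot p s :=
  div_pos (sub_pos.2 (Real.rpow_lt_one h0.le h1 hp)) (sub_pos.2 h1)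

lemma hasDerivAt_invSummand {p l : ℝ} (hp : 0 < p) (h0 : 0 < l) (h1 : l < 1) :
    HasDerivAt (invSummand p) (invSummandDeriv p l) l := by
  have hpos : 0 < geomQuot p l + geomQuot p (1 - l) :=
    add_pos (geomQuot_pos hp h0 h1) (geomQuot_pos hp (by linarith) (by linarith))
  have h := (hasDerivAt_geomQuot_add (p := p) h0 h1).inv hpos.ne'
  have e : invSummand p = fun l => (geomQuot p l + geomQuot p (1 - l))⁻¹ := by
    funext l; simp [invSummand]
  rw [e]
  exact h

lemma hasDerivAt_invSummandDeriv {p l : ℝ} (hp : 0 < p) (h0 : 0 < l) (h1 : l < 1) :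
    HasDerivAt (invSummandDeriv p) (invSummandDeriv2 p l) l := by
  have hpos : 0 < geomQuot p l + geomQuot p (1 - l) :=
    add_pos (geomQuot_pos hp h0 h1) (geomQuot_pos hp (by linarith) (by linarith))
  have h := (hasDerivAt_geomQuotDeriv_sub (p := p) h0 h1).neg.div
    ((hasDerivAt_geomQuot_add (p := p) h0 h1).pow 2) (pow_pos hpos 2).ne'
  refine h.congr_deriv ?_
  simp only [invSummandDeriv2, Pi.pow_apply, Pi.neg_apply]
  field_simp
  ring

/-! ### Truncated binomial series -/

/-- The binomial series of `(1 - l) ^ (-p)`, truncated after the sixth power. -/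
noncomputable def binomTrunc (p l : ℝ) : ℝ :=
  1 + p * l + p * (p + 1) / 2 * l ^ 2 + p * (p + 1) * (p + 2) / 6 * l ^ 3
    + p * (p + 1) * (p + 2) * (p + 3) / 24 * l ^ 4
    + p * (p + 1) * (p + 2) * (p + 3) * (p + 4) / 120 * l ^ 5
    + p * (p + 1) * (p + 2) * (p + 3) * (p + 4) * (p + 5) / 720 * l ^ 6

lemma one_le_binomTrunc {p l : ℝ} (hp : 0 ≤ p) (h0 : 0 ≤ l) : 1 + p * l ≤ binomTrunc p l := by
  have : 0 ≤ binomTrunc p l - (1 + p * l) := by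
    rw [binomTrunc]; ring_nf; positivity
  linarith

lemma rpow_mul_binomTrunc_le {p l : ℝ} (hp : 0 ≤ p) (h0 : 0 ≤ l) (h1 : l < 1) :
    (1 - l) ^ p * binomTrunc p l ≤ 1 := by
  have hd : ∀ x : ℝ, 0 ≤ x → x < 1 → HasDerivAt (fun l => (1 - l) ^ p * binomTrunc p l)
      (-((1 - x) ^ (p - 1) * (p * (p + 1) * (p + 2) * (p + 3) * (p + 4) * (p + 5) * (p + 6) / 720
        * x ^ 6))) x := by
    intro x hx0 hx1
    have hx : 0 < 1 - x := sub_pos.2 hx1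
    have a := (Real.hasDerivAt_rpow_const (p := p) (Or.inl hx.ne')).comp x
      ((hasDerivAt_id x).const_sub 1)
    have m : ∀ (c : ℝ) (n : ℕ), HasDerivAt (fun l : ℝ => c * l ^ n) (c * (n * x ^ (n - 1))) x :=
      fun c n => (hasDerivAt_pow n x).const_mul c
    have b := (((((((hasDerivAt_id x).const_mul p).const_add 1).add (m (p * (p + 1) / 2) 2)).add
      (m (p * (p + 1) * (p + 2) / 6) 3)).add (m (p * (p + 1) * (p + 2) * (p + 3) / 24) 4)).add
      (m (p * (p + 1) * (p + 2) * (p + 3) * (p + 4) / 120) 5)).add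
      (m (p * (p + 1) * (p + 2) * (p + 3) * (p + 4) * (p + 5) / 720) 6)
    refine (a.mul b).congr_deriv ?_
    have e : (1 - x) ^ p = (1 - x) ^ (p - 1) * (1 - x) := by
      rw [← Real.rpow_add_one hx.ne']; congr 1; ring
    simp only [Function.comp_apply, id, Pi.add_apply, e]
    push_cast
    ring
  have h : AntitoneOn (fun l => (1 - l) ^ p * binomTrunc p l) (Set.Icc 0 l) := by
    refine antitoneOn_of_deriv_nonpos (convex_Icc _ _)
      (fun x hx => (hd x hx.1 (hx.2.trans_lt h1)).continuousAt.continuousWithinAt)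
      (fun x hx => ?_) (fun x hx => ?_)
    · rw [interior_Icc] at hx
      exact (hd x hx.1.le (hx.2.trans h1)).differentiableAt.differentiableWithinAt
    · rw [interior_Icc] at hx
      rw [(hd x hx.1.le (hx.2.trans h1)).deriv, neg_nonpos]
      have := hx.1
      have := Real.rpow_nonneg (sub_pos.2 (hx.2.trans h1)).le (p - 1)
      positivity
  have := h ⟨le_rfl, h0⟩ ⟨h0, le_rfl⟩ h0
  simpa [binomTrunc] using this

set_option maxRecDepth 100000 in
/-- In the coordinates `s - 2` and `p - 2` all coefficients of the difference of the two sides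
are nonnegative. -/
lemma invSummand_polynomial_le {p s M D R : ℝ} (hp : 2 ≤ p) (hs : 2 ≤ s)
    (hM : M = s ^ 6 + p * s ^ 5 + p * (p + 1) / 2 * s ^ 4 + p * (p + 1) * (p + 2) / 6 * s ^ 3
      + p * (p + 1) * (p + 2) * (p + 3) / 24 * s ^ 2
      + p * (p + 1) * (p + 2) * (p + 3) * (p + 4) / 120 * s
      + p * (p + 1) * (p + 2) * (p + 3) * (p + 4) * (p + 5) / 720)
    (hD : D = (s ^ 2 + s + 1) * M - s ^ 8)
    (hR : R = (s ^ 2 - 1) * M * (s - 1) - s ^ 8 * (s - 1) - s ^ 8 * p) :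
    5 * (s + 16) * s * M * (2 * R ^ 2
      - D * (2 * R * (s - 1) + 2 * M * (s - 1) ^ 2 - s ^ 8 * (p * (p - 1))))
      ≤ 2 * D ^ 3 * (s - 1) ^ 2 := by
  obtain ⟨x, rfl⟩ : ∃ x, p = 2 + x := ⟨p - 2, by ring⟩
  obtain ⟨v, rfl⟩ : ∃ v, s = 2 + v := ⟨s - 2, by ring⟩
  have hx : 0 ≤ x := by linarith
  have hv : 0 ≤ v := by linarith
  rw [← sub_nonneg]
  subst hD hR hM
  ring_nf
  positivity

/-! ### Second derivative of the inverse summand, for exponents at least three -/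

lemma sqrt_le_two_mul_add {l : ℝ} (h : 0 ≤ l) : √l ≤ 2 * l + 1 / 8 := by
  have := Real.sq_sqrt h
  nlinarith [sq_nonneg (√l - 1 / 4)]

/-- A convex quadratic that is nonpositive at the origin increases wherever it is positive. -/
lemma quadratic_le_of_le {a b c x y : ℝ} (ha : 0 ≤ a) (hc : c ≤ 0) (hx : 0 < x) (hxy : x ≤ y)
    (h : 0 ≤ a * x ^ 2 + b * x + c) : a * x ^ 2 + b * x + c ≤ a * y ^ 2 + b * y + c := by
  have h1 : 0 ≤ a * x + b := by nlinarith
  nlinarith [mul_nonneg ha (sub_nonneg.2 hxy), mul_nonneg (sub_nonneg.2 hxy) h1,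
    mul_nonneg (mul_nonneg ha (hx.le.trans hxy)) (sub_nonneg.2 hxy)]

/-- The inequality of `invSummand_polynomial_le`, in terms of `X = (1 - l) ^ p`. -/
lemma sqrt_mul_quadratic_le {p l X : ℝ} (hp : 2 ≤ p) (h0 : 0 < l) (h1 : l ≤ 1 / 2) (hX0 : 0 < X)
    (hX : X * binomTrunc p l ≤ 1) :
    20 * √l * (2 * (1 - l ^ 2 - (1 + p * l / (1 - l)) * X) ^ 2
      - (1 + l + l ^ 2 - X) * (2 * (1 - (1 + p * l / (1 - l)) * X)
        - l ^ 2 * (p * (p - 1) / (1 - l) ^ 2) * X)) ≤ (1 + l + l ^ 2 - X) ^ 3 := by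
  have hμ : 0 < 1 - l := by linarith
  have hMl := one_le_binomTrunc (show 0 ≤ p by linarith) h0.le
  set M := binomTrunc p l with hM
  have hM0 : 0 < M := by nlinarith
  have hM1 : 1 ≤ M := by nlinarith
  set Q := 1 + p * l / (1 - l) with hQ
  set K := l ^ 2 * (p * (p - 1) / (1 - l) ^ 2) with hK
  have hXM : X ≤ 1 / M := by rw [le_div_iff₀ hM0]; exact hX
  have hM1' : 1 / M ≤ 1 := by rw [div_le_one hM0]; exact hM1
  set N : ℝ → ℝ := fun X => 2 * (1 - l ^ 2 - Q * X) ^ 2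
    - (1 + l + l ^ 2 - X) * (2 * (1 - Q * X) - K * X) with hN
  change 20 * √l * N X ≤ _
  have hNq : ∀ X, N X = (2 * Q ^ 2 - 2 * Q - K) * X ^ 2
      + (-4 * (1 - l ^ 2) * Q + (1 + l + l ^ 2) * (2 * Q + K) + 2) * X
      + (2 * (1 - l ^ 2) ^ 2 - 2 * (1 + l + l ^ 2)) := by
    intro X; simp only [hN]; ring
  have hDpos : 0 < 1 + l + l ^ 2 - 1 / M := by nlinarith [sq_nonneg l]
  have hD : (1 + l + l ^ 2 - 1 / M) ^ 3 ≤ (1 + l + l ^ 2 - X) ^ 3 :=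
    pow_le_pow_left₀ hDpos.le (by linarith) 3
  by_cases hneg : N X ≤ 0
  · have : 20 * √l * N X ≤ 0 := mul_nonpos_of_nonneg_of_nonpos (by positivity) hneg
    linarith [pow_pos hDpos 3]
  push Not at hneg
  have hmono : N X ≤ N (1 / M) := by
    rw [hNq] at hneg ⊢
    rw [hNq]
    refine quadratic_le_of_le ?_ ?_ hX0 hXM hneg.le
    · have : 2 * Q ^ 2 - 2 * Q - K =
          2 * (p * l / (1 - l)) + (p * l / (1 - l)) ^ 2 + p * l ^ 2 / (1 - l) ^ 2 := by
        simp only [hQ, hK]; field_simp; ring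
      rw [this]; positivity
    · have hl2 : l ^ 2 ≤ 1 := pow_le_one₀ h0.le (by linarith)
      have : (1 - l ^ 2) ^ 2 ≤ 1 := pow_le_one₀ (by linarith) (by linarith [sq_nonneg l])
      linarith [sq_nonneg l]
  have hpoly : 5 * (1 + 16 * l) * N (1 / M) ≤ 2 * (1 + l + l ^ 2 - 1 / M) ^ 3 := by
    have hs : 2 ≤ 1 / l := by rw [le_div_iff₀ h0]; linarith
    have hm : 0 < 1 / l - 1 := by linarith
    have h := invSummand_polynomial_le (s := 1 / l) (M := (1 / l) ^ 6 * M)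
      (D := (1 / l) ^ 8 * M * (1 + l + l ^ 2 - 1 / M))
      (R := (1 / l) ^ 8 * (1 / l - 1) * M * (1 - l ^ 2 - Q * (1 / M))) hp hs
      (by rw [hM, binomTrunc]; field_simp)
      (by field_simp)
      (by
        rw [hQ]
        have : 1 - l ≠ 0 := hμ.ne'
        field_simp
        ring)
    have hpos : 0 < (1 / l) ^ 24 * M ^ 3 * (1 / l - 1) ^ 2 := by positivity
    refine le_of_mul_le_mul_left ?_ hpos
    refine le_trans (le_of_eq ?_) (h.trans (le_of_eq ?_))
    · simp only [hN, hQ, hK]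
      have : 1 - l ≠ 0 := hμ.ne'
      field_simp
      ring
    · ring
  have hsq := sqrt_le_two_mul_add h0.le
  calc 20 * √l * N X ≤ 20 * (2 * l + 1 / 8) * N (1 / M) := by
        have h2 : 20 * √l ≤ 20 * (2 * l + 1 / 8) := by linarith
        exact mul_le_mul h2 hmono hneg.le (by linarith)
    _ ≤ _ := by linarith

/-- In the comparison the quotient at `l` may be replaced by `1 + l`, and its
derivatives by `1` and `0`. -/
lemma mul_sqrt_mul_invSummandDeriv2_le {p l : ℝ} (hp : 2 ≤ p) (h0 : 0 < l) (h1 : l ≤ 1 / 2) :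
    2 * l * √l * invSummandDeriv2 p l ≤ 1 / 10 := by
  have hμ0 : 0 < 1 - l := by linarith
  have hμ1 : 1 - l < 1 := by linarith
  have hl1 : l < 1 := by linarith
  have hs : 0 ≤ √l := Real.sqrt_nonneg _
  set X := (1 - l) ^ p with hX
  have hX0 : 0 < X := Real.rpow_pos_of_pos hμ0 p
  have hXq := sqrt_mul_quadratic_le hp h0 h1 hX0 (rpow_mul_binomTrunc_le (by linarith) h0.le hl1)
  have eX1 : (1 - l) ^ (p - 1) = X / (1 - l) := Real.rpow_sub_one hμ0.ne' p
  have eX2 : (1 - l) ^ (p - 2) = X / (1 - l) ^ 2 := by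
    rw [Real.rpow_sub hμ0, Real.rpow_two]
  set e := geomQuot p (1 - l) + 1 + l with he
  set e1 := geomQuotDeriv p (1 - l) - 1 with he1
  set e2 := geomQuotDeriv2 p (1 - l) with he2
  have hel : e = (1 + l + l ^ 2 - X) / l := by
    rw [he, geomQuot, sub_sub_cancel, ← hX]; field_simp; ring
  have he1l : e1 = (1 - l ^ 2 - (1 + p * l / (1 - l)) * X) / l ^ 2 := by
    rw [he1, geomQuotDeriv, geomQuot, sub_sub_cancel, eX1, ← hX]; field_simp; ring
  have he2l : e2 = (2 * (1 - (1 + p * l / (1 - l)) * X)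
        - l ^ 2 * (p * (p - 1) / (1 - l) ^ 2) * X) / l ^ 3 := by
    rw [he2, geomQuotDeriv2, geomQuotDeriv, geomQuot, sub_sub_cancel, eX1, eX2, ← hX]
    field_simp; ring
  have hmain : 20 * l * √l * (2 * e1 ^ 2 - e * e2) ≤ e ^ 3 := by
    have h2 := mul_le_mul_of_nonneg_right hXq (show 0 ≤ 1 / l ^ 3 by positivity)
    refine le_trans (le_of_eq ?_) (h2.trans (le_of_eq ?_))
    · rw [hel, he1l, he2l]; field_simp
    · rw [hel]; field_simp
  have hepos : 0 < e := by
    have := geomQuot_pos (show 0 < p by linarith) hμ0 hμ1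
    linarith
  have hh : e ≤ geomQuot p l + geomQuot p (1 - l) := by
    linarith [one_add_le_geomQuot hp h0 hl1]
  have hr : (geomQuotDeriv p l - geomQuotDeriv p (1 - l)) ^ 2 ≤ e1 ^ 2 := by
    have a := geomQuotDeriv_mono hp h0 (show l ≤ 1 - l by linarith) hμ1
    have b := one_le_geomQuotDeriv hp h0 hl1
    refine sq_le_sq' ?_ ?_ <;> linarith
  have h2l := geomQuotDeriv2_nonneg hp h0 hl1
  have h2m := geomQuotDeriv2_nonneg hp hμ0 hμ1
  have hnum : 2 * (geomQuotDeriv p l - geomQuotDeriv p (1 - l)) ^ 2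
      - (geomQuot p l + geomQuot p (1 - l)) * (geomQuotDeriv2 p l + geomQuotDeriv2 p (1 - l))
      ≤ 2 * e1 ^ 2 - e * e2 := by
    have : e * e2 ≤ (geomQuot p l + geomQuot p (1 - l)) *
        (geomQuotDeriv2 p l + geomQuotDeriv2 p (1 - l)) :=
      mul_le_mul hh (by linarith) h2m (by linarith)
    linarith
  have hh0 : 0 < geomQuot p l + geomQuot p (1 - l) := by linarith
  rw [invSummandDeriv2, mul_div_assoc', div_le_iff₀ (pow_pos hh0 3)]
  have h3 : e ^ 3 ≤ (geomQuot p l + geomQuot p (1 - l)) ^ 3 := pow_le_pow_left₀ hepos.le hh 3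
  have h4 := mul_le_mul_of_nonneg_left hnum (show 0 ≤ 20 * l * √l by positivity)
  linarith

/-! ### The inverse summand is increasing -/

lemma invSummandDeriv_nonneg {p l : ℝ} (hp : 2 ≤ p) (h0 : 0 < l) (h1 : l ≤ 1 / 2) :
    0 ≤ invSummandDeriv p l := by
  have a := geomQuotDeriv_mono hp h0 (show l ≤ 1 - l by linarith) (by linarith)
  exact div_nonneg (by linarith) (sq_nonneg _)

lemma invSummand_mono {p l m : ℝ} (hp : 2 ≤ p) (h0 : 0 < l) (hlm : l ≤ m) (h1 : m ≤ 1 / 2) :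
    invSummand p l ≤ invSummand p m := by
  have hd : ∀ x, l ≤ x → x ≤ m → HasDerivAt (invSummand p) (invSummandDeriv p x) x :=
    fun x hx hx' => hasDerivAt_invSummand (by linarith) (by linarith) (by linarith)
  have h : MonotoneOn (invSummand p) (Set.Icc l m) := by
    refine monotoneOn_of_deriv_nonneg (convex_Icc _ _)
      (fun x hx => (hd x hx.1 hx.2).continuousAt.continuousWithinAt)
      (fun x hx => ?_) (fun x hx => ?_)
    · rw [interior_Icc] at hx
      exact (hd x hx.1.le hx.2.le).differentiableAt.differentiableWithinAt
    · rw [interior_Icc] at hx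
      rw [(hd x hx.1.le hx.2.le).deriv]
      exact invSummandDeriv_nonneg hp (by linarith [hx.1]) (by linarith [hx.2])
  exact h ⟨le_rfl, hlm⟩ ⟨hlm, le_rfl⟩ hlm

/-! ### Exponents at least three: affine bounds of the ratio -/

lemma invSummand_pos {p l : ℝ} (hp : 0 < p) (h0 : 0 < l) (h1 : l < 1) : 0 < invSummand p l :=
  one_div_pos.2 (add_pos (geomQuot_pos hp h0 h1) (geomQuot_pos hp (by linarith) (by linarith)))

lemma concSummand_mul_invSummand {p l : ℝ} (hp : 0 < p) (h0 : 0 < l) (h1 : l < 1) :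
    concSummand (p + 1) l * invSummand p l = l * (1 - l) := by
  have := add_pos (geomQuot_pos hp h0 h1) (geomQuot_pos (s := 1 - l) hp (by linarith) (by linarith))
  rw [concSummand_eq h0 h1, invSummand]
  field_simp

/-- Bounds of `invSummand`, relative to its value at `1 / d`, are bounds of the ratio that enters
the averages. -/
lemma ratio_mul_le_of_invSummand_le {d p y A : ℝ} (hd : 1 < d) (hp : 0 < p) (h0 : 0 < y)
    (h1 : y < d) (hA : invSummand p (y / d) ≤ invSummand p (1 / d) * A) :
    y * (d - y) / (d - 1) * concSummand (p + 1) (1 / d) ≤ A * concSummand (p + 1) (y / d) := by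
  have hd0 : 0 < d := by linarith
  have hl0 : 0 < y / d := by positivity
  have hl1 : y / d < 1 := (div_lt_one hd0).2 h1
  have ha0 : 0 < 1 / d := by positivity
  have ha1 : 1 / d < 1 := (div_lt_one hd0).2 hd
  have e1 := concSummand_mul_invSummand hp hl0 hl1
  have e2 := concSummand_mul_invSummand hp ha0 ha1
  have hκ := invSummand_pos hp ha0 ha1
  have hf := concSummand_pos (show 1 < p + 1 by linarith) hl0 hl1
  have hn : 0 < d - 1 := by linarith
  have e3 : concSummand (p + 1) (1 / d) = (d - 1) / d ^ 2 / invSummand p (1 / d) := by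
    rw [eq_div_iff hκ.ne', e2]; field_simp
  have e4 : y * (d - y) / (d - 1) * concSummand (p + 1) (1 / d) =
      concSummand (p + 1) (y / d) * invSummand p (y / d) / invSummand p (1 / d) := by
    rw [e1, e3]; field_simp
  rw [e4, div_le_iff₀ hκ]
  nlinarith

lemma ratio_le_one {d p : ℝ} (hd : 2 ≤ d) (hp : 2 ≤ p) {y : ℝ} (h0 : 0 ≤ y) (h1 : y ≤ 1) :
    y * (d - y) / (d - 1) * concSummand (p + 1) (1 / d) ≤ concSummand (p + 1) (y / d) := by
  rcases h0.eq_or_lt with rfl | h0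
  · simpa using concSummand_nonneg (show 1 ≤ p + 1 by linarith) (le_refl 0) zero_le_one
  have h := ratio_mul_le_of_invSummand_le (A := 1) (show 1 < d by linarith)
    (show 0 < p by linarith) h0 (by linarith) (by
      rw [mul_one]
      exact invSummand_mono hp (by positivity) (by gcongr) (by
        rw [div_le_div_iff₀] <;> linarith))
  rwa [one_mul] at h

/-- Equivalently, the derivative of `concSummand (p + 1)` is nonnegative on `(0, 1 / 2]`. -/
lemma mul_invSummandDeriv_le {p l : ℝ} (hp : 0 < p) (h0 : 0 < l) (h1 : l ≤ 1 / 2) :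
    l * (1 - l) * invSummandDeriv p l ≤ (1 - 2 * l) * invSummand p l := by
  have hm : 0 < 1 - l := by linarith
  set h := geomQuot p l + geomQuot p (1 - l) with hh
  have hpos : 0 < h := add_pos (geomQuot_pos hp h0 (by linarith)) (geomQuot_pos hp hm (by linarith))
  have key : 0 ≤ (1 - 2 * l) * h + l * (1 - l) * (geomQuotDeriv p l - geomQuotDeriv p (1 - l)) := by
    have e1 : l ^ (p - 1) = l ^ p / l := Real.rpow_sub_one h0.ne' p
    have e2 : (1 - l) ^ (p - 1) = (1 - l) ^ p / (1 - l) := Real.rpow_sub_one hm.ne' p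
    have e : (1 - 2 * l) * h + l * (1 - l) * (geomQuotDeriv p l - geomQuotDeriv p (1 - l)) =
        (p + 1) * ((1 - l) ^ p - l ^ p) := by
      simp only [hh, geomQuotDeriv, geomQuot, e1, e2, sub_sub_cancel]
      field_simp
      ring
    rw [e]
    have := Real.rpow_le_rpow h0.le (show l ≤ 1 - l by linarith) hp.le
    exact mul_nonneg (by linarith) (by linarith)
  rw [invSummandDeriv, invSummand, ← hh, mul_div_assoc', mul_div_assoc', mul_one,
    div_le_div_iff₀ (pow_pos hpos 2) hpos]
  nlinarith

/-- The trapezoidal rule for the convex function `x ↦ x ^ (q - 1)` bounds `1 - (1 - l) ^ q`. -/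
lemma concSummand_le_div {q l : ℝ} (hq : 3 ≤ q) (h0 : 0 < l) (h1 : l < 1) :
    concSummand q l ≤ q * l / (1 + (q - 1) * l / 2) := by
  have hm : 0 < 1 - l := by linarith
  have hd : ∀ s : ℝ, 0 < s → HasDerivAt (fun s : ℝ => q / 2 * ((1 - s) * (1 + s ^ (q - 1)))
      - (1 - s ^ q)) (-(q / 2 * (1 - s ^ (q - 1) - (q - 1) * s ^ (q - 1 - 1) * (1 - s)))) s := by
    intro s hs
    have a := (Real.hasDerivAt_rpow_const (p := q) (Or.inl hs.ne')).const_sub 1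
    have b := (Real.hasDerivAt_rpow_const (p := q - 1) (Or.inl hs.ne')).const_add 1
    have c := (hasDerivAt_id s).const_sub 1
    refine (((c.mul b).const_mul (q / 2)).sub a).congr_deriv ?_
    simp only [id]
    ring
  have h := nonneg_of_deriv_nonpos hd (fun s hs0 hs1 => by
    have h2 := one_le_geomQuotDeriv (p := q - 1) (by linarith) hs0 hs1
    have hs := sub_pos.2 hs1
    rw [geomQuotDeriv, le_div_iff₀ hs, geomQuot, le_sub_iff_add_le, le_div_iff₀ hs] at h2
    have h3 : 0 ≤ 1 - s ^ (q - 1) - (q - 1) * s ^ (q - 1 - 1) * (1 - s) := by nlinarith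
    rw [neg_nonpos]
    exact mul_nonneg (by linarith) h3) (by simp) hm (by linarith)
  have e : (1 - l) ^ (q - 1) = (1 - l) ^ q / (1 - l) := Real.rpow_sub_one hm.ne' q
  simp only [sub_sub_cancel, e] at h
  have hX : 0 ≤ (1 - l) ^ q := Real.rpow_nonneg hm.le q
  have hX1 : (1 - l) ^ q ≤ 1 := Real.rpow_le_one hm.le (by linarith) (by linarith)
  have hY : 0 ≤ l ^ q := Real.rpow_nonneg h0.le q
  have hden : 0 < 1 + (q - 1) * l / 2 := by nlinarith
  have h4 : (1 - (1 - l) ^ q) * (1 - l) ≤ q / 2 * (l * ((1 - l) + (1 - l) ^ q)) := by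
    have := mul_le_mul_of_nonneg_right (sub_nonneg.1 h) hm.le
    refine this.trans (le_of_eq ?_)
    field_simp
  have h5 : (1 - (1 - l) ^ q) * (1 + (q - 1) * l / 2) ≤ q * l := by
    have hD : 0 < 2 + (q - 2) * l := by nlinarith
    refine le_of_mul_le_mul_left ?_ hD
    have h6 := mul_le_mul_of_nonneg_right h4 hden.le
    have h7 : 0 ≤ q * l * ((q - 1) * l ^ 2 / 2) := by
      have : 0 < q - 1 := by linarith
      have : 0 < q := by linarith
      positivity
    have h8 : 0 ≤ (1 - (1 - l) ^ q) := by linarith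
    have e1 : (2 + (q - 2) * l) * ((1 - (1 - l) ^ q) * (1 + (q - 1) * l / 2)) =
        2 * ((1 - (1 - l) ^ q) * (1 - l) * (1 + (q - 1) * l / 2)
          - q / 2 * (l * ((1 - l) + (1 - l) ^ q)) * (1 + (q - 1) * l / 2))
        + q * l * (2 - l) * (1 + (q - 1) * l / 2) := by ring
    have e2 : q * l * (2 - l) * (1 + (q - 1) * l / 2) =
        (2 + (q - 2) * l) * (q * l) - q * l * ((q - 1) * l ^ 2 / 2) := by ring
    linarith
  rw [le_div_iff₀ hden]
  refine le_trans ?_ h5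
  refine mul_le_mul_of_nonneg_right ?_ hden.le
  simp only [concSummand]; linarith

/-- The slope `b` is the logarithmic derivative of `invSummand p` at `1 / d`, and `C` comes from the
uniform bound `1 / 10` of the second derivative. -/
lemma isConcurrenceBound_of_three_le {d : ℕ} (hd : 3 ≤ d) {q : ℝ} (hq : 3 ≤ q)
    (hC : 2 / 5 * concSummand q (1 / d) * (d * (√(d : ℝ) - 1)) ≤ d - 2) :
    IsConcurrenceBound d q (d * concSummand q (1 / d) / ((d : ℝ) - 1) ^ 2) := by
  obtain ⟨p, rfl⟩ : ∃ p, q = p + 1 := ⟨q - 1, by ring⟩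
  have hp : 2 ≤ p := by linarith
  have hp0 : 0 < p := by linarith
  have h3 : (3 : ℝ) ≤ d := by exact_mod_cast hd
  have hd0 : (0 : ℝ) < d := by linarith
  have hn : (0 : ℝ) < d - 1 := by linarith
  have ha0 : (0 : ℝ) < 1 / d := by positivity
  have ha1 : (1 : ℝ) / d < 1 := by rw [div_lt_one hd0]; linarith
  have ha2 : (1 : ℝ) / d ≤ 1 / 2 := by gcongr; linarith
  have hg₀ : 0 < concSummand (p + 1) (1 / d) := concSummand_pos (by linarith) ha0 ha1
  set κ := invSummand p (1 / d) with hκdef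
  have hκ : 0 < κ := invSummand_pos hp0 ha0 ha1
  set b := 1 / d * invSummandDeriv p (1 / d) / κ with hb
  set r := √(d : ℝ) with hr
  have hr0 : 0 < r := Real.sqrt_pos.2 hd0
  have hr2 : r ^ 2 = d := Real.sq_sqrt hd0.le
  have hb0 : 0 ≤ b := by
    have := invSummandDeriv_nonneg hp ha0 ha2
    positivity
  have hb1 : b ≤ (d - 2) / (d - 1) := by
    have h := mul_invSummandDeriv_le hp0 ha0 ha2
    rw [hb, div_le_div_iff₀ hκ hn]
    have h' := mul_le_mul_of_nonneg_left h hd0.le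
    have e1 : d * (1 / (d : ℝ) * (1 - 1 / d) * invSummandDeriv p (1 / d)) =
      1 / d * invSummandDeriv p (1 / d) * (d - 1) := by field_simp
    have e2 : d * ((1 - 2 * (1 / (d : ℝ))) * invSummand p (1 / d)) = (d - 2) * κ := by
      rw [hκdef]; field_simp
    rwa [e1, e2] at h'
  have hb1' : b ≤ 1 := hb1.trans (by rw [div_le_one hn]; linarith)
  have hgκ : concSummand (p + 1) (1 / d) * κ = (d - 1) / d ^ 2 := by
    rw [hκdef, concSummand_mul_invSummand hp0 ha0 ha1]; field_simp
  refine isConcurrenceBound_of_affine hd (b := b) (C := 1 / 10 / (r * κ)) (by linarith) hb0 hb1'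
    (by positivity) ?_ (fun y h0 h1 => ratio_le_one (by linarith) hp h0 h1) ?_
  · have h1 : (d : ℝ) / (2 * (d - 1)) ≤ 1 - b / 2 := by
      have : (d : ℝ) / (2 * (d - 1)) = 1 - (d - 2) / (d - 1) / 2 := by field_simp; ring
      rw [this]; linarith
    have h2 : (1 : ℝ) / 10 / (r * κ) =
        concSummand (p + 1) (1 / d) * d ^ 2 / (10 * r * (d - 1)) := by
      have : 1 / κ = concSummand (p + 1) (1 / d) * d ^ 2 / (d - 1) := by
        rw [div_eq_div_iff hκ.ne' hn.ne', one_mul, mul_right_comm, hgκ]; field_simp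
      calc (1 : ℝ) / 10 / (r * κ) = 1 / (10 * r) * (1 / κ) := by field_simp
        _ = _ := by rw [this]; field_simp
    have h3' : concSummand (p + 1) (1 / d) * d ^ 2 / (10 * r * (d - 1)) ≤
        d / (2 * (d - 1)) * ((d - 2) / (d - 1)) * ((1 + 1 / r) / 2) := by
      have e : (d : ℝ) / (2 * (d - 1)) * ((d - 2) / (d - 1)) * ((1 + 1 / r) / 2) =
        (d * (d - 2) * (r + 1) * 10) / (40 * r * (d - 1) ^ 2) := by field_simp; ring
      have e' : concSummand (p + 1) (1 / d) * d ^ 2 / (10 * r * (d - 1)) =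
        (2 / 5 * concSummand (p + 1) (1 / d) * (d * (r - 1))) * (d * (r + 1) * 10) /
          (40 * r * (d - 1) ^ 2) := by
        rw [div_eq_div_iff (by positivity) (by positivity)]
        have : ((d : ℝ) - 1) = (r - 1) * (r + 1) := by rw [← hr2]; ring
        rw [this]; ring
      rw [e, e']
      refine div_le_div_of_nonneg_right ?_ (by positivity)
      have := mul_le_mul_of_nonneg_right hC (show 0 ≤ d * (r + 1) * 10 by positivity)
      linarith
    rw [h2]
    refine h3'.trans ?_
    refine mul_le_mul_of_nonneg_right (mul_le_mul_of_nonneg_right h1 ?_) (by positivity)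
    exact div_nonneg (by linarith) hn.le
  · intro y hy0 hy
    rcases hy0.eq_or_lt with rfl | hy0
    · have h1 : 0 ≤ concSummand (p + 1) (0 / d) := by
        rw [zero_div]; exact concSummand_nonneg (by linarith) le_rfl zero_le_one
      have h2 : 0 ≤ 1 / 10 / (r * κ) := by positivity
      rw [zero_mul, zero_div, zero_mul]
      refine mul_nonneg ?_ h1
      simp only [Real.sqrt_zero]
      linarith
    refine ratio_mul_le_of_invSummand_le (by linarith) hp0 hy0 (by linarith) ?_
    have hl0 : 0 < y / d := by positivity
    have hl2 : y / d ≤ 1 / 2 := by rw [div_le_div_iff₀ hd0 two_pos]; linarith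
    have hsa : √(1 / (d : ℝ)) = 1 / r := by rw [Real.sqrt_div zero_le_one, Real.sqrt_one]
    have hsy : √(y / d) = √y / r := Real.sqrt_div hy0.le _
    have h := le_tangent_add_sq_sqrt_sub (F := invSummand p) (c := r / 10) ha0 ha2
      (fun x hx hx' => hasDerivAt_invSummand hp0 hx (by linarith))
      (fun x hx hx' => hasDerivAt_invSummandDeriv hp0 hx (by linarith))
      (fun x hx hx' => by
        refine (mul_sqrt_mul_invSummandDeriv2_le hp hx hx'.le).trans (le_of_eq ?_)
        rw [hsa]; field_simp) hl0 hl2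
    refine h.trans (le_of_eq ?_)
    rw [hsa, hsy, ← hκdef, hb]
    field_simp

/-- In small dimensions the bound `concSummand q (1 / d) ≤ 1` is enough. -/
lemma isConcurrenceBound_of_le_eight {d : ℕ} (hd : 3 ≤ d) (hd8 : d ≤ 8) {q : ℝ} (hq : 3 ≤ q) :
    IsConcurrenceBound d q (d * concSummand q (1 / d) / ((d : ℝ) - 1) ^ 2) := by
  have h3 : (3 : ℝ) ≤ d := by exact_mod_cast hd
  have hd0 : (0 : ℝ) < d := by linarith
  refine isConcurrenceBound_of_three_le hd hq ?_
  have hg : concSummand q (1 / d) ≤ 1 := by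
    have h1 : 0 ≤ (1 / (d : ℝ)) ^ q := by positivity
    have h2 : 0 ≤ (1 - 1 / (d : ℝ)) ^ q :=
      Real.rpow_nonneg (by rw [sub_nonneg, div_le_one hd0]; linarith) q
    simp only [concSummand]; linarith
  -- this is what the claim requires when `concSummand q (1 / d)` is replaced by `1`
  have hr : √(d : ℝ) ≤ 7 / 2 - 5 / d := by
    rw [Real.sqrt_le_iff]
    constructor
    · have : 5 / (d : ℝ) ≤ 5 / 3 := by gcongr
      linarith
    · interval_cases d <;> norm_num
  have hr1 : 1 ≤ √(d : ℝ) := Real.one_le_sqrt.2 (by linarith)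
  have h1 : d * (√(d : ℝ) - 1) ≤ 5 / 2 * d - 5 := by
    have := mul_le_mul_of_nonneg_left hr hd0.le
    have e : (d : ℝ) * (7 / 2 - 5 / d) = 7 / 2 * d - 5 := by field_simp
    linarith
  have h2 : 0 ≤ d * (√(d : ℝ) - 1) := mul_nonneg hd0.le (by linarith)
  nlinarith

/-- For moderate exponents `concSummand q (1 / d)` is of the order of `q / d`. -/
lemma isConcurrenceBound_of_le_fourteen {d : ℕ} (hd : 9 ≤ d) {q : ℝ} (hq : 3 ≤ q) (hq14 : q ≤ 14) :
    IsConcurrenceBound d q (d * concSummand q (1 / d) / ((d : ℝ) - 1) ^ 2) := by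
  have h9 : (9 : ℝ) ≤ d := by exact_mod_cast hd
  have hd0 : (0 : ℝ) < d := by linarith
  refine isConcurrenceBound_of_three_le (by omega) hq ?_
  have hg : concSummand q (1 / d) ≤ 14 / (d + 13 / 2) := by
    refine (concSummand_le_div hq (by positivity) (by rw [div_lt_one hd0]; linarith)).trans ?_
    have e : q * (1 / (d : ℝ)) / (1 + (q - 1) * (1 / d) / 2) = q / (d + (q - 1) / 2) := by
      field_simp
    rw [e, div_le_div_iff₀ (by linarith) (by linarith)]
    nlinarith
  obtain ⟨r, hr0, hr⟩ : ∃ r : ℝ, 3 ≤ r ∧ r ^ 2 = d :=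
    ⟨√(d : ℝ), Real.le_sqrt_of_sq_le (by linarith), Real.sq_sqrt hd0.le⟩
  have hs : √(d : ℝ) = r := by rw [← hr]; exact Real.sqrt_sq (by linarith)
  rw [hs]
  have h1 : 0 ≤ d * (r - 1) := mul_nonneg hd0.le (by linarith)
  have h2 : 2 / 5 * concSummand q (1 / d) * (d * (r - 1)) ≤
      2 / 5 * (14 / (d + 13 / 2)) * (d * (r - 1)) := by gcongr
  refine h2.trans ?_
  rw [mul_div_assoc', div_mul_eq_mul_div, div_le_iff₀ (by linarith), ← hr]
  obtain ⟨x, rfl⟩ : ∃ x, r = 3 + x := ⟨r - 3, by ring⟩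
  have hx : 0 ≤ x := by linarith
  rw [← sub_nonneg]
  have e : ((3 + x) ^ 2 - 2) * ((3 + x) ^ 2 + 13 / 2) - 2 / 5 * 14 * ((3 + x) ^ 2 * (3 + x - 1)) =
      x ^ 4 + 32 / 5 * x ^ 3 + 137 / 10 * x ^ 2 + 87 / 5 * x + 77 / 10 := by
    ring
  rw [e]
  positivity

/-! ### Two qubits -/

/-- The function `λ (1 - λ) / concSummand q λ` is largest at `1 / 2`, and
`((√λ + √(1 - λ)) ^ 2 - 1) ^ 2 = 4 λ (1 - λ)`. -/
lemma isConcurrenceBound_two {q : ℝ} (hq : 3 ≤ q) :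
    IsConcurrenceBound 2 q (2 * concSummand q (1 / 2)) := by
  intro l hl0 hl1
  rw [Fin.sum_univ_two] at hl1
  rw [Fin.sum_univ_two, Fin.sum_univ_two]
  have h0 := hl0 0
  have h1 := hl0 1
  have e1 : l 1 = 1 - l 0 := by linarith
  have hT : ((√(l 0) + √(l 1)) ^ 2 - 1) ^ 2 = 4 * (l 0 * l 1) := by
    have a := Real.sq_sqrt h0
    have b := Real.sq_sqrt h1
    have : (√(l 0) + √(l 1)) ^ 2 - 1 = 2 * (√(l 0) * √(l 1)) := by
      rw [add_sq, a, b]; linarith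
    rw [this, mul_pow, mul_pow, a, b]; ring
  have key : ∀ t : ℝ, 0 ≤ t → t ≤ 1 / 2 →
      concSummand q (1 / 2) * (4 * (t * (1 - t))) ≤ concSummand q t := by
    intro t ht0 ht
    have h := ratio_le_one (d := 2) (p := q - 1) le_rfl (by linarith) (y := 2 * t) (by linarith)
      (by linarith)
    rw [sub_add_cancel, mul_div_cancel_left₀ t two_ne_zero] at h
    refine le_trans (le_of_eq ?_) h
    ring
  rw [hT, e1, concSummand_one_sub]
  rcases le_total (l 0) (1 / 2) with h | h
  · have := key _ h0 h
    linarith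
  · have := key (1 - l 0) (by linarith) (by linarith)
    rw [concSummand_one_sub] at this
    linarith

/-! ### The binomial series in `λ / (1 - λ)` -/

/-- The binomial series of `(1 + t) ^ q`, truncated after the sixth power. -/
noncomputable def binomSum (q t : ℝ) : ℝ :=
  1 + q * t + q * (q - 1) / 2 * t ^ 2 + q * (q - 1) * (q - 2) / 6 * t ^ 3
    + q * (q - 1) * (q - 2) * (q - 3) / 24 * t ^ 4
    + q * (q - 1) * (q - 2) * (q - 3) * (q - 4) / 120 * t ^ 5
    + q * (q - 1) * (q - 2) * (q - 3) * (q - 4) * (q - 5) / 720 * t ^ 6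

lemma binomSum_le {q t : ℝ} (hq : 6 ≤ q) (h0 : 0 ≤ t) : binomSum q t ≤ (1 + t) ^ q := by
  have hd : ∀ x : ℝ, 0 ≤ x → HasDerivAt (fun t => (1 + t) ^ (-q) * binomSum q t)
      (-((1 + x) ^ (-q - 1) * (q * (q - 1) * (q - 2) * (q - 3) * (q - 4) * (q - 5) * (q - 6) / 720
        * x ^ 6))) x := by
    intro x hx0
    have hx : 0 < 1 + x := by linarith
    have a := (Real.hasDerivAt_rpow_const (p := -q) (Or.inl hx.ne')).comp x
      ((hasDerivAt_id x).const_add 1)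
    have m : ∀ (c : ℝ) (n : ℕ), HasDerivAt (fun l : ℝ => c * l ^ n) (c * (n * x ^ (n - 1))) x :=
      fun c n => (hasDerivAt_pow n x).const_mul c
    have b := (((((((hasDerivAt_id x).const_mul q).const_add 1).add (m (q * (q - 1) / 2) 2)).add
      (m (q * (q - 1) * (q - 2) / 6) 3)).add (m (q * (q - 1) * (q - 2) * (q - 3) / 24) 4)).add
      (m (q * (q - 1) * (q - 2) * (q - 3) * (q - 4) / 120) 5)).add
      (m (q * (q - 1) * (q - 2) * (q - 3) * (q - 4) * (q - 5) / 720) 6)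
    refine (a.mul b).congr_deriv ?_
    have e : (1 + x) ^ (-q) = (1 + x) ^ (-q - 1) * (1 + x) := by
      rw [← Real.rpow_add_one hx.ne']; congr 1; ring
    simp only [Function.comp_apply, id, Pi.add_apply, e]
    push_cast
    ring
  have h : AntitoneOn (fun t => (1 + t) ^ (-q) * binomSum q t) (Set.Icc 0 t) := by
    refine antitoneOn_of_deriv_nonpos (convex_Icc _ _)
      (fun x hx => (hd x hx.1).continuousAt.continuousWithinAt)
      (fun x hx => ?_) (fun x hx => ?_)
    · rw [interior_Icc] at hx
      exact (hd x hx.1.le).differentiableAt.differentiableWithinAt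
    · rw [interior_Icc] at hx
      rw [(hd x hx.1.le).deriv, neg_nonpos]
      have := hx.1
      have := Real.rpow_nonneg (show 0 ≤ 1 + x by linarith) (-q - 1)
      have : 0 ≤ q * (q - 1) * (q - 2) * (q - 3) * (q - 4) * (q - 5) * (q - 6) := by
        obtain ⟨y, rfl⟩ : ∃ y, q = 6 + y := ⟨q - 6, by ring⟩
        have : 0 ≤ y := by linarith
        ring_nf
        positivity
      positivity
  have h1 := h ⟨le_rfl, h0⟩ ⟨h0, le_rfl⟩ h0
  have e0 : binomSum q 0 = 1 := by simp [binomSum]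
  simp only [e0, add_zero, Real.one_rpow, mul_one] at h1
  rw [Real.rpow_neg (by linarith), inv_mul_le_iff₀ (Real.rpow_pos_of_pos (by linarith) q)] at h1
  linarith

lemma one_add_mul_le_binomSum {q t : ℝ} (hq : 6 ≤ q) (h0 : 0 ≤ t) :
    1 + q * t ≤ binomSum q t := by
  have : 0 ≤ binomSum q t - (1 + q * t) := by
    obtain ⟨y, rfl⟩ : ∃ y, q = 6 + y := ⟨q - 6, by ring⟩
    have : 0 ≤ y := by linarith
    rw [binomSum]; ring_nf; positivity
  linarith

set_option maxRecDepth 100000 in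
/-- In the coordinates `s - 1` and `q - 14` all coefficients of the difference of the two sides
are nonnegative. -/
lemma divSummand_polynomial_le {q s M : ℝ} (hq : 14 ≤ q) (hs : 1 ≤ s)
    (hM : M = s ^ 6 + q * s ^ 5 + q * (q - 1) / 2 * s ^ 4 + q * (q - 1) * (q - 2) / 6 * s ^ 3
    + q * (q - 1) * (q - 2) * (q - 3) / 24 * s ^ 2
    + q * (q - 1) * (q - 2) * (q - 3) * (q - 4) / 120 * s
    + q * (q - 1) * (q - 2) * (q - 3) * (q - 4) * (q - 5) / 720) :
    s ^ 4 * (q + 4 + 4 * s) * q * M * ((q - 1 - 2 * s) * M + (q + 1 + 2 * s) * s ^ 6) ≤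
      51 / 25 * (s + 1) * (M - s ^ 6) ^ 3 := by
  obtain ⟨x, rfl⟩ : ∃ x, q = 14 + x := ⟨q - 14, by ring⟩
  obtain ⟨v, rfl⟩ : ∃ v, s = 1 + v := ⟨s - 1, by ring⟩
  have hx : 0 ≤ x := by linarith
  have hv : 0 ≤ v := by linarith
  rw [← sub_nonneg]
  subst hM
  ring_nf
  positivity

/-! ### Large exponents: the second derivative of `λ / concSummand q λ` -/

/-- The first derivative of `concSummand q`. -/
noncomputable def concSummandDeriv (q l : ℝ) : ℝ := q * ((1 - l) ^ (q - 1) - l ^ (q - 1))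

/-- The second derivative of `concSummand q`. -/
noncomputable def concSummandDeriv2 (q l : ℝ) : ℝ :=
  -(q * (q - 1) * ((1 - l) ^ (q - 2) + l ^ (q - 2)))

lemma hasDerivAt_concSummand {q l : ℝ} (h0 : 0 < l) (h1 : l < 1) :
    HasDerivAt (concSummand q) (concSummandDeriv q l) l := by
  have hm : 0 < 1 - l := sub_pos.2 h1
  have a := Real.hasDerivAt_rpow_const (p := q) (Or.inl h0.ne')
  have b := (Real.hasDerivAt_rpow_const (p := q) (Or.inl hm.ne')).comp l
    ((hasDerivAt_id l).const_sub 1)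
  refine ((a.const_sub 1).sub b).congr_deriv ?_
  rw [concSummandDeriv]; ring

lemma hasDerivAt_concSummandDeriv {q l : ℝ} (h0 : 0 < l) (h1 : l < 1) :
    HasDerivAt (concSummandDeriv q) (concSummandDeriv2 q l) l := by
  have hm : 0 < 1 - l := sub_pos.2 h1
  have a := Real.hasDerivAt_rpow_const (p := q - 1) (Or.inl h0.ne')
  have b := (Real.hasDerivAt_rpow_const (p := q - 1) (Or.inl hm.ne')).comp l
    ((hasDerivAt_id l).const_sub 1)
  refine ((b.sub a).const_mul q).congr_deriv ?_
  have e : q - 1 - 1 = q - 2 := by ring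
  rw [concSummandDeriv2, e]; ring

/-- The first derivative of `l / concSummand q l`. -/
noncomputable def divSummandDeriv (q l : ℝ) : ℝ :=
  (concSummand q l - l * concSummandDeriv q l) / concSummand q l ^ 2

/-- The second derivative of `l / concSummand q l`. -/
noncomputable def divSummandDeriv2 (q l : ℝ) : ℝ :=
  (2 * l * concSummandDeriv q l ^ 2
    - (2 * concSummandDeriv q l + l * concSummandDeriv2 q l) * concSummand q l)
    / concSummand q l ^ 3

lemma hasDerivAt_divSummand {q l : ℝ} (hq : 1 < q) (h0 : 0 < l) (h1 : l < 1) :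
    HasDerivAt (fun l => l / concSummand q l) (divSummandDeriv q l) l := by
  have hf := concSummand_pos hq h0 h1
  refine ((hasDerivAt_id l).div (hasDerivAt_concSummand h0 h1) hf.ne').congr_deriv ?_
  simp [divSummandDeriv]

lemma hasDerivAt_divSummandDeriv {q l : ℝ} (hq : 1 < q) (h0 : 0 < l) (h1 : l < 1) :
    HasDerivAt (divSummandDeriv q) (divSummandDeriv2 q l) l := by
  have hf := concSummand_pos hq h0 h1
  have h := ((hasDerivAt_concSummand (q := q) h0 h1).sub
    ((hasDerivAt_id l).mul (hasDerivAt_concSummandDeriv (q := q) h0 h1))).div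
    ((hasDerivAt_concSummand (q := q) h0 h1).pow 2) (pow_pos hf 2).ne'
  refine h.congr_deriv ?_
  simp only [divSummandDeriv2, Pi.pow_apply, Pi.sub_apply, Pi.mul_apply, id]
  field_simp
  ring

/-- The inequality of `divSummand_polynomial_le`, in terms of `X = (1 - l) ^ q`. -/
lemma divSummand_main_le {q l X : ℝ} (hq : 14 ≤ q) (h0 : 0 < l) (h1 : l ≤ 1 / 2) (hX0 : 0 < X)
    (hX : X * binomSum q (l / (1 - l)) ≤ 1) :
    (q * l + 4) * l * (q * X / (1 - l) ^ 2 * ((q + 1) * l - 2 + X * ((q - 1) * l + 2))) ≤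
      51 / 25 * (1 - X) ^ 3 := by
  have hμ : 0 < 1 - l := by linarith
  set M := binomSum q (l / (1 - l)) with hM
  have hM1 : 1 < M := by
    have := one_add_mul_le_binomSum (show 6 ≤ q by linarith) (show 0 ≤ l / (1 - l) by positivity)
    have h2 : 0 < q * (l / (1 - l)) := mul_pos (by linarith) (by positivity)
    linarith
  have hM0 : 0 < M := by linarith
  have hXM : X ≤ 1 / M := by rw [le_div_iff₀ hM0]; exact hX
  have hM1' : 1 / M < 1 := by rw [div_lt_one hM0]; exact hM1
  have hq1 : 0 < q - 1 := by linarith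
  have hq0 : 0 < q := by linarith
  have hF : (1 - 1 / M) ^ 3 ≤ (1 - X) ^ 3 := pow_le_pow_left₀ (by linarith) (by linarith) 3
  have hF0 : 0 < (1 - 1 / M) ^ 3 := pow_pos (by linarith) 3
  set B : ℝ → ℝ := fun X => (q + 1) * l - 2 + X * ((q - 1) * l + 2) with hB
  change (q * l + 4) * l * (q * X / (1 - l) ^ 2 * B X) ≤ _
  by_cases hneg : B X ≤ 0
  · have : (q * l + 4) * l * (q * X / (1 - l) ^ 2 * B X) ≤ 0 :=
      mul_nonpos_of_nonneg_of_nonpos (by positivity)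
        (mul_nonpos_of_nonneg_of_nonpos (by positivity) hneg)
    linarith
  push Not at hneg
  have hBM : B X ≤ B (1 / M) := by
    simp only [hB]
    have := mul_le_mul_of_nonneg_right hXM (show 0 ≤ (q - 1) * l + 2 by positivity)
    linarith
  have hle : (q * l + 4) * l * (q * X / (1 - l) ^ 2 * B X) ≤
      (q * l + 4) * l * (q * (1 / M) / (1 - l) ^ 2 * B (1 / M)) := by gcongr
  refine hle.trans (le_trans ?_ (mul_le_mul_of_nonneg_left hF (by norm_num)))
  have hs : 1 ≤ (1 - l) / l := by rw [le_div_iff₀ h0]; linarith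
  have h := divSummand_polynomial_le (s := (1 - l) / l) (M := ((1 - l) / l) ^ 6 * M) hq hs (by
    rw [hM, binomSum]; field_simp)
  set s := (1 - l) / l with hsdef
  have hs0 : 0 < s := by linarith
  have hl : l = 1 / (1 + s) := by rw [hsdef]; field_simp; ring
  have hm : 1 - l = s / (1 + s) := by rw [hl]; field_simp; ring
  have hpos : 0 < s ^ 18 * M ^ 3 * (1 + s) := by positivity
  refine le_of_mul_le_mul_left ?_ hpos
  refine le_trans (le_of_eq ?_) (h.trans (le_of_eq ?_))
  · simp only [hB]
    rw [hm]
    conv_lhs => rw [hl]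
    field_simp
    ring
  · field_simp
    ring

/-- Exponential decay against cubic growth. -/
lemma mul_rpow_half_le {q : ℝ} (hq : 14 ≤ q) :
    (q / 2 + 4) * q * (q + 1) * (1 / 2 : ℝ) ^ (q - 2) ≤ 564 / 1000 := by
  have hq0 : 0 < q := by linarith
  have h1 : (q / 14) ^ 3 ≤ (2 : ℝ) ^ (q - 14) := by
    have h2 : q / 14 ≤ Real.exp ((q - 14) / 14) := by
      have := Real.add_one_le_exp ((q - 14) / 14); linarith
    calc (q / 14) ^ 3 ≤ Real.exp ((q - 14) / 14) ^ 3 := by gcongr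
      _ = Real.exp (3 * ((q - 14) / 14)) := by rw [← Real.exp_nat_mul]; norm_num
      _ ≤ Real.exp (Real.log 2 * (q - 14)) := by
          have := Real.log_two_gt_d9
          refine Real.exp_le_exp.2 ?_
          nlinarith
      _ = _ := by rw [Real.rpow_def_of_pos two_pos]
  have h3 : (1 / 2 : ℝ) ^ (q - 2) = 1 / 4096 * (1 / (2 : ℝ) ^ (q - 14)) := by
    have : q - 2 = 12 + (q - 14) := by ring
    rw [this, Real.rpow_add (by norm_num), Real.div_rpow zero_le_one zero_le_two,
      Real.div_rpow zero_le_one zero_le_two, Real.one_rpow, Real.one_rpow]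
    norm_num
  have h4 : 0 < (2 : ℝ) ^ (q - 14) := Real.rpow_pos_of_pos two_pos _
  have h5 : (q / 2 + 4) * q * (q + 1) ≤ 564 / 1000 * 4096 * (q / 14) ^ 3 := by
    obtain ⟨x, rfl⟩ : ∃ x, q = 14 + x := ⟨q - 14, by ring⟩
    have : 0 ≤ x := by linarith
    rw [← sub_nonneg]
    ring_nf
    positivity
  rw [h3, ← mul_assoc, mul_one_div, mul_one_div, div_div, div_le_iff₀ (by positivity)]
  nlinarith

/-- The main term, in which `l ^ q` is neglected, contributes `51 / 25` by `divSummand_main_le`; the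
terms with `l ^ q` contribute at most `147 / 1000`. -/
lemma mul_divSummandDeriv2_le {q l : ℝ} (hq : 14 ≤ q) (h0 : 0 < l) (h1 : l ≤ 1 / 2) :
    (q * l + 4) * l * divSummandDeriv2 q l ≤ 11 / 5 := by
  have hμ : 0 < 1 - l := by linarith
  have hq0 : 0 < q := by linarith
  have hf := concSummand_pos (show 1 < q by linarith) h0 (by linarith)
  set X := (1 - l) ^ q with hX
  set Y := l ^ q with hY
  have hX0 : 0 < X := Real.rpow_pos_of_pos hμ q
  have hY0 : 0 < Y := Real.rpow_pos_of_pos h0 q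
  have hYX : Y ≤ X := Real.rpow_le_rpow h0.le (by linarith) hq0.le
  set F := 1 - X with hF
  have hXM : X * binomSum q (l / (1 - l)) ≤ 1 := by
    have h := binomSum_le (show 6 ≤ q by linarith) (show 0 ≤ l / (1 - l) by positivity)
    have e : 1 + l / (1 - l) = 1 / (1 - l) := by field_simp; ring
    rw [e, Real.div_rpow zero_le_one hμ.le, Real.one_rpow, ← hX, le_div_iff₀ hX0] at h
    linarith
  have hmain := divSummand_main_le hq h0 h1 hX0 hXM
  have hFl : 98 / 50 * l ≤ F := by
    have h2 : X ≤ (1 - l) ^ (6 : ℝ) :=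
      Real.rpow_le_rpow_of_exponent_ge hμ (by linarith) (by linarith)
    have e6 : (1 - l) ^ (6 : ℝ) = (1 - l) ^ 6 := by norm_cast
    rw [e6] at h2
    obtain ⟨v, hv⟩ : ∃ v, l = 1 / 2 - v := ⟨1 / 2 - l, by ring⟩
    have hv0 : 0 ≤ v := by linarith
    have h3 : 0 ≤ l * ((1 + (1 / 2 + v)) * (1 + (1 / 2 + v) ^ 2 + (1 / 2 + v) ^ 4) - 98 / 50) := by
      refine mul_nonneg h0.le ?_
      ring_nf
      positivity
    have h4 : 1 - (1 - l) ^ 6 - 98 / 50 * l =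
        l * ((1 + (1 / 2 + v)) * (1 + (1 / 2 + v) ^ 2 + (1 / 2 + v) ^ 4) - 98 / 50) := by
      rw [hv]; ring
    linarith
  have hF0 : 0 < F := by linarith
  have eY : Y = l * l * l ^ (q - 2) := by
    rw [hY, Real.rpow_sub h0, Real.rpow_two]; field_simp
  have hp2 : l ^ (q - 2) ≤ (1 / 2 : ℝ) ^ (q - 2) := Real.rpow_le_rpow h0.le h1 (by linarith)
  have hp0 : 0 ≤ l ^ (q - 2) := Real.rpow_nonneg h0.le _
  have hF2 : 96 / 25 * (l * l) ≤ F ^ 2 := by nlinarith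
  have hJ : (q * l + 4) * q * (q + 1) * Y ≤ 147 / 1000 * F ^ 2 := by
    have h2 : (q * l + 4) * q * (q + 1) * l ^ (q - 2) ≤ 564 / 1000 := by
      refine le_trans ?_ (mul_rpow_half_le hq)
      have : q * l ≤ q / 2 := by nlinarith
      gcongr
    rw [eY]
    have h3 := mul_le_mul_of_nonneg_right h2 (mul_self_nonneg l)
    nlinarith [mul_self_nonneg l]
  have hYF : 10000 * Y ≤ F := by
    have h2 : (1 / 2 : ℝ) ^ (q - 2) ≤ (1 / 2 : ℝ) ^ (12 : ℝ) :=
      Real.rpow_le_rpow_of_exponent_ge (by norm_num) (by norm_num) (by linarith)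
    have e : (1 / 2 : ℝ) ^ (12 : ℝ) = 1 / 4096 := by norm_num
    have h3 : l ^ (q - 2) ≤ 1 / 4096 := by linarith
    have h4 : l * l ^ (q - 2) ≤ 1 / 2 * (1 / 4096) := by gcongr
    rw [eY, mul_assoc]
    nlinarith
  have ef : concSummand q l = F - Y := by simp only [concSummand, hF, hX, hY]; ring
  have hf3 : F ^ 3 * (2187 / 1000) ≤ 11 / 5 * concSummand q l ^ 3 := by
    have : (9999 / 10000 * F) ^ 3 ≤ concSummand q l ^ 3 := by
      refine pow_le_pow_left₀ (by positivity) ?_ 3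
      rw [ef]; linarith
    have h2 : 0 < F ^ 3 := by positivity
    rw [mul_pow] at this
    linarith
  have ef1 : concSummandDeriv q l = q * (X / (1 - l) - Y / l) := by
    rw [concSummandDeriv, Real.rpow_sub_one hμ.ne', Real.rpow_sub_one h0.ne']
  have ef2 : concSummandDeriv2 q l = -(q * (q - 1) * (X / (1 - l) ^ 2 + Y / l ^ 2)) := by
    rw [concSummandDeriv2, Real.rpow_sub hμ, Real.rpow_sub h0, Real.rpow_two, Real.rpow_two]
  set f₁ := concSummandDeriv q l with hf₁
  have hf₁0 : 0 ≤ f₁ := by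
    have := Real.rpow_le_rpow h0.le (show l ≤ 1 - l by linarith) (show 0 ≤ q - 1 by linarith)
    rw [hf₁, concSummandDeriv]
    exact mul_nonneg hq0.le (by linarith)
  set N := 2 * l * f₁ ^ 2 - (2 * f₁ + l * concSummandDeriv2 q l) * concSummand q l with hN
  -- the terms without `Y` are those of the second derivative of `l / F`
  have hNle : N ≤ q * X / (1 - l) ^ 2 * ((q + 1) * l - 2 + X * ((q - 1) * l + 2))
      + q * (q + 1) * (Y / l) * F := by
    have e : q * X / (1 - l) ^ 2 * ((q + 1) * l - 2 + X * ((q - 1) * l + 2))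
      + q * (q + 1) * (Y / l) * F - N = 2 * q * Y * f₁ + 2 * (q - 1) * (q * X / (1 - l)) * Y
        + q * (q - 1) * (X / (1 - l) ^ 2) * l * Y + q * (q + 1) * (Y / l) * Y := by
      rw [hN, ef, ef2, ef1, hF]
      field_simp
      ring
    have hq1 : 0 < q - 1 := by linarith
    have : 0 ≤ 2 * q * Y * f₁ + 2 * (q - 1) * (q * X / (1 - l)) * Y
        + q * (q - 1) * (X / (1 - l) ^ 2) * l * Y + q * (q + 1) * (Y / l) * Y := by positivity
    linarith
  have hm2 := mul_le_mul_of_nonneg_left hNle (show 0 ≤ (q * l + 4) * l by positivity)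
  have hJ2 : (q * l + 4) * l * (q * (q + 1) * (Y / l) * F) ≤ 147 / 1000 * F ^ 3 := by
    have e : (q * l + 4) * l * (q * (q + 1) * (Y / l) * F) = (q * l + 4) * q * (q + 1) * Y * F := by
      field_simp
    rw [e]
    have := mul_le_mul_of_nonneg_right hJ hF0.le
    linarith
  rw [divSummandDeriv2, mul_div_assoc', div_le_iff₀ (pow_pos hf 3)]
  change (q * l + 4) * l * N ≤ _
  linarith

/-! ### Large exponents: the bound -/

/-- An upper bound of the logarithmic derivative of the summand, from the first terms of the
binomial series. -/
lemma mul_concSummandDeriv_le {p a : ℝ} (hp : 13 ≤ p) (h0 : 0 < a) (h1 : a ≤ 1 / 2) :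
    a * concSummandDeriv (p + 1) a * (1 + 13 / 2 * a + 65 / 2 * a ^ 2) ≤
      concSummand (p + 1) a := by
  have hμ : 0 < 1 - a := by linarith
  have hZ0 : 0 < (1 - a) ^ p := Real.rpow_pos_of_pos hμ p
  have hW0 : 0 < a ^ p := Real.rpow_pos_of_pos h0 p
  have hb := rpow_mul_binomTrunc_le (show 0 ≤ p by linarith) h0.le (by linarith)
  have e1 : a ^ (p + 1) = a ^ p * a := Real.rpow_add_one h0.ne' p
  have e2 : (1 - a) ^ (p + 1) = (1 - a) ^ p * (1 - a) := Real.rpow_add_one hμ.ne' p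
  rw [concSummandDeriv, concSummand, e1, e2, add_sub_cancel_right]
  generalize (1 - a) ^ p = Z at *
  generalize a ^ p = W at *
  have h2 : 1 - a + (p + 1) * a * (1 + 13 / 2 * a + 65 / 2 * a ^ 2) ≤ binomTrunc p a := by
    have : 0 ≤ binomTrunc p a - (1 - a + (p + 1) * a * (1 + 13 / 2 * a + 65 / 2 * a ^ 2)) := by
      obtain ⟨x, rfl⟩ : ∃ x, p = 13 + x := ⟨p - 13, by ring⟩
      have : 0 ≤ x := by linarith
      rw [binomTrunc]
      ring_nf
      positivity
    linarith
  have h3 := mul_le_mul_of_nonneg_left h2 hZ0.le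
  have h4 : W * a ≤ (p + 1) * (1 + 13 / 2 * a + 65 / 2 * a ^ 2) * (W * a) := by
    refine le_mul_of_one_le_left (by positivity) ?_
    have : 0 ≤ 13 / 2 * a + 65 / 2 * a ^ 2 := by positivity
    nlinarith
  nlinarith

/-- The inequality of the arithmetic and geometric means in the denominator of
`concSummand_le_div`. -/
lemma sq_concSummand_le {q a : ℝ} (hq : 14 ≤ q) (h0 : 0 < a) (h1 : a < 1) :
    concSummand q a ^ 2 ≤ 7 / 13 * q * a := by
  have h := concSummand_le_div (show 3 ≤ q by linarith) h0 h1
  have hz : 0 < (q - 1) * a := mul_pos (by linarith) h0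
  have h2 : concSummand q a ^ 2 ≤ (q * a / (1 + (q - 1) * a / 2)) ^ 2 :=
    pow_le_pow_left₀ (concSummand_nonneg (by linarith) h0.le h1.le) h 2
  refine h2.trans ?_
  rw [div_pow, div_le_iff₀ (by positivity)]
  have h3 : 2 * ((q - 1) * a) ≤ (1 + (q - 1) * a / 2) ^ 2 := by
    nlinarith [sq_nonneg (1 - (q - 1) * a / 2)]
  have h4 : 0 ≤ 7 / 13 * q * a := by
    have : 0 < q := by linarith
    positivity
  refine le_trans ?_ (mul_le_mul_of_nonneg_left h3 h4)
  have : 0 ≤ q * a ^ 2 * (q / 13 - 14 / 13) :=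
    mul_nonneg (mul_nonneg (by linarith) (sq_nonneg a)) (by linarith)
  nlinarith

lemma sqrt_mul_concSummand_le {q a x : ℝ} (hq : 14 ≤ q) (h0 : 0 < a) (h1 : a < 1) (hx : 0 < x) :
    √x * concSummand q a ≤ 7339 / 10000 * √a * ((q * x + 4) / 4) := by
  have hq0 : 0 < q := by linarith
  refine le_of_sq_le_sq ?_ (by positivity)
  rw [mul_pow, mul_pow, mul_pow, Real.sq_sqrt hx.le, Real.sq_sqrt h0.le]
  have h2 := mul_le_mul_of_nonneg_left (sq_concSummand_le hq h0 h1) hx.le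
  have h3 : q * x ≤ ((q * x + 4) / 4) ^ 2 := by nlinarith [sq_nonneg (q * x - 4)]
  have h4 := mul_le_mul_of_nonneg_left h3 (show 0 ≤ (7339 / 10000) ^ 2 * a by positivity)
  have h5 : 0 ≤ q * x * a := by positivity
  linarith

/-- A tangent bound of `λ / concSummand q λ` gives the hypothesis of
`isConcurrenceBound_of_quadratic`: the factor `(d - 1) / (d - 2)` of `ν` makes up for the
quadratic term of `y (d - y)`. -/
lemma ratio_mul_le_of_div_le {d q y ν C : ℝ} (hd : 2 < d) (hq : 1 < q) (hν : 0 ≤ ν)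
    (h0 : 0 < y) (h1 : y < d)
    (h : y / d / concSummand q (y / d) ≤
      1 / d / concSummand q (1 / d) * (1 + (1 - ν) * (y - 1) + C * (√y - 1) ^ 2)) :
    y * (d - y) / (d - 1) * concSummand q (1 / d) ≤
      (ν * ((d - 1) / (d - 2)) + (1 - ν * ((d - 1) / (d - 2))) * (y * (d - y) / (d - 1))
        + C * ((√y - 1) ^ 2 * ((d - y) / (d - 1)))) * concSummand q (y / d) := by
  have hd0 : 0 < d := by linarith
  have hn : 0 < d - 1 := by linarith
  have hn1 : 0 < d - 2 := by linarith
  have hf := concSummand_pos hq (show 0 < y / d by positivity) ((div_lt_one hd0).2 h1)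
  have hf0 := concSummand_pos hq (show 0 < 1 / d by positivity) ((div_lt_one hd0).2 (by linarith))
  set f := concSummand q (y / d)
  set f0 := concSummand q (1 / d)
  set E := 1 + (1 - ν) * (y - 1) + C * (√y - 1) ^ 2 with hE
  have h2 : y * f0 ≤ E * f := by
    rw [div_le_iff₀ hf] at h
    have := mul_le_mul_of_nonneg_left h (show 0 ≤ d * f0 by positivity)
    have e1 : d * f0 * (y / d) = y * f0 := by field_simp
    have e2 : d * f0 * (1 / d / f0 * E * f) = E * f := by field_simp
    linarith
  have h3 := mul_le_mul_of_nonneg_right h2 (show 0 ≤ (d - y) / (d - 1) from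
    div_nonneg (by linarith) hn.le)
  have h4 : E * ((d - y) / (d - 1)) ≤
      ν * ((d - 1) / (d - 2)) + (1 - ν * ((d - 1) / (d - 2))) * (y * (d - y) / (d - 1))
        + C * ((√y - 1) ^ 2 * ((d - y) / (d - 1))) := by
    rw [← sub_nonneg]
    have e : ν * ((d - 1) / (d - 2)) + (1 - ν * ((d - 1) / (d - 2))) * (y * (d - y) / (d - 1))
        + C * ((√y - 1) ^ 2 * ((d - y) / (d - 1))) - E * ((d - y) / (d - 1)) =
        ν * (y - 1) ^ 2 / ((d - 1) * (d - 2)) := by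
      rw [hE]
      field_simp
      ring
    rw [e]
    positivity
  have h5 := mul_le_mul_of_nonneg_right h4 hf.le
  calc y * (d - y) / (d - 1) * f0 = y * f0 * ((d - y) / (d - 1)) := by ring
    _ ≤ E * f * ((d - y) / (d - 1)) := h3
    _ = E * ((d - y) / (d - 1)) * f := by ring
    _ ≤ _ := h5

/-- The quadratic bound, with `ν` the logarithmic derivative of the summand at `1 / d`. -/
lemma isConcurrenceBound_of_fourteen_le {d : ℕ} (hd : 9 ≤ d) {q : ℝ} (hq : 14 ≤ q) :
    IsConcurrenceBound d q (d * concSummand q (1 / d) / ((d : ℝ) - 1) ^ 2) := by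
  have h9 : (9 : ℝ) ≤ d := by exact_mod_cast hd
  have hd0 : (0 : ℝ) < d := by linarith
  have hn : (0 : ℝ) < d - 1 := by linarith
  have hn1 : (0 : ℝ) < d - 2 := by linarith
  have hq1 : 1 < q := by linarith
  have ha0 : (0 : ℝ) < 1 / d := by positivity
  have ha1 : (1 : ℝ) / d < 1 := by rw [div_lt_one hd0]; linarith
  have ha2 : (1 : ℝ) / d ≤ 1 / 2 := by gcongr; linarith
  have hf₀ : 0 < concSummand q (1 / d) := concSummand_pos hq1 ha0 ha1
  set f₀ := concSummand q (1 / d) with hf₀def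
  set f₁ := concSummandDeriv q (1 / d) with hf₁def
  have hf₁ : 0 ≤ f₁ := by
    have := Real.rpow_le_rpow ha0.le (show 1 / (d : ℝ) ≤ 1 - 1 / d by linarith)
      (show 0 ≤ q - 1 by linarith)
    rw [hf₁def, concSummandDeriv]
    exact mul_nonneg (by linarith) (by linarith)
  set ν := 1 / d * f₁ / f₀ with hν
  have hν0 : 0 ≤ ν := by positivity
  set E : ℝ := d ^ 2 + 13 / 2 * d + 65 / 2 with hE
  have hE0 : 0 < E := by positivity
  have hνE : ν * E ≤ d ^ 2 := by
    have h := mul_concSummandDeriv_le (p := q - 1) (by linarith) ha0 ha2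
    rw [sub_add_cancel, ← hf₁def, ← hf₀def] at h
    have e : ν * E = d ^ 2 * (1 / d * f₁ * (1 + 13 / 2 * (1 / (d : ℝ)) + 65 / 2 * (1 / (d : ℝ)) ^ 2))
        / f₀ := by
      rw [hν, hE]; field_simp
    rw [e, div_le_iff₀ hf₀]
    exact mul_le_mul_of_nonneg_left h (by positivity)
  set ν' := ν * (((d : ℝ) - 1) / (d - 2)) with hν'
  have hν'0 : 0 ≤ ν' := by positivity
  have hν'E : ν' * (E * (d - 2)) ≤ d ^ 2 * (d - 1) := by
    have e : ν' * (E * (d - 2)) = ν * E * (d - 1) := by rw [hν']; field_simp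
    rw [e]
    exact mul_le_mul_of_nonneg_right hνE hn.le
  obtain ⟨x, hx⟩ : ∃ x : ℝ, (d : ℝ) = 9 + x := ⟨d - 9, by ring⟩
  have hx0 : 0 ≤ x := by linarith
  have hν'1 : ν' ≤ 1 := by
    have h1 : (d : ℝ) ^ 2 * (d - 1) ≤ 1 * (E * (d - 2)) := by
      rw [hE, hx, ← sub_nonneg]; ring_nf; positivity
    exact le_of_mul_le_mul_right (hν'E.trans h1) (by positivity)
  have hr : √(d : ℝ) ≤ d / 3 := by
    rw [Real.sqrt_le_left (by positivity)]; nlinarith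
  refine isConcurrenceBound_of_quadratic (by omega) hq1 hν'0 hν'1 (C := 81 / 100) (by norm_num)
    ?_ ?_ ?_
  · have h1 : ν' * (8 / 3 * d - 3) ≤ 19 / 100 * d ^ 2 - 1 - d / 3 := by
      have h2 := mul_le_mul_of_nonneg_right hν'E (show (0 : ℝ) ≤ 8 / 3 * d - 3 by linarith)
      have h3 : (d : ℝ) ^ 2 * (d - 1) * (8 / 3 * d - 3) ≤
          (19 / 100 * d ^ 2 - 1 - d / 3) * (E * (d - 2)) := by
        rw [hE, hx, ← sub_nonneg]; ring_nf; positivity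
      refine le_of_mul_le_mul_right ?_ (mul_pos hE0 hn1)
      linarith
    have h4 := mul_le_mul_of_nonneg_left hr (sub_nonneg.2 hν'1)
    linarith
  · intro y hy0 hy1
    have h := ratio_le_one (p := q - 1) (show (2 : ℝ) ≤ d by linarith) (by linarith) hy0 hy1
    rwa [sub_add_cancel] at h
  · intro y hy0 hy
    rcases hy0.eq_or_lt with rfl | hy0
    · have h1 : 0 ≤ concSummand q (0 / d) := by
        rw [zero_div]; exact concSummand_nonneg hq1.le le_rfl zero_le_one
      rw [zero_mul, zero_div, zero_mul]
      refine mul_nonneg ?_ h1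
      have : 0 ≤ (d - 0) / ((d : ℝ) - 1) := by rw [sub_zero]; positivity
      positivity
    refine ratio_mul_le_of_div_le (by linarith) hq1 hν0 hy0 (by linarith) ?_
    have hl0 : 0 < y / d := by positivity
    have hl2 : y / d ≤ 1 / 2 := by rw [div_le_div_iff₀ hd0 two_pos]; linarith
    have h := le_tangent_add_sq_sqrt_sub (F := fun l => l / concSummand q l)
      (c := 81 / 100 / f₀) ha0 ha2
      (fun x hx hx' => hasDerivAt_divSummand hq1 hx (by linarith))
      (fun x hx hx' => hasDerivAt_divSummandDeriv hq1 hx (by linarith))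
      (fun z hz hz' => by
        have hsz : 0 ≤ √(1 / (d : ℝ)) := Real.sqrt_nonneg _
        rw [div_mul_eq_mul_div, le_div_iff₀ hf₀]
        by_cases hk : divSummandDeriv2 q z ≤ 0
        · have h1 : 2 * z * √z * divSummandDeriv2 q z ≤ 0 :=
            mul_nonpos_of_nonneg_of_nonpos (by positivity) hk
          have h2 := mul_nonpos_of_nonpos_of_nonneg h1 hf₀.le
          linarith
        push Not at hk
        have h1 := mul_divSummandDeriv2_le hq hz hz'.le
        have h2 := mul_le_mul_of_nonneg_left (sqrt_mul_concSummand_le hq ha0 ha1 hz)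
          (show 0 ≤ 2 * z * divSummandDeriv2 q z by positivity)
        have h3 := mul_le_mul_of_nonneg_left h1
          (show 0 ≤ 7339 / 20000 * √(1 / (d : ℝ)) by positivity)
        linarith) hl0 hl2
    refine h.trans (le_of_eq ?_)
    have hs : √(1 / (d : ℝ)) ^ 2 = 1 / d := Real.sq_sqrt ha0.le
    have hsy : √(y / d) = √y * √(1 / d) := by rw [← Real.sqrt_mul hy0.le]; congr 1; ring
    have e : (√(y / d) - √(1 / d)) ^ 2 = (√y - 1) ^ 2 * (1 / d) := by
      calc (√(y / d) - √(1 / d)) ^ 2 = (√y - 1) ^ 2 * √(1 / (d : ℝ)) ^ 2 := by rw [hsy]; ring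
        _ = _ := by rw [hs]
    rw [e, divSummandDeriv, ← hf₀def, ← hf₁def, hν]
    field_simp

/-! ### Averages of decreasing bounds -/

/-- Averaging the bound `1 + B (1 - y) + C (√y - 1) ^ 2`, through
`1 - y ≤ (d - 1) / (d - 2) (1 - y (d - y) / (d - 1))`. -/
lemma sum_csWeight_mul_decreasing_le {d : ℕ} {x : Fin d → ℝ} (hd : 3 ≤ d) (hx0 : ∀ i, 0 ≤ x i)
    (hx : ∑ i, x i ^ 2 = d) (hle : ∀ i, x i ^ 2 ≤ d - 1) {a : Fin d → ℝ} {B C : ℝ} (hB0 : 0 ≤ B)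
    (hBd : 2 * (B * d) ≤ 1) (hC0 : 0 ≤ C)
    (hC : 2 * B * (1 + √((d : ℝ) - 1)) ^ 2 / (d - 2) + 2 * C ≤
      7 / 8 * (((d : ℝ) - 2) / (d - 1)) * (1 + 1 / √(d : ℝ)))
    (ha : ∀ i, a i ≤ 1 + B * (1 - min (x i ^ 2) (d - x i ^ 2))
      + C * (√(min (x i ^ 2) (d - x i ^ 2)) - 1) ^ 2) :
    ∑ i, csWeight x i * a i ≤ d := by
  have h3 : (3 : ℝ) ≤ d := by exact_mod_cast hd
  have hn : (0 : ℝ) < d - 1 := by linarith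
  have hn1 : (0 : ℝ) < d - 2 := by linarith
  have hlt : ∀ i, x i ^ 2 < d := fun i => by linarith [hle i]
  obtain ⟨σ, hσ⟩ : ∃ σ : ℝ, ∑ j, x j = d * σ := ⟨(∑ j, x j) / d, by field_simp⟩
  obtain ⟨hσ0, hσ1⟩ := mean_bounds hd hx0 hx hσ
  set m := √((d : ℝ) - 1) with hm
  have hm0 : 0 ≤ m := Real.sqrt_nonneg _
  have hxm : ∀ i, x i ≤ m := fun i => Real.le_sqrt_of_sq_le (hle i)
  have hδ := sq_sqrt_min_sub_one_le hx0 hle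
  set P : Fin d → ℝ := fun i => x i ^ 2 * (d - x i ^ 2) / ((d : ℝ) - 1) with hP
  have hmin : ∀ i, 1 - min (x i ^ 2) (d - x i ^ 2) ≤ ((d : ℝ) - 1) / (d - 2) * (1 - P i) := by
    have key : ∀ y : ℝ, 1 - y ≤ ((d : ℝ) - 1) / (d - 2) * (1 - y * (d - y) / ((d : ℝ) - 1)) := by
      intro y
      have e : ((d : ℝ) - 1) / (d - 2) * (1 - y * (d - y) / ((d : ℝ) - 1)) - (1 - y) =
        (y - 1) ^ 2 / (d - 2) := by field_simp; ring
      have : 0 ≤ (y - 1) ^ 2 / ((d : ℝ) - 2) := by positivity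
      linarith
    intro i
    rcases le_total (x i ^ 2) (d - x i ^ 2) with h | h
    · rw [min_eq_left h]; exact key _
    · rw [min_eq_right h]
      refine (key _).trans (le_of_eq ?_)
      simp only [hP]
      ring
  have hPle : ∀ i, P i - 1 ≤ ((d : ℝ) - 2) ^ 2 / (4 * (d - 1)) := by
    intro i
    have e : ((d : ℝ) - 2) ^ 2 / (4 * (d - 1)) - (P i - 1) =
        (x i ^ 2 - d / 2) ^ 2 / (d - 1) := by
      simp only [hP]; field_simp; ring
    have : 0 ≤ (x i ^ 2 - d / 2) ^ 2 / ((d : ℝ) - 1) := by positivity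
    linarith
  have hterm : ∀ i, csWeight x i * a i ≤ 1 - 7 / 8 * (1 - csWeight x i)
      + B * (((d : ℝ) - 1) / (d - 2)) * (1 - P i) + C * (x i - 1) ^ 2 := by
    intro i
    have hw0 := csWeight_nonneg hd (hlt i).le
    have hw1 := csWeight_le_one hd hx i
    have h1 := mul_le_mul_of_nonneg_left (ha i) hw0
    have h2 : csWeight x i * (C * (√(min (x i ^ 2) (d - x i ^ 2)) - 1) ^ 2) ≤
        1 * (C * (x i - 1) ^ 2) :=
      mul_le_mul hw1 (mul_le_mul_of_nonneg_left (hδ i) hC0) (by positivity) zero_le_one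
    have h4 := mul_le_mul_of_nonneg_left (hmin i) (mul_nonneg hw0 hB0)
    have h5 := mul_le_mul_of_nonneg_left (hPle i) (show
      0 ≤ B * (((d : ℝ) - 1) / (d - 2)) * (1 - csWeight x i) from
      mul_nonneg (by positivity) (by linarith))
    have e : B * (((d : ℝ) - 1) / (d - 2)) * (1 - csWeight x i) *
        (((d : ℝ) - 2) ^ 2 / (4 * (d - 1))) = B * (d - 2) / 4 * (1 - csWeight x i) := by
      field_simp
    rw [e] at h5
    have h6 : B * (d - 2) / 4 * (1 - csWeight x i) ≤ 1 / 8 * (1 - csWeight x i) :=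
      mul_le_mul_of_nonneg_right (by linarith) (by linarith)
    linarith
  have h4 := sum_csWeight_le hd hx hlt hσ rfl
  have h6 := sum_sub_one_sq hx hσ
  have hquart : (((d : ℝ) - 1) * ∑ i, (1 - P i)) = ∑ i, ((x i - 1) * (x i + 1)) ^ 2 := by
    have e1 : ∀ i, 1 - P i = 1 - d / ((d : ℝ) - 1) * x i ^ 2 + 1 / ((d : ℝ) - 1) * x i ^ 4 := by
      intro i; simp only [hP]; field_simp; ring
    have e2 : ∀ i, ((x i - 1) * (x i + 1)) ^ 2 = x i ^ 4 - 2 * x i ^ 2 + 1 := fun i => by ring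
    simp only [e1, e2, Finset.sum_add_distrib, Finset.sum_sub_distrib, ← Finset.mul_sum, hx]
    simp
    field_simp
    ring
  have hvar : ((d : ℝ) - 1) * ∑ i, (1 - P i) ≤ (1 + m) ^ 2 * (2 * d * (1 - σ)) := by
    rw [hquart, ← h6, Finset.mul_sum]
    refine Finset.sum_le_sum fun i _ => ?_
    rw [mul_pow, mul_comm]
    have := pow_le_pow_left₀ (by linarith [hx0 i]) (show x i + 1 ≤ 1 + m by linarith [hxm i]) 2
    exact mul_le_mul_of_nonneg_right this (sq_nonneg _)
  calc ∑ i, csWeight x i * a i ≤ _ := Finset.sum_le_sum fun i _ => hterm i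
    _ = d - 7 / 8 * ∑ i, (1 - csWeight x i)
        + B / (d - 2) * (((d : ℝ) - 1) * ∑ i, (1 - P i)) + C * (2 * d * (1 - σ)) := by
      rw [Finset.sum_add_distrib, Finset.sum_add_distrib, Finset.sum_sub_distrib,
        ← Finset.mul_sum, ← Finset.mul_sum, ← Finset.mul_sum, h6]
      simp
      ring
    _ ≤ d := by
      have h7 := mul_le_mul_of_nonneg_left hvar (show 0 ≤ B / ((d : ℝ) - 2) by positivity)
      have h8 : 7 / 8 * (((d : ℝ) - 2) / (d - 1)) * (1 + 1 / √(d : ℝ)) ≤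
          7 / 8 * (((d : ℝ) - 2) / (d - 1)) * (1 + σ) :=
        mul_le_mul_of_nonneg_left (by linarith) (by positivity)
      have h9 := mul_le_mul_of_nonneg_left (hC.trans h8) (show 0 ≤ (d : ℝ) * (1 - σ) from
        mul_nonneg (by linarith) (by linarith))
      have e1 : (d : ℝ) * (1 - σ) * (2 * B * (1 + m) ^ 2 / (d - 2) + 2 * C) =
        B / (d - 2) * ((1 + m) ^ 2 * (2 * d * (1 - σ))) + C * (2 * d * (1 - σ)) := by ring
      have e2 : (d : ℝ) * (1 - σ) * (7 / 8 * (((d : ℝ) - 2) / (d - 1)) * (1 + σ)) =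
        7 / 8 * (d * (1 - σ ^ 2) * (((d : ℝ) - 2) / (d - 1))) := by ring
      linarith

/-! ### The geometric quotient for exponents between one and two -/

lemma geomQuotDeriv2_nonpos {p s : ℝ} (hp1 : 1 ≤ p) (hp2 : p ≤ 2) (h0 : 0 < s) (h1 : s < 1) :
    geomQuotDeriv2 p s ≤ 0 := by
  have h := nonneg_of_deriv_nonpos (fun s hs => (hasDerivAt_geomQuotDeriv2_mul (p := p) hs).neg)
    (fun s hs _ => by
      have h1 : 0 ≤ p * (p - 1) * (2 - p) :=
        mul_nonneg (mul_nonneg (by linarith) (by linarith)) (by linarith)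
      have := mul_nonneg (mul_nonneg h1 (Real.rpow_nonneg hs.le (p - 3))) (sq_nonneg (1 - s))
      linarith) (by simp) h0 h1.le
  simp only [Pi.neg_apply, ← geomQuotDeriv2_mul h1] at h
  have h3 := pow_pos (sub_pos.2 h1) 3
  by_contra hc
  push Not at hc
  linarith [mul_pos hc h3]

/-- The difference of the two sides, multiplied by `(1 - s) ^ 3`, vanishes at `1` and decreases. -/
lemma neg_geomQuotDeriv2_le {p s : ℝ} (hp1 : 1 ≤ p) (hp2 : p ≤ 2) (h0 : 0 < s) (h1 : s < 1) :
    -geomQuotDeriv2 p s ≤ p * (p - 1) * (2 - p) / 3 / (s * √s) := by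
  set c := p * (p - 1) * (2 - p) with hc
  have hc0 : 0 ≤ c := mul_nonneg (mul_nonneg (by linarith) (by linarith)) (by linarith)
  have hd : ∀ s : ℝ, 0 < s → HasDerivAt (fun s : ℝ => c / 3 * ((1 - s) ^ 3 * s ^ (-(3 / 2) : ℝ))
      + (2 * (1 - s ^ p) - 2 * p * s ^ (p - 1) * (1 - s) - p * (p - 1) * s ^ (p - 2) * (1 - s) ^ 2))
      (c * (1 - s) ^ 2 * s ^ (-(5 / 2) : ℝ) * (s ^ (p - 1 / 2) - (1 + s) / 2)) s := by
    intro s hs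
    have a := ((((hasDerivAt_id s).const_sub 1).pow 3).mul
      (Real.hasDerivAt_rpow_const (p := -(3 / 2)) (Or.inl hs.ne'))).const_mul (c / 3)
    refine (a.add (hasDerivAt_geomQuotDeriv2_mul (p := p) hs)).congr_deriv ?_
    have e1 : s ^ (-(3 / 2) : ℝ) = s * s ^ (-(5 / 2) : ℝ) := by
      rw [← Real.rpow_one_add' hs.le (by norm_num)]; norm_num
    have e2 : s ^ (p - 3) = s ^ (p - 1 / 2) * s ^ (-(5 / 2) : ℝ) := by
      rw [← Real.rpow_add hs]; congr 1; ring
    have e3 : (-(3 / 2) - 1 : ℝ) = -(5 / 2) := by norm_num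
    simp only [id, Pi.pow_apply, e3, e1, e2, hc]
    push_cast
    ring
  have h := nonneg_of_deriv_nonpos hd (fun s hs hs1 => by
    have h2 : s ^ (p - 1 / 2) ≤ (1 + s) / 2 := by
      have h3 : s ^ (p - 1 / 2) ≤ s ^ (1 / 2 : ℝ) :=
        Real.rpow_le_rpow_of_exponent_ge hs hs1.le (by linarith)
      rw [← Real.sqrt_eq_rpow] at h3
      have h4 := Real.sq_sqrt hs.le
      nlinarith [sq_nonneg (√s - 1)]
    have := Real.rpow_nonneg hs.le (-(5 / 2) : ℝ)
    exact mul_nonpos_of_nonneg_of_nonpos (by positivity) (by linarith)) (by simp) h0 h1.le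
  simp only [← geomQuotDeriv2_mul h1] at h
  have e : s ^ (-(3 / 2) : ℝ) = 1 / (s * √s) := by
    rw [Real.rpow_neg h0.le, Real.sqrt_eq_rpow, ← Real.rpow_one_add' h0.le (by norm_num)]
    norm_num
  rw [e] at h
  have h3 := pow_pos (sub_pos.2 h1) 3
  have h5 : 0 ≤ (c / 3 / (s * √s) + geomQuotDeriv2 p s) * (1 - s) ^ 3 := by
    refine h.trans (le_of_eq ?_); ring
  have := nonneg_of_mul_nonneg_left h5 h3
  linarith

lemma geomQuotDeriv_anti {p s t : ℝ} (hp1 : 1 ≤ p) (hp2 : p ≤ 2) (h0 : 0 < s) (hst : s ≤ t)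
    (h1 : t < 1) : geomQuotDeriv p t ≤ geomQuotDeriv p s := by
  have h : AntitoneOn (geomQuotDeriv p) (Set.Icc s t) := by
    refine antitoneOn_of_deriv_nonpos (convex_Icc _ _)
      (fun x hx => (hasDerivAt_geomQuotDeriv (h0.trans_le hx.1)
        (hx.2.trans_lt h1)).continuousAt.continuousWithinAt)
      (fun x hx => ?_) (fun x hx => ?_)
    · rw [interior_Icc] at hx
      exact (hasDerivAt_geomQuotDeriv (h0.trans hx.1)
        (hx.2.trans h1)).differentiableAt.differentiableWithinAt
    · rw [interior_Icc] at hx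
      rw [(hasDerivAt_geomQuotDeriv (h0.trans hx.1) (hx.2.trans h1)).deriv]
      exact geomQuotDeriv2_nonpos hp1 hp2 (h0.trans hx.1) (hx.2.trans h1)
  exact h ⟨le_rfl, hst⟩ ⟨hst, le_rfl⟩ hst

/-- The bound of the second derivative, integrated. -/
lemma geomQuotDeriv_sub_le {p s t : ℝ} (hp1 : 1 ≤ p) (hp2 : p ≤ 2) (h0 : 0 < s) (hst : s ≤ t)
    (h1 : t < 1) : geomQuotDeriv p s - geomQuotDeriv p t ≤
      2 * (p * (p - 1) * (2 - p)) / 3 * (1 / √s - 1 / √t) := by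
  set c := p * (p - 1) * (2 - p) with hc
  have hd : ∀ x, 0 < x → x < 1 → HasDerivAt
      (fun x => geomQuotDeriv p x - 2 * c / 3 * (√x)⁻¹)
      (geomQuotDeriv2 p x + c / 3 / (x * √x)) x := by
    intro x hx0 hx1
    have hs := Real.sqrt_pos.2 hx0
    have a := (((Real.hasDerivAt_sqrt hx0.ne').inv hs.ne').const_mul (2 * c / 3))
    refine ((hasDerivAt_geomQuotDeriv (p := p) hx0 hx1).sub a).congr_deriv ?_
    have e : √x ^ 2 = x := Real.sq_sqrt hx0.le
    rw [e]
    field_simp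
    ring
  have h : MonotoneOn (fun x => geomQuotDeriv p x - 2 * c / 3 * (√x)⁻¹) (Set.Icc s t) := by
    refine monotoneOn_of_deriv_nonneg (convex_Icc _ _)
      (fun x hx => (hd x (h0.trans_le hx.1) (hx.2.trans_lt h1)).continuousAt.continuousWithinAt)
      (fun x hx => ?_) (fun x hx => ?_)
    · rw [interior_Icc] at hx
      exact (hd x (h0.trans hx.1) (hx.2.trans h1)).differentiableAt.differentiableWithinAt
    · rw [interior_Icc] at hx
      rw [(hd x (h0.trans hx.1) (hx.2.trans h1)).deriv]
      linarith [neg_geomQuotDeriv2_le hp1 hp2 (h0.trans hx.1) (hx.2.trans h1)]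
  have := h ⟨le_rfl, hst⟩ ⟨hst, le_rfl⟩ hst
  simp only [one_div]
  linarith

lemma geomQuotDeriv_nonneg {p s : ℝ} (hp1 : 1 ≤ p) (h0 : 0 < s) (h1 : s < 1) :
    0 ≤ geomQuotDeriv p s := by
  have hd : ∀ s : ℝ, 0 < s → HasDerivAt (fun s : ℝ => (1 - s ^ p) - p * s ^ (p - 1) * (1 - s))
      (-(p * (p - 1) * s ^ (p - 1 - 1) * (1 - s))) s := by
    intro s hs
    have a := (Real.hasDerivAt_rpow_const (p := p) (Or.inl hs.ne')).const_sub 1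
    have b := ((Real.hasDerivAt_rpow_const (p := p - 1) (Or.inl hs.ne')).const_mul p).mul
      ((hasDerivAt_id s).const_sub 1)
    refine (a.sub b).congr_deriv ?_
    simp only [id]
    ring
  have h := nonneg_of_deriv_nonpos hd (fun s hs hs1 => by
    have := Real.rpow_nonneg hs.le (p - 1 - 1)
    have : 0 ≤ p - 1 := by linarith
    have : 0 ≤ 1 - s := by linarith
    rw [neg_nonpos]
    positivity) (by simp) h0 h1.le
  have hs := sub_pos.2 h1
  have e : geomQuotDeriv p s = ((1 - s ^ p) - p * s ^ (p - 1) * (1 - s)) / (1 - s) ^ 2 := by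
    rw [geomQuotDeriv, geomQuot]; field_simp
  rw [e]
  exact div_nonneg h (sq_nonneg _)

lemma geomQuotDeriv_le_one {p s : ℝ} (hp1 : 1 ≤ p) (hp2 : p ≤ 2) (h0 : 0 < s) (h1 : s < 1) :
    geomQuotDeriv p s ≤ 1 := by
  have hs := sub_pos.2 h1
  have e : geomQuotDeriv p s = ((1 - s ^ p) - p * s ^ (p - 1) * (1 - s)) / (1 - s) ^ 2 := by
    rw [geomQuotDeriv, geomQuot]; field_simp
  have h2 : s ^ (2 - p) ≤ 1 + (2 - p) * (s - 1) := by
    have := rpow_one_add_le_one_add_mul_self (s := s - 1) (by linarith)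
      (show 0 ≤ 2 - p by linarith) (by linarith)
    rwa [add_sub_cancel] at this
  have hz : 0 < s ^ (2 - p) := Real.rpow_pos_of_pos h0 _
  set z := s ^ (2 - p) with hzdef
  have e1 : s ^ (p - 1) = s / z := by
    rw [hzdef, eq_div_iff (by positivity), ← Real.rpow_add h0]
    norm_num
  have e2 : s ^ p = s ^ 2 / z := by
    rw [hzdef, eq_div_iff (by positivity), ← Real.rpow_add h0, ← Real.rpow_two]
    norm_num
  rw [e, div_le_one (by positivity), e1, e2]
  have h3 : s * (2 - s) * z ≤ s ^ 2 + p * s * (1 - s) := by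
    have h4 := mul_le_mul_of_nonneg_left h2 (show 0 ≤ s * (2 - s) by nlinarith)
    have h5 : 0 ≤ s * ((2 - p) * (1 - s) ^ 2) :=
      mul_nonneg h0.le (mul_nonneg (by linarith) (sq_nonneg _))
    nlinarith
  rw [← le_div_iff₀ hz] at h3
  have e3 : (s ^ 2 + p * s * (1 - s)) / z = s ^ 2 / z + p * (s / z) * (1 - s) := by ring
  rw [e3] at h3
  nlinarith

lemma one_add_mul_le_geomQuot {p s : ℝ} (hp1 : 1 ≤ p) (hp2 : p ≤ 2) (h0 : 0 < s) (h1 : s < 1) :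
    1 + (p - 1) * s ≤ geomQuot p s := by
  have h2 : s ^ (p - 1) ≤ 1 + (p - 1) * (s - 1) := by
    have := rpow_one_add_le_one_add_mul_self (s := s - 1) (by linarith)
      (show 0 ≤ p - 1 by linarith) (by linarith)
    rwa [add_sub_cancel] at this
  have e : s ^ p = s ^ (p - 1) * s := by rw [← Real.rpow_add_one h0.ne']; norm_num
  rw [geomQuot, le_div_iff₀ (sub_pos.2 h1), e]
  nlinarith [mul_le_mul_of_nonneg_right h2 h0.le]

lemma geomQuot_add_mono {p l m : ℝ} (hp1 : 1 ≤ p) (hp2 : p ≤ 2) (h0 : 0 < l) (hlm : l ≤ m)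
    (h1 : m ≤ 1 / 2) :
    geomQuot p l + geomQuot p (1 - l) ≤ geomQuot p m + geomQuot p (1 - m) := by
  have hd : ∀ x, l ≤ x → x ≤ m → HasDerivAt (fun l => geomQuot p l + geomQuot p (1 - l))
      (geomQuotDeriv p x - geomQuotDeriv p (1 - x)) x :=
    fun x hx hx' => hasDerivAt_geomQuot_add (by linarith) (by linarith)
  have h : MonotoneOn (fun l => geomQuot p l + geomQuot p (1 - l)) (Set.Icc l m) := by
    refine monotoneOn_of_deriv_nonneg (convex_Icc _ _)
      (fun x hx => (hd x hx.1 hx.2).continuousAt.continuousWithinAt)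
      (fun x hx => ?_) (fun x hx => ?_)
    · rw [interior_Icc] at hx
      exact (hd x hx.1.le hx.2.le).differentiableAt.differentiableWithinAt
    · rw [interior_Icc] at hx
      rw [(hd x hx.1.le hx.2.le).deriv, sub_nonneg]
      exact geomQuotDeriv_anti hp1 hp2 (by linarith [hx.1]) (by linarith [hx.2])
        (by linarith [hx.1])
  exact h ⟨le_rfl, hlm⟩ ⟨hlm, le_rfl⟩ hlm

lemma add_one_le_geomQuot_add {p l : ℝ} (hp1 : 1 ≤ p) (hp2 : p ≤ 2) (h0 : 0 < l) (h1 : l < 1) :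
    p + 1 ≤ geomQuot p l + geomQuot p (1 - l) := by
  linarith [one_add_mul_le_geomQuot hp1 hp2 h0 h1,
    one_add_mul_le_geomQuot hp1 hp2 (show 0 < 1 - l by linarith) (by linarith)]

/-- The sum is at most its value `4 (1 - 2 ^ (-p))` at `1 / 2`. -/
lemma geomQuot_add_le {p l : ℝ} (hp1 : 1 ≤ p) (hp2 : p ≤ 2) (h0 : 0 < l) (h1 : l ≤ 1 / 2) :
    geomQuot p l + geomQuot p (1 - l) ≤ 18 / 17 * (p + 1) := by
  refine (geomQuot_add_mono hp1 hp2 h0 h1 le_rfl).trans ?_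
  obtain ⟨t, rfl⟩ : ∃ t, p = 1 + t := ⟨p - 1, by ring⟩
  have ht0 : 0 ≤ t := by linarith
  have ht1 : t ≤ 1 := by linarith
  have hs : √2 ≤ 1.4143 := by rw [Real.sqrt_le_left (by norm_num)]; norm_num
  have h2 : (2 : ℝ) ^ t ≤ (1 + 0.4143 * t) ^ 2 := by
    have h3 := rpow_one_add_le_one_add_mul_self (s := √2 - 1)
      (by linarith [Real.sqrt_nonneg 2]) ht0 ht1
    rw [add_sub_cancel] at h3
    have e : (2 : ℝ) ^ t = (√2 ^ t) ^ 2 := by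
      rw [← Real.rpow_natCast, ← Real.rpow_mul (Real.sqrt_nonneg _), mul_comm, Real.rpow_mul
        (Real.sqrt_nonneg _), Real.rpow_natCast, Real.sq_sqrt zero_le_two]
    rw [e]
    refine pow_le_pow_left₀ (Real.rpow_nonneg (Real.sqrt_nonneg _) _) (h3.trans ?_) 2
    nlinarith
  have hz : 0 < (2 : ℝ) ^ t := Real.rpow_pos_of_pos two_pos t
  have e : (1 / 2 : ℝ) ^ (1 + t) = 1 / 2 * (1 / 2 ^ t) := by
    rw [Real.rpow_add (by norm_num), Real.rpow_one, Real.div_rpow zero_le_one zero_le_two,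
      Real.one_rpow]
  -- equivalent to the claim at `l = 1 / 2`
  have h4 : (16 - 9 * t) / 17 ≤ 1 / (2 : ℝ) ^ t := by
    rw [div_le_div_iff₀ (by norm_num) hz]
    have h5 := mul_le_mul_of_nonneg_left h2 (show 0 ≤ 16 - 9 * t by linarith)
    have h6 : (16 - 9 * t) * (1 + 0.4143 * t) ^ 2 ≤ 1 * 17 := by
      nlinarith [sq_nonneg (t - 0.4), mul_nonneg ht0 (sq_nonneg (t - 0.4)), mul_nonneg ht0 ht0]
    linarith
  have e2 : (1 : ℝ) - 1 / 2 = 1 / 2 := by norm_num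
  rw [e2, geomQuot, e, e2]
  linarith

/-! ### Exponents between two and three -/

lemma six_mul_le {p : ℝ} (hp1 : 1 ≤ p) : 6 * (p * (p - 1) * (2 - p)) ≤ p + 1 := by
  obtain ⟨t, rfl⟩ : ∃ t, p = 1 + t := ⟨p - 1, by ring⟩
  have ht0 : 0 ≤ t := by linarith
  nlinarith [mul_nonneg ht0 (sq_nonneg (t - 1 / 2)), sq_nonneg (t - 1 / 2)]

/-- Here `h₀` stands for the value of the sum of the geometric quotients at `1 / d`. -/
lemma mul_sqrt_mul_invSummandDeriv2_le_of_le_two {p l h₀ : ℝ} (hp1 : 1 ≤ p) (hp2 : p ≤ 2)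
    (h0 : 0 < l) (h1 : l ≤ 1 / 2) (hh₀ : 0 < h₀) (hh₀' : h₀ ≤ 18 / 17 * (p + 1)) :
    2 * l * √l * invSummandDeriv2 p l * h₀ ≤ 3 / 10 := by
  have hm : 0 < 1 - l := by linarith
  have hm1 : 1 - l < 1 := by linarith
  set c := p * (p - 1) * (2 - p) with hc
  have hc0 : 0 ≤ c := mul_nonneg (mul_nonneg (by linarith) (by linarith)) (by linarith)
  have hcQ : 6 * c ≤ p + 1 := six_mul_le hp1
  set h := geomQuot p l + geomQuot p (1 - l) with hh
  have hQ : p + 1 ≤ h := add_one_le_geomQuot_add hp1 hp2 h0 (by linarith)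
  set u := geomQuotDeriv p l - geomQuotDeriv p (1 - l) with hu
  have hs := Real.sqrt_pos.2 h0
  have hsm := Real.sqrt_pos.2 hm
  have hs2 := Real.sq_sqrt h0.le
  have hu0 : 0 ≤ u := by
    rw [hu, sub_nonneg]; exact geomQuotDeriv_anti hp1 hp2 h0 (by linarith) hm1
  have hu1 : √l * u ≤ (p + 1) / 9 := by
    have h2 := geomQuotDeriv_sub_le hp1 hp2 h0 (show l ≤ 1 - l by linarith) hm1
    have h3 : u ≤ 2 * c / 3 * (1 / √l) := by
      refine h2.trans (mul_le_mul_of_nonneg_left ?_ (by positivity))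
      have : 0 ≤ 1 / √(1 - l) := by positivity
      linarith
    have h4 := mul_le_mul_of_nonneg_left h3 hs.le
    have e : √l * (2 * c / 3 * (1 / √l)) = 2 * c / 3 := by field_simp
    linarith
  have hs1 : √l ≤ 3 / 4 := by rw [Real.sqrt_le_left (by norm_num)]; linarith
  have hA : 2 * l * √l * (2 * u ^ 2) ≤ (p + 1) ^ 2 / 27 := by
    have h2 : (√l * u) ^ 2 ≤ ((p + 1) / 9) ^ 2 := pow_le_pow_left₀ (by positivity) hu1 2
    calc 2 * l * √l * (2 * u ^ 2) = 4 * √l * (√l * u) ^ 2 := by rw [mul_pow, hs2]; ring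
      _ ≤ 4 * (3 / 4) * ((p + 1) / 9) ^ 2 := by gcongr
      _ = _ := by ring
  set S := geomQuotDeriv2 p l + geomQuotDeriv2 p (1 - l) with hS
  have hB : 2 * l * √l * (-S) ≤ 2 / 9 * (p + 1) := by
    have h2 := neg_geomQuotDeriv2_le hp1 hp2 h0 (show l < 1 by linarith)
    have h3 := neg_geomQuotDeriv2_le hp1 hp2 hm hm1
    have h4 : c / 3 / ((1 - l) * √(1 - l)) ≤ c / 3 / (l * √l) := by
      have := Real.sqrt_le_sqrt (show l ≤ 1 - l by linarith)
      gcongr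
      linarith
    have h5 : -S ≤ 2 * (c / 3 / (l * √l)) := by linarith
    have h6 := mul_le_mul_of_nonneg_left h5 (show 0 ≤ 2 * l * √l by positivity)
    have e : 2 * l * √l * (2 * (c / 3 / (l * √l))) = 4 / 3 * c := by field_simp; ring
    linarith
  have hp0 : 0 < p + 1 := by linarith
  have hh0 : 0 < h := by linarith
  have hmain : 2 * l * √l * (2 * u ^ 2 - h * S) * h₀ ≤ 3 / 10 * h ^ 3 := by
    have h2 : 2 * l * √l * (2 * u ^ 2 - h * S) ≤ (p + 1) ^ 2 / 27 + h * (2 / 9 * (p + 1)) := by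
      have := mul_le_mul_of_nonneg_left hB hh0.le
      linarith
    have h3 := mul_le_mul_of_nonneg_right h2 hh₀.le
    have h4 : ((p + 1) ^ 2 / 27 + h * (2 / 9 * (p + 1))) * h₀ ≤
        (h ^ 2 / 27 + h * (2 / 9 * h)) * (18 / 17 * h) := by
      have : h₀ ≤ 18 / 17 * h := by linarith
      gcongr
    have h5 : 0 < h ^ 3 := by positivity
    linarith
  rw [invSummandDeriv2, mul_div_assoc', div_mul_eq_mul_div, div_le_iff₀ (pow_pos hh0 3)]
  exact hmain

/-- For these exponents `invSummand p` decreases on `(0, 1 / 2]`, with slope `-B` at `1 / d` relative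
to its value there. -/
lemma isConcurrenceBound_of_le_three {d : ℕ} (hd : 3 ≤ d) {q : ℝ} (hq2 : 2 ≤ q) (hq3 : q ≤ 3) :
    IsConcurrenceBound d q (d * concSummand q (1 / d) / ((d : ℝ) - 1) ^ 2) := by
  obtain ⟨p, rfl⟩ : ∃ p, q = p + 1 := ⟨q - 1, by ring⟩
  have hp1 : 1 ≤ p := by linarith
  have hp2 : p ≤ 2 := by linarith
  have hp0 : 0 < p := by linarith
  have h3 : (3 : ℝ) ≤ d := by exact_mod_cast hd
  have hd0 : (0 : ℝ) < d := by linarith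
  have hn : (0 : ℝ) < d - 1 := by linarith
  have ha0 : (0 : ℝ) < 1 / d := by positivity
  have ha1 : (1 : ℝ) / d < 1 := by rw [div_lt_one hd0]; linarith
  have ha2 : (1 : ℝ) / d ≤ 1 / 2 := by gcongr; linarith
  set κ := invSummand p (1 / d) with hκdef
  have hκ : 0 < κ := invSummand_pos hp0 ha0 ha1
  set h₀ := geomQuot p (1 / d) + geomQuot p (1 - 1 / d) with hh₀
  have hκh : κ = 1 / h₀ := rfl
  have hh₀Q : p + 1 ≤ h₀ := add_one_le_geomQuot_add hp1 hp2 ha0 ha1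
  have hh₀Q' : h₀ ≤ 18 / 17 * (p + 1) := geomQuot_add_le hp1 hp2 ha0 ha2
  have hh₀0 : 0 < h₀ := by linarith
  set u := geomQuotDeriv p (1 / d) - geomQuotDeriv p (1 - 1 / d) with hu
  have hu0 : 0 ≤ u := by
    rw [hu, sub_nonneg]; exact geomQuotDeriv_anti hp1 hp2 ha0 (by linarith) (by linarith)
  have hu1 : u ≤ 1 := by
    linarith [geomQuotDeriv_le_one hp1 hp2 ha0 ha1,
      geomQuotDeriv_nonneg hp1 (show 0 < 1 - 1 / (d : ℝ) by linarith) (by linarith)]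
  set r := √(d : ℝ) with hr
  have hr0 : 0 < r := Real.sqrt_pos.2 hd0
  have hr2 : r ^ 2 = d := Real.sq_sqrt hd0.le
  set m := √((d : ℝ) - 1) with hm
  have hm2 : m ^ 2 = d - 1 := Real.sq_sqrt hn.le
  have hm0 : 0 < m := Real.sqrt_pos.2 hn
  have hm1 : 141 / 100 ≤ m := Real.le_sqrt_of_sq_le (by linarith)
  have hr1 : 17 / 10 ≤ r := Real.le_sqrt_of_sq_le (by linarith)
  set B := 1 / d * u / h₀ with hB
  have hB0 : 0 ≤ B := by positivity
  have hsa : √(1 / (d : ℝ)) = 1 / r := by rw [Real.sqrt_div zero_le_one, Real.sqrt_one]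
  have hsm : √(1 - 1 / (d : ℝ)) = m / r := by
    rw [← Real.sqrt_div hn.le]; congr 1; field_simp
  have hBr : B * (9 * r * m) ≤ m - 1 := by
    have h2 := geomQuotDeriv_sub_le hp1 hp2 ha0 (show 1 / (d : ℝ) ≤ 1 - 1 / d by linarith)
      (by linarith)
    rw [hsa, hsm, ← hu] at h2
    have h4 : 1 / (1 / r) - 1 / (m / r) = r * (m - 1) / m := by field_simp
    rw [h4] at h2
    have h5 : u ≤ h₀ / 9 * (r * (m - 1) / m) := by
      refine h2.trans (mul_le_mul_of_nonneg_right ?_ ?_)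
      · linarith [six_mul_le hp1]
      · have : 0 ≤ m - 1 := by linarith
        positivity
    have h6 := mul_le_mul_of_nonneg_right h5 (show 0 ≤ 9 * m / (r * h₀) by positivity)
    have e1 : u * (9 * m / (r * h₀)) = B * (9 * r * m) := by
      rw [hB, ← hr2]; field_simp
    have e2 : h₀ / 9 * (r * (m - 1) / m) * (9 * m / (r * h₀)) = m - 1 := by field_simp
    linarith
  have hBd : 2 * (B * d) ≤ 1 := by
    have e : 2 * (B * d) = 2 * u / h₀ := by rw [hB]; field_simp
    rw [e, div_le_one hh₀0]; linarith
  have hsmall : ∀ y : ℝ, 0 ≤ y → y ≤ 1 →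
      y * (d - y) / ((d : ℝ) - 1) * concSummand (p + 1) (1 / d) ≤
        18 / 17 * concSummand (p + 1) (y / d) := by
    intro y hy0 hy1
    rcases hy0.eq_or_lt with rfl | hy0
    · have : 0 ≤ concSummand (p + 1) (0 / d) := by
        rw [zero_div]; exact concSummand_nonneg (by linarith) le_rfl zero_le_one
      rw [zero_mul, zero_div, zero_mul]
      positivity
    refine ratio_mul_le_of_invSummand_le (by linarith) hp0 hy0 (by linarith) ?_
    have hl0 : 0 < y / d := by positivity
    have hl1 : y / d < 1 := by rw [div_lt_one hd0]; linarith
    have hQ := add_one_le_geomQuot_add hp1 hp2 hl0 hl1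
    rw [← hκdef, hκh, invSummand, div_mul_eq_mul_div, one_mul,
      div_le_div_iff₀ (by linarith) hh₀0]
    linarith
  refine isConcurrenceBound_of_ratio_bound hd (by linarith)
    (A := fun y => 1 + B * (1 - y) + 3 / 10 / r * (√y - 1) ^ 2) hsmall ?_ ?_ ?_
  · intro y hy0 hy
    have h4 : B * y ≤ B * (d / 2) := mul_le_mul_of_nonneg_left hy hB0
    have : 0 ≤ 3 / 10 / r * (√y - 1) ^ 2 := by positivity
    linarith
  · intro y hy0 hy
    rcases hy0.eq_or_lt with rfl | hy0
    · have h1 : 0 ≤ concSummand (p + 1) (0 / d) := by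
        rw [zero_div]; exact concSummand_nonneg (by linarith) le_rfl zero_le_one
      rw [zero_mul, zero_div, zero_mul]
      refine mul_nonneg ?_ h1
      have : 0 ≤ 3 / 10 / r * (√0 - 1) ^ 2 := by positivity
      linarith
    refine ratio_mul_le_of_invSummand_le (by linarith) hp0 hy0 (by linarith) ?_
    have hl0 : 0 < y / d := by positivity
    have hl2 : y / d ≤ 1 / 2 := by rw [div_le_div_iff₀ hd0 two_pos]; linarith
    have hsy : √(y / d) = √y / r := Real.sqrt_div hy0.le _
    have h := le_tangent_add_sq_sqrt_sub (F := invSummand p) (c := 3 / 10 * r / h₀) ha0 ha2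
      (fun x hx hx' => hasDerivAt_invSummand hp0 hx (by linarith))
      (fun x hx hx' => hasDerivAt_invSummandDeriv hp0 hx (by linarith))
      (fun x hx hx' => by
        have := mul_sqrt_mul_invSummandDeriv2_le_of_le_two hp1 hp2 hx hx'.le hh₀0 hh₀Q'
        rw [← le_div_iff₀ hh₀0] at this
        refine this.trans (le_of_eq ?_)
        rw [hsa]; field_simp) hl0 hl2
    refine h.trans (le_of_eq ?_)
    rw [hsa, hsy, ← hκdef, hB, invSummandDeriv, ← hh₀, ← hu, hκh, ← hr2]
    field_simp
    ring
  · intro x hx0 hx hle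
    refine sum_csWeight_mul_decreasing_le hd hx0 hx hle hB0 hBd
      (show 0 ≤ 3 / 10 / r by positivity) ?_ (fun i => le_rfl)
    have h4 : 2 * B * (1 + m) ^ 2 / (d - 2) ≤ 19 / 50 / r := by
      have e : (d : ℝ) - 2 = (m - 1) * (m + 1) := by linarith
      have hm3 : 0 < m - 1 := by linarith
      rw [e, div_le_div_iff₀ (by positivity) hr0]
      have h5 := mul_le_mul_of_nonneg_right hBr (show 0 ≤ (1 + m) ^ 2 / (9 * m) by positivity)
      have e1 : B * (9 * r * m) * ((1 + m) ^ 2 / (9 * m)) = B * (1 + m) ^ 2 * r := by field_simp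
      have e2 : (m - 1) * ((1 + m) ^ 2 / (9 * m)) = (m - 1) * (1 + m) * ((1 + m) / (9 * m)) := by
        ring
      have h6 : (1 + m) / (9 * m) ≤ 19 / 100 := by
        rw [div_le_div_iff₀ (by positivity) (by norm_num)]; linarith
      have h7 := mul_le_mul_of_nonneg_left h6 (show 0 ≤ (m - 1) * (1 + m) by positivity)
      linarith
    have h5 : (1 : ℝ) / 2 ≤ (d - 2) / (d - 1) := by
      rw [div_le_div_iff₀ two_pos hn]; linarith
    have h6 : 7 / 8 * (1 / 2) * (1 + 1 / r) ≤ 7 / 8 * (((d : ℝ) - 2) / (d - 1)) * (1 + 1 / r) := by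
      gcongr
    have h7 : 49 / 50 / r ≤ 7 / 8 * (1 / 2) * (1 + 1 / r) := by
      rw [div_le_iff₀ hr0]
      have : 7 / 8 * (1 / 2) * (1 + 1 / r) * r = 7 / 16 * (r + 1) := by field_simp; norm_num
      rw [this]; linarith
    have e : (19 : ℝ) / 50 / r + 2 * (3 / 10 / r) = 49 / 50 / r := by ring
    linarith

/-! ### The coefficients -/

lemma coefficient_eq {d : ℕ} (hd : 2 ≤ d) (q : ℝ) :
    ((d : ℝ) - (d : ℝ) ^ (1 - q) * (1 + ((d : ℝ) - 1) ^ q)) / ((d : ℝ) - 1) ^ 2 =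
      d * concSummand q (1 / d) / ((d : ℝ) - 1) ^ 2 := by
  have h2 : (2 : ℝ) ≤ d := by exact_mod_cast hd
  have hd0 : (0 : ℝ) < d := by linarith
  have e1 : (d : ℝ) ^ (1 - q) = d / (d : ℝ) ^ q := by rw [Real.rpow_sub hd0, Real.rpow_one]
  have e2 : (1 / (d : ℝ)) ^ q = 1 / (d : ℝ) ^ q := by
    rw [Real.div_rpow zero_le_one hd0.le, Real.one_rpow]
  have e3 : (1 - 1 / (d : ℝ)) ^ q = ((d : ℝ) - 1) ^ q / (d : ℝ) ^ q := by
    rw [← Real.div_rpow (by linarith) hd0.le]; congr 1; field_simp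
  rw [concSummand, e1, e2, e3]
  ring

lemma isConcurrenceBound_of_three_le_card {d : ℕ} (hd : 3 ≤ d) {q : ℝ} (hq : 2 ≤ q) :
    IsConcurrenceBound d q (d * concSummand q (1 / d) / ((d : ℝ) - 1) ^ 2) := by
  rcases le_total q 3 with h3 | h3
  · exact isConcurrenceBound_of_le_three hd hq h3
  rcases le_or_gt d 8 with h8 | h8
  · exact isConcurrenceBound_of_le_eight hd h8 h3
  rcases le_total q 14 with h14 | h14
  · exact isConcurrenceBound_of_le_fourteen h8 h3 h14
  · exact isConcurrenceBound_of_fourteen_le h8 h14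

lemma concSummand_half (q : ℝ) : concSummand q (1 / 2) = 1 - 2 ^ (1 - q) := by
  have e1 : (1 / 2 : ℝ) ^ q = 1 / 2 ^ q := by
    rw [Real.div_rpow zero_le_one zero_le_two, Real.one_rpow]
  have e2 : (2 : ℝ) ^ (1 - q) = 2 / 2 ^ q := by rw [Real.rpow_sub two_pos, Real.rpow_one]
  have e3 : (1 : ℝ) - 1 / 2 = 1 / 2 := by norm_num
  rw [concSummand, e3, e1, e2]
  ring

end QuantumBipartite

theorem theorem2 (d : ℕ) (ρ : QuantumBipartite.BipartiteMatrix d)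
    (hρ : QuantumBipartite.IsState ρ) :
    (∀ q : ℝ, (3 ≤ d ∧ 2 ≤ q) ∨ (d = 2 ∧ 4 ≤ q) →
      ((d : ℝ) - (d : ℝ) ^ (1 - q) * (1 + ((d : ℝ) - 1) ^ q)) / ((d : ℝ) - 1) ^ 2 *
          (max (QuantumBipartite.traceNorm (QuantumBipartite.partialTransposeB ρ))
            (QuantumBipartite.traceNorm (QuantumBipartite.realignment ρ)) - 1) ^ 2
        ≤ QuantumBipartite.totalConcurrence q ρ) ∧
    (∀ s q : ℝ, |s - 3.339| ≤ 0.001 → d = 2 → s ≤ q → q < 4 →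
      (1 - (2 : ℝ) ^ (1 - q)) / (1 - (2 : ℝ) ^ (1 - s)) *
          (max (QuantumBipartite.traceNorm (QuantumBipartite.partialTransposeB ρ))
            (QuantumBipartite.traceNorm (QuantumBipartite.realignment ρ)) - 1) ^ 2
        ≤ QuantumBipartite.totalConcurrence q ρ ∧
      (¬ QuantumBipartite.IsSeparable ρ →
        (1 - (2 : ℝ) ^ (1 - q)) / (1 - (2 : ℝ) ^ (1 - s)) *
            (max (QuantumBipartite.traceNorm (QuantumBipartite.partialTransposeB ρ))
              (QuantumBipartite.traceNorm (QuantumBipartite.realignment ρ)) - 1) ^ 2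
          < QuantumBipartite.totalConcurrence q ρ)) := by
  constructor
  · rintro q (⟨hd, hq⟩ | ⟨rfl, hq⟩)
    · have h3 : (3 : ℝ) ≤ d := by exact_mod_cast hd
      rw [QuantumBipartite.coefficient_eq (by omega)]
      refine (QuantumBipartite.isConcurrenceBound_of_three_le_card hd hq).le_totalConcurrence ?_ hρ
      have := QuantumBipartite.concSummand_nonneg (q := q) (t := 1 / d) (by linarith)
        (by positivity) (by rw [div_le_one (by linarith)]; linarith)
      positivity
    · rw [QuantumBipartite.coefficient_eq le_rfl]
      have h := (QuantumBipartite.isConcurrenceBound_two (show 3 ≤ q by linarith))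
      have hg := QuantumBipartite.concSummand_nonneg (q := q) (t := 1 / 2) (by linarith)
        (by norm_num) (by norm_num)
      refine le_trans (le_of_eq ?_) (h.le_totalConcurrence (by positivity) hρ)
      congr 1
      push_cast
      norm_num
  · rintro s q hs rfl hsq hq4
    rw [abs_le] at hs
    have hs3 : 3 < s := by linarith [hs.1]
    have h := QuantumBipartite.isConcurrenceBound_two (show 3 ≤ q by linarith)
    rw [QuantumBipartite.concSummand_half] at h
    have hhalf : (2 : ℝ) ^ (1 - s) < 1 / 2 := by
      have : (2 : ℝ) ^ (1 - s) < (2 : ℝ) ^ (-1 : ℝ) :=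
        Real.rpow_lt_rpow_of_exponent_lt (by norm_num) (by linarith)
      rwa [Real.rpow_neg_one, inv_eq_one_div] at this
    have hqs : (2 : ℝ) ^ (1 - q) ≤ (2 : ℝ) ^ (1 - s) :=
      Real.rpow_le_rpow_of_exponent_le (by norm_num) (by linarith)
    set A := 1 - (2 : ℝ) ^ (1 - q) with hA
    set D := 1 - (2 : ℝ) ^ (1 - s) with hD
    have hA0 : 0 < A := by linarith
    have hD2 : 1 / 2 < D := by linarith
    have hD0 : 0 < D := by linarith
    set T := (max (QuantumBipartite.traceNorm (QuantumBipartite.partialTransposeB ρ))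
            (QuantumBipartite.traceNorm (QuantumBipartite.realignment ρ)) - 1) ^ 2 with hT
    have hT0 : 0 ≤ T := sq_nonneg _
    have hle := h.le_totalConcurrence (by positivity) hρ
    rw [← hT] at hle
    have hKT : A / D * T = 1 / (2 * D) * (2 * A * T) := by field_simp
    -- the coefficient falls short of the optimal `2 A` by the factor `1 / (2 D) < 1`
    have hr1 : 1 / (2 * D) < 1 := by rw [div_lt_one (by positivity)]; linarith
    have hr0 : 0 ≤ 2 * A * T := by positivity
    rw [hKT]
    refine ⟨le_trans ?_ hle, fun hsep => ?_⟩
    · exact mul_le_of_le_one_left hr0 hr1.le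
    · have hpos := h.totalConcurrence_pos (by positivity) hρ hsep
      have h1 : 1 / (2 * D) * (2 * A * T) ≤
          1 / (2 * D) * QuantumBipartite.totalConcurrence q ρ :=
        mul_le_mul_of_nonneg_left hle (by positivity)
      refine h1.trans_lt ?_
      exact mul_lt_of_lt_one_left hpos hr1
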